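/- **Theorem 2.1.** Let $H$ and $G$ be (real or complex) Hilbert spaces with norms $|\cdot|$, $|\cdot|_G$, and let $A:D(A)\subset H\to H$ satisfy (A1) $A$ is self-adjoint and nonnegative, and there is $\omega>0$ with $|Au|\ge\omega|u|$ for all $u\in D(A)$. Put $H_0=H$, $H_1=D(A^{1/2})$ with norm $|A^{1/2}\cdot|$, $H_2=D(A)$ with norm $|A\cdot|$, and let $H_{-1}$ and $H_2'$ be the duals of $H_1$ and $H_2$ with pivot space $H$. For $w\in H_1$, $w'\in H$ put $e_1(w,w')=\frac12(|A^{1/2}w|^2+|w'|^2)$. By a solution on $[0,T]$ of $w''+Aw=f$ with $f\in C([0,T];H)$ we mean a strict solution, $w\in C([0,T];D(A))\cap C^2([0,T];H)$; we write $W=(w,w')$. Let $C$ and $\Pi_p$ be bounded operators in $H$. Let $B$ be a control operator, either bounded, $B\in\mathcal L(G,H)$, in which case we put $\mathbf B^*(w,w')=B^*w'$, or unbounded, $B\in\mathcal L(G,H_2')$, in which case we put $\mathbf B^*(w,w')=B^*w$. Assume: (A2) for every $T>0$ there is $K>0$ such that all solutions of $w''+Aw=f$ on $[0,T]$ satisfy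 $$\int_0^T|\mathbf B^*(w,w')|_G^2\,dt\le K\Big(e_1(W(0))+e_1(W(T))+\int_0^Te_1(W(t))\,dt+\int_0^T|f|^2\,dt\Big);$$ (A3) there are $T_1>0$ and $T_2>0$ such that for every $T>T_1$ (resp. every $T>T_2$) there is $C_1(T)>0$ (resp. $C_2(T)>0$) such that all solutions of $w''+Aw=0$ on $[0,T]$ satisfy $$\int_0^T|\mathbf B^*(w,w')|_G^2\,dt\ge C_1(T)\,e_1(W(0))\qquad\Big(\text{resp. }\int_0^T|\Pi_pw'|^2\,dt\ge C_2(T)\,e_1(W(0))\Big);$$ (A4) $C\in\mathcal L(H_k)$ for $k=0,1,2$; with $\beta=\|C\|_{\mathcal L(H)}$, $|Cw|^2\le\beta\,\mathrm{Re}\langle Cw,w\rangle$ for all $w\in H$; and there is $\alpha>0$ with $\alpha|\Pi_pw|^2\le\mathrm{Re}\langle Cw,w\rangle$ for all $w\in H$. Consider the cascade system $$y_1''+Ay_1+C^*y_2=0,\qquad y_2''+Ay_2=Bv,\qquad (y_i,y_i')(0)=(y_i^0,y_i^1),\quad i=1,2,\tag{1}$$ with initial data $Y_0=(y_1^0,y_2^0,y_1^1,y_2^1)$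 and state $Y=(y_1,y_2,y_1',y_2')$, where $C^*$ is the adjoint of $C$ in $H$ and solutions are understood by transposition. That is, $y''+Ay=F$, $y(0)=y^0$, $y'(0)=y^1$ on $[0,T]$ means that for every $t\in[0,T]$, every $f\in C([0,t];H)$ and every strict solution $\theta$ of $\theta''+A\theta=f$ on $[0,t]$, $$\langle y'(t),\theta(t)\rangle-\langle y(t),\theta'(t)\rangle=\langle y^1,\theta(0)\rangle-\langle y^0,\theta'(0)\rangle+\int_0^t\big(\langle F(s),\theta(s)\rangle-\langle y(s),f(s)\rangle\big)ds.$$ (i) Let $B\in\mathcal L(G,H)$, $\mathbf B^*(w,w')=B^*w'$. Then there is $T^*\ge\max(T_1,T_2)$ such that for all $T>T^*$ and all $Y_0\in H_2\times H_1\times H_1\times H_0$ there is a control $v\in L^2((0,T);G)$ such that (1) has a unique solution $Y\in C([0,T];H_2\times H_1\times H_1\times H_0)$, and $Y(T)=0$. (ii) Let $B\in\mathcal L(G,H_2')$, $\mathbf B^*(w,w')=B^*w$. Then there is $T^*\ge\max(T_1,T_2)$ such that for all $T>T^*$ and all $Y_0\in H_1\times H_0\times H_0\times H_{-1}$ there is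 a control $v\in L^2((0,T);G)$ such that (1) has a unique solution $Y\in C([0,T];H_1\times H_0\times H_0\times H_{-1})$, and $Y(T)=0$. -/

import Mathlib

open RCLike MeasureTheory

noncomputable section

namespace Cascade

variable {𝕜 H G : Type*} [RCLike 𝕜]
  [NormedAddCommGroup H] [InnerProductSpace 𝕜 H] [CompleteSpace H]
  [NormedAddCommGroup G] [InnerProductSpace 𝕜 G] [CompleteSpace G]

/-! ### The square root of a bounded nonnegative self-adjoint operator -/

theorem sum_catalan_le (N : ℕ) :
    ∑ n ∈ Finset.range N, (catalan n : ℝ) / 4 ^ n ≤ 2 := by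
  induction N with
  | zero => simp
  | succ N ih =>
    set a : ℕ → ℝ := fun n => (catalan n : ℝ) / 4 ^ n with ha
    have ha0 : ∀ n, 0 ≤ a n := fun n => by positivity
    have hrec : ∀ n, a (n + 1) = (1 / 4) * ∑ p ∈ Finset.HasAntidiagonal.antidiagonal n, a p.1 * a p.2 := by
      intro n
      simp only [ha, catalan_succ', Nat.cast_sum, Nat.cast_mul, Finset.mul_sum, Finset.sum_div]
      refine Finset.sum_congr rfl fun p hp => ?_
      rw [← Finset.HasAntidiagonal.mem_antidiagonal.1 hp]
      field_simp
      ring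
    rw [Finset.sum_range_succ']
    have h0 : a 0 = 1 := by simp [ha]
    have h1 : ∑ n ∈ Finset.range N, ∑ p ∈ Finset.HasAntidiagonal.antidiagonal n, a p.1 * a p.2
        ≤ (∑ n ∈ Finset.range N, a n) * ∑ n ∈ Finset.range N, a n := by
      rw [Finset.sum_mul_sum, ← Finset.sum_product']
      have hf : ∀ n ∈ Finset.range N, Finset.HasAntidiagonal.antidiagonal n =
          {p ∈ Finset.range N ×ˢ Finset.range N | p.1 + p.2 = n} := by
        intro n hn
        ext p
        simp only [Finset.HasAntidiagonal.mem_antidiagonal, Finset.mem_filter, Finset.mem_product,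
          Finset.mem_range] at *
        omega
      rw [Finset.sum_congr rfl fun n hn => by rw [hf n hn]]
      exact Finset.sum_fiberwise_le_sum_of_sum_fiber_nonneg fun n _ =>
        Finset.sum_nonneg fun p _ => mul_nonneg (ha0 _) (ha0 _)
    have h2 : 0 ≤ ∑ n ∈ Finset.range N, a n := Finset.sum_nonneg fun n _ => ha0 n
    have : ∑ n ∈ Finset.range N, a (n + 1) ≤ 1 := by
      simp_rw [hrec]; rw [← Finset.mul_sum]; nlinarith
    change _ + a 0 ≤ 2
    linarith

set_option maxHeartbeats 800000 in
theorem exists_bounded_sqrt_aux (K : H →L[𝕜] H) (hK : IsSelfAdjoint K) (h1 : ‖K‖ ≤ 1) :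
    ∃ Q : H →L[𝕜] H, IsSelfAdjoint Q ∧ (∀ x, 0 ≤ re (inner 𝕜 (Q x) x)) ∧ Q * Q = 1 - K := by
  set a : ℕ → ℝ := fun n => (catalan n : ℝ) / 4 ^ n with ha
  have ha0 : ∀ n, 0 ≤ a n := fun n => by positivity
  have hsum : Summable a := summable_of_sum_range_le ha0 sum_catalan_le
  have htsum : ∑' n, a n ≤ 2 := hsum.tsum_le_of_sum_range_le sum_catalan_le
  have hpow : ∀ n, ‖K ^ n‖ ≤ 1 := by
    intro n
    induction n with
    | zero => exact ContinuousLinearMap.norm_id_le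
    | succ n ih =>
      rw [pow_succ]
      exact (norm_mul_le _ _).trans (mul_le_one₀ ih (norm_nonneg _) h1)
  set t : ℕ → (H →L[𝕜] H) := fun n => ((a n : ℝ) : 𝕜) • K ^ n with ht
  have htn : ∀ n, ‖t n‖ ≤ a n := by
    intro n
    rw [ht]; simp only [norm_smul, RCLike.norm_ofReal, abs_of_nonneg (ha0 n)]
    exact mul_le_of_le_one_right (ha0 n) (hpow n)
  have htsn : Summable fun n => ‖t n‖ := Summable.of_nonneg_of_le (fun _ => norm_nonneg _) htn hsum
  have hts : Summable t := htsn.of_norm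
  set g := ∑' n, t n with hg
  have hgn : ‖g‖ ≤ 2 := (tsum_of_norm_bounded hsum.hasSum htn).trans htsum
  have hgself : IsSelfAdjoint g := by
    rw [IsSelfAdjoint, hg, tsum_star]
    refine tsum_congr fun n => ?_
    rw [ht]; simp only [star_smul, star_pow, hK.star_eq]; simp
  have hcomm : Commute K g := by
    refine Commute.tsum_right _ fun n => ?_
    exact ((Commute.refl K).pow_right n).smul_right _
  have hgg : g = 1 + (4⁻¹ : 𝕜) • (K * (g * g)) := by
    rw [hg, tsum_mul_tsum_eq_tsum_sum_antidiagonal_of_summable_norm htsn htsn, ← hg]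
    have hs2 : Summable fun n => ∑ p ∈ Finset.HasAntidiagonal.antidiagonal n, t p.1 * t p.2 :=
      (summable_norm_sum_mul_antidiagonal_of_summable_norm htsn htsn).of_norm
    rw [← hs2.tsum_mul_left, ← (hs2.mul_left K).tsum_const_smul, hg, hts.tsum_eq_zero_add]
    congr 1
    · simp [ht, ha]
    · refine tsum_congr fun n => ?_
      simp only [ht, ha, smul_mul_smul_comm, ← pow_add]
      rw [catalan_succ', Finset.mul_sum, Finset.smul_sum, Nat.cast_sum, Finset.sum_div,
        RCLike.ofReal_sum, Finset.sum_smul]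
      refine Finset.sum_congr rfl fun p hp => ?_
      rw [← Finset.HasAntidiagonal.mem_antidiagonal.1 hp, mul_smul_comm, ← pow_succ', smul_smul]
      congr 1
      push_cast
      field_simp
      ring
  refine ⟨1 - (2⁻¹ : 𝕜) • (K * g), ?_, ?_, ?_⟩
  · rw [IsSelfAdjoint, star_sub, star_one, star_smul, star_mul, hK.star_eq, hgself.star_eq,
      hcomm.eq]
    simp
  · intro x
    have : ‖((2⁻¹ : 𝕜) • (K * g)) x‖ ≤ ‖x‖ := by
      have h3 : ‖(2⁻¹ : 𝕜) • (K * g)‖ ≤ 1 := by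
        rw [norm_smul]
        have := (norm_mul_le K g).trans (mul_le_mul h1 hgn (norm_nonneg _) zero_le_one)
        simp only [norm_inv, RCLike.norm_ofNat]
        linarith
      exact ((2⁻¹ : 𝕜) • (K * g)).le_of_opNorm_le h3 x |>.trans (by simp)
    have h4 := (re_inner_le_norm (𝕜 := 𝕜) (((2⁻¹ : 𝕜) • (K * g)) x) x)
    rw [sub_apply, inner_sub_left, map_sub, one_apply_eq_self,
      inner_self_eq_norm_sq]
    nlinarith [norm_nonneg x]
  · have e : g * (K * g) = K * (g * g) := by rw [← mul_assoc, ← hcomm.eq, mul_assoc]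
    have : K * g * (K * g) = (4 : 𝕜) • (K * g - K) := by
      rw [mul_assoc, e]
      conv_rhs => rw [hgg]
      simp [mul_add, smul_smul]
    simp only [sub_mul, mul_sub, one_mul, mul_one, smul_mul_smul_comm, this, smul_smul, smul_sub]
    norm_num
    module


theorem exists_bounded_sqrt (R : H →L[𝕜] H) (hR : IsSelfAdjoint R)
    (hpos : ∀ x, 0 ≤ re (inner 𝕜 (R x) x)) :
    ∃ Q : H →L[𝕜] H, IsSelfAdjoint Q ∧ (∀ x, 0 ≤ re (inner 𝕜 (Q x) x)) ∧ Q * Q = R := by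
  set c : ℝ := ‖R‖ + 1 with hc
  have hc0 : 0 < c := by positivity
  have hck : (c : 𝕜) ≠ 0 := by exact_mod_cast hc0.ne'
  set P : H →L[𝕜] H := ((c⁻¹ : ℝ) : 𝕜) • R with hP
  have hPself : IsSelfAdjoint P := by
    rw [IsSelfAdjoint, hP, star_smul, hR.star_eq]; simp
  have hPn : ‖P‖ ≤ 1 := by
    rw [hP, norm_smul, RCLike.norm_ofReal, abs_of_pos (by positivity), inv_mul_le_iff₀ hc0]
    linarith
  have hPpos : ∀ x, 0 ≤ re (inner 𝕜 (P x) x) := by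
    intro x
    rw [hP, smul_apply, inner_smul_left, RCLike.conj_ofReal, RCLike.re_ofReal_mul]
    exact mul_nonneg (by positivity) (hpos x)
  have hsym : ∀ x y, inner 𝕜 (P x) y = inner 𝕜 x (P y) := by
    intro x y
    conv_lhs => rw [← hPself.star_eq, ContinuousLinearMap.star_eq_adjoint,
      ContinuousLinearMap.adjoint_inner_left]
  have hK : ‖1 - P‖ ≤ 1 := by
    refine ContinuousLinearMap.opNorm_le_bound _ zero_le_one fun x => ?_
    rw [one_mul, ← sq_le_sq₀ (norm_nonneg _) (norm_nonneg _), sub_apply, one_apply_eq_self,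
      norm_sub_sq (𝕜 := 𝕜)]
    have h1 := hPpos (x - P x)
    have h2 : re (inner 𝕜 (P (P x)) (P x)) ≤ ‖P x‖ ^ 2 := by
      refine (re_inner_le_norm _ _).trans ?_
      have := P.le_of_opNorm_le hPn (P x)
      nlinarith [norm_nonneg (P x)]
    have h3 : inner 𝕜 (P (P x)) x = inner 𝕜 (P x) (P x) := hsym _ _
    rw [map_sub, inner_sub_left, inner_sub_right, inner_sub_right, h3, map_sub, map_sub, map_sub,
      inner_self_eq_norm_sq] at h1
    rw [← hsym]
    linarith [hPpos x]
  obtain ⟨Q, hQ, hQpos, hQQ⟩ := exists_bounded_sqrt_aux (1 - P)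
    ((IsSelfAdjoint.one _).sub hPself) hK
  refine ⟨((√c : ℝ) : 𝕜) • Q, ?_, ?_, ?_⟩
  · rw [IsSelfAdjoint, star_smul, hQ.star_eq]; simp
  · intro x
    rw [smul_apply, inner_smul_left, RCLike.conj_ofReal, RCLike.re_ofReal_mul]
    exact mul_nonneg (by positivity) (hQpos x)
  · rw [smul_mul_smul_comm, hQQ, sub_sub_cancel, hP, smul_smul, ← RCLike.ofReal_mul,
      ← RCLike.ofReal_mul, Real.mul_self_sqrt hc0.le, mul_inv_cancel₀ hc0.ne']
    simp

/-! ### Coercive self-adjoint operators and their positive square root -/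

variable (𝕜 H) in
/-- An unbounded self-adjoint operator `A : D(A) ⊆ H → H` which is nonnegative and satisfies
`‖A u‖ ≥ ω ‖u‖` on `D(A)` for some `ω > 0`. For a self-adjoint operator, mathlib's `IsSelfAdjoint`
includes density of the domain. -/
structure CoerciveOperator where
  op : H →ₗ.[𝕜] H
  selfAdjoint : IsSelfAdjoint op
  nonneg : ∀ u : op.domain, 0 ≤ re (inner 𝕜 (op u) (u : H))
  coercive : ∃ ω : ℝ, 0 < ω ∧ ∀ u : op.domain, ω * ‖(u : H)‖ ≤ ‖op u‖

/-- `S` is a nonnegative self-adjoint operator with `S² = A`, as an equality of graphs: `(x, z)`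
lies in the graph of `A` iff `x ∈ D(S)`, `S x ∈ D(S)` and `S (S x) = z`. -/
structure IsPositiveSqrt (A S : H →ₗ.[𝕜] H) : Prop where
  selfAdjoint : IsSelfAdjoint S
  nonneg : ∀ u : S.domain, 0 ≤ re (inner 𝕜 (S u) (u : H))
  sq : ∀ x z : H, (x, z) ∈ A.graph ↔ ∃ y, (x, y) ∈ S.graph ∧ (y, z) ∈ S.graph

namespace CoerciveOperator

variable (A : CoerciveOperator 𝕜 H)

theorem injective : Function.Injective A.op.toFun := by
  obtain ⟨ω, hω, h⟩ := A.coercive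
  refine (injective_iff_map_eq_zero _).2 fun u hu => ?_
  have := h u
  rw [show A.op u = 0 from hu, norm_zero] at this
  have : ‖(u : H)‖ = 0 := le_antisymm (by nlinarith) (norm_nonneg _)
  exact Subtype.ext (norm_eq_zero.1 this)

theorem symm (x y : A.op.domain) : inner 𝕜 (A.op x) (y : H) = inner 𝕜 (x : H) (A.op y) := by
  have h := LinearPMap.adjoint_isFormalAdjoint A.selfAdjoint.dense_domain
  rw [LinearPMap.isSelfAdjoint_def.1 A.selfAdjoint] at h
  exact h x y

theorem surjective : Function.Surjective A.op.toFun := by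
  obtain ⟨ω, hω, h⟩ := A.coercive
  have hcl : IsClosed (A.op.graph : Set (H × H)) := A.selfAdjoint.isClosed
  have : CompleteSpace A.op.graph := hcl.completeSpace_coe
  have hanti : AntilipschitzWith (max 1 ω⁻¹).toNNReal (fun p : A.op.graph => (p : H × H).2) := by
    refine AddMonoidHomClass.antilipschitz_of_bound
      ((LinearMap.snd 𝕜 H H).comp A.op.graph.subtype) fun p => ?_
    obtain ⟨u, hu1, hu2⟩ := (LinearPMap.mem_graph_iff _).1 p.2
    have h1 := h u
    rw [hu1, hu2] at h1
    rw [Real.coe_toNNReal _ (by positivity)]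
    have h2 : ‖(p : H × H).1‖ ≤ ω⁻¹ * ‖(p : H × H).2‖ := by
      rw [inv_mul_eq_div, le_div_iff₀ hω]; linarith
    refine max_le ?_ ?_
    · exact h2.trans (mul_le_mul_of_nonneg_right (le_max_right _ _) (norm_nonneg _))
    · exact le_mul_of_one_le_left (norm_nonneg _) (le_max_left _ _)
  have hrc := hanti.isClosed_range (uniformContinuous_snd.comp uniformContinuous_subtype_val)
  set M : Submodule 𝕜 H := LinearMap.range A.op.toFun with hM
  have hMr : (M : Set H) = Set.range (fun p : A.op.graph => (p : H × H).2) := by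
    ext z
    constructor
    · rintro ⟨u, rfl⟩
      exact ⟨⟨(u, A.op u), A.op.mem_graph u⟩, rfl⟩
    · rintro ⟨p, rfl⟩
      obtain ⟨u, hu1, hu2⟩ := (LinearPMap.mem_graph_iff _).1 p.2
      exact ⟨u, hu2⟩
  have hMc : IsClosed (M : Set H) := hMr ▸ hrc
  have hperp : Mᗮ = ⊥ := by
    refine (Submodule.eq_bot_iff _).2 fun y hy => ?_
    have hy0 : ∀ x : A.op.domain, inner 𝕜 (0 : H) (x : H) = inner 𝕜 y (A.op x) := fun x => by
      rw [inner_zero_left]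
      exact (Submodule.inner_left_of_mem_orthogonal (LinearMap.mem_range_self _ x) hy).symm
    have hmem := LinearPMap.mem_adjoint_domain_of_exists y ⟨0, hy0⟩
    rw [LinearPMap.isSelfAdjoint_def.1 A.selfAdjoint] at hmem
    have hz : A.op ⟨y, hmem⟩ = 0 := by
      refine A.selfAdjoint.dense_domain.eq_of_inner_left 𝕜 fun v hv => ?_
      rw [A.symm ⟨y, hmem⟩ ⟨v, hv⟩, ← hy0 ⟨v, hv⟩]
    exact congrArg Subtype.val (A.injective (hz.trans (map_zero A.op.toFun).symm))
  have : M = ⊤ := by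
    rw [← hMc.submodule_topologicalClosure_eq, Submodule.topologicalClosure_eq_top_iff, hperp]
  exact LinearMap.range_eq_top.1 this

theorem exists_inverse : ∃ R : H →L[𝕜] H, IsSelfAdjoint R ∧
    (∀ x, 0 ≤ re (inner 𝕜 (R x) x)) ∧ ∀ x z : H, (x, z) ∈ A.op.graph ↔ R z = x := by
  obtain ⟨ω, hω, h⟩ := A.coercive
  set e := LinearEquiv.ofBijective A.op.toFun ⟨A.injective, A.surjective⟩ with he
  have hAe : ∀ z, A.op (e.symm z) = z := fun z => e.apply_symm_apply z
  set R : H →L[𝕜] H := (A.op.domain.subtype.comp e.symm.toLinearMap).mkContinuous ω⁻¹ (by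
    intro z
    have := h (e.symm z)
    rw [hAe] at this
    rw [inv_mul_eq_div, le_div_iff₀ hω, mul_comm]
    exact this) with hR
  have hRe : ∀ z, R z = (e.symm z : H) := fun z => rfl
  refine ⟨R, ?_, ?_, ?_⟩
  · rw [ContinuousLinearMap.isSelfAdjoint_iff_isSymmetric]
    intro z w
    change inner 𝕜 (R z) w = inner 𝕜 z (R w)
    conv_lhs => rw [← hAe w]
    conv_rhs => rw [← hAe z]
    rw [hRe, hRe, A.symm]
  · intro z
    have := A.nonneg (e.symm z)
    rw [hAe, inner_re_symm] at this
    exact this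
  · intro x z
    rw [LinearPMap.mem_graph_iff]
    constructor
    · rintro ⟨u, hu1, hu2⟩
      simp only at hu1 hu2
      rw [hRe, ← hu1, ← hu2]
      exact congrArg Subtype.val (e.symm_apply_apply u)
    · intro hx
      exact ⟨e.symm z, hx, hAe z⟩

theorem exists_sqrt : ∃ S : H →ₗ.[𝕜] H, IsPositiveSqrt A.op S := by
  obtain ⟨R, hR, hRpos, hRg⟩ := A.exists_inverse
  obtain ⟨Q, hQ, hQpos, hQQ⟩ := exists_bounded_sqrt R hR hRpos
  have hsym : ∀ x y, inner 𝕜 (Q x) y = inner 𝕜 x (Q y) := by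
    intro x y
    conv_lhs => rw [← hQ.star_eq, ContinuousLinearMap.star_eq_adjoint,
      ContinuousLinearMap.adjoint_inner_left]
  have hQi : Function.Injective Q := by
    refine (injective_iff_map_eq_zero _).2 fun z hz => ?_
    have hRz : R z = 0 := by rw [← hQQ]; change Q (Q z) = 0; rw [hz, map_zero]
    obtain ⟨u, hu1, hu2⟩ := (LinearPMap.mem_graph_iff _).1 ((hRg 0 z).2 hRz)
    have : u = 0 := Subtype.ext hu1
    rw [this] at hu2
    exact hu2.symm.trans (map_zero A.op.toFun)
  let e := LinearEquiv.ofInjective (Q : H →ₗ[𝕜] H) hQi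
  let S : H →ₗ.[𝕜] H := ⟨LinearMap.range (Q : H →ₗ[𝕜] H), e.symm.toLinearMap⟩
  have hSg : ∀ x z : H, (x, z) ∈ S.graph ↔ Q z = x := by
    intro x z
    rw [LinearPMap.mem_graph_iff]
    constructor
    · rintro ⟨u, hu1, hu2⟩
      simp only at hu1 hu2
      rw [← hu1, ← hu2]
      exact congrArg Subtype.val (e.apply_symm_apply u)
    · intro hx
      exact ⟨e z, hx, e.symm_apply_apply z⟩
  have hdense : Dense (S.domain : Set H) := by
    rw [Submodule.dense_iff_topologicalClosure_eq_top, Submodule.topologicalClosure_eq_top_iff]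
    refine (Submodule.eq_bot_iff _).2 fun y hy => hQi ?_
    rw [map_zero]
    refine ext_inner_left 𝕜 fun v => ?_
    rw [← hsym, inner_zero_right]
    exact Submodule.inner_right_of_mem_orthogonal (K := S.domain) (LinearMap.mem_range_self _ v) hy
  refine ⟨S, ?_, ?_, ?_⟩
  · rw [LinearPMap.isSelfAdjoint_def]
    refine LinearPMap.eq_of_eq_graph ?_
    rw [LinearPMap.adjoint_graph_eq_graph_adjoint hdense]
    ext ⟨x, z⟩
    rw [Submodule.mem_adjoint_iff, hSg]
    constructor
    · intro hx
      refine ext_inner_left 𝕜 fun b => ?_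
      have := hx (Q b) b ((hSg _ _).2 rfl)
      rw [hsym] at this
      exact (sub_eq_zero.1 this).symm
    · rintro hx a b hab
      rw [hSg] at hab
      simp only
      rw [← hab, ← hx, hsym, sub_self]
  · intro u
    have := hQpos (S u)
    rw [(hSg u (S u)).1 (S.mem_graph u), inner_re_symm] at this
    exact this
  · intro x z
    rw [hRg, ← hQQ]
    simp only [hSg]
    constructor
    · intro hx; exact ⟨Q z, hx, rfl⟩
    · rintro ⟨y, rfl, rfl⟩; rfl

/-- The operator `A^{1/2}`: the nonnegative self-adjoint operator whose square is `A`. -/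
def half : H →ₗ.[𝕜] H := A.exists_sqrt.choose

theorem half_spec : IsPositiveSqrt A.op A.half := A.exists_sqrt.choose_spec

theorem op_domain_le : A.op.domain ≤ A.half.domain := by
  intro x hx
  obtain ⟨y, hy, -⟩ := (A.half_spec.sq x _).1 (A.op.mem_graph ⟨x, hx⟩)
  exact LinearPMap.mem_domain_of_mem_graph hy

theorem half_injective : Function.Injective A.half.toFun := by
  refine (injective_iff_map_eq_zero _).2 fun u hu => ?_
  have h1 : ((u : H), (0 : H)) ∈ A.half.graph := by
    have := A.half.mem_graph u
    rwa [show A.half u = 0 from hu] at this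
  have h2 : ((u : H), (0 : H)) ∈ A.op.graph :=
    (A.half_spec.sq _ _).2 ⟨0, h1, A.half.graph.zero_mem⟩
  obtain ⟨v, hv1, hv2⟩ := (LinearPMap.mem_graph_iff _).1 h2
  have hv : v = 0 := A.injective (hv2.trans (map_zero A.op.toFun).symm)
  refine Subtype.ext ?_
  rw [← show (v : H) = u from hv1, hv]
  rfl

/-! ### The spaces `H₁ = D(A^{1/2})`, `H₂ = D(A)` and their (anti)duals -/

/-- `H₁ = D(A^{1/2})` with the norm `‖A^{1/2} u‖`. -/
def H1 : Type _ := A.half.domain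

/-- `H₂ = D(A)` with the norm `‖A u‖`. -/
def H2 : Type _ := A.op.domain

instance : AddCommGroup A.H1 := inferInstanceAs (AddCommGroup A.half.domain)
instance : Module 𝕜 A.H1 := inferInstanceAs (Module 𝕜 A.half.domain)
instance : AddCommGroup A.H2 := inferInstanceAs (AddCommGroup A.op.domain)
instance : Module 𝕜 A.H2 := inferInstanceAs (Module 𝕜 A.op.domain)

/-- The map `A^{1/2} : H₁ → H`. -/
def halfMap : A.H1 →ₗ[𝕜] H := A.half.toFun

/-- The map `A : H₂ → H`. -/
def opMap : A.H2 →ₗ[𝕜] H := A.op.toFun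

instance : NormedAddCommGroup A.H1 :=
  NormedAddCommGroup.induced A.H1 H A.halfMap A.half_injective

instance : NormedSpace 𝕜 A.H1 := NormedSpace.induced 𝕜 A.H1 H A.halfMap

instance : NormedAddCommGroup A.H2 :=
  NormedAddCommGroup.induced A.H2 H A.opMap A.injective

instance : NormedSpace 𝕜 A.H2 := NormedSpace.induced 𝕜 A.H2 H A.opMap

/-- The inclusion `H₁ ⊆ H`. -/
def ofH1 : A.H1 →ₗ[𝕜] H := A.half.domain.subtype

/-- The inclusion `H₂ ⊆ H`. -/
def ofH2 : A.H2 →ₗ[𝕜] H := A.op.domain.subtype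

/-- The inclusion `H₂ ⊆ H₁`. -/
def inclH2H1 : A.H2 →ₗ[𝕜] A.H1 := Submodule.inclusion A.op_domain_le

/-- `H₋₁`, the dual of `H₁` with pivot space `H`, with the dual norm. Conjugate-linear functionals
are used, so that `u ∈ H` is identified linearly with `w ↦ ⟪w, u⟫`; over `ℝ` this is the ordinary
dual. The value `φ w` is the duality product of `φ ∈ H₋₁` and `w ∈ H₁`. -/
abbrev HNeg1 : Type _ := A.H1 →SL[starRingEnd 𝕜] 𝕜

/-- The (anti)dual `H₂'` of `H₂ = D(A)` with pivot space `H`, with the dual norm. -/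
abbrev H2Dual : Type _ := A.H2 →SL[starRingEnd 𝕜] 𝕜

/-- The natural energy `e₁(w, w') = (|A^{1/2} w|² + |w'|²) / 2`. -/
def energy (w : A.H1) (w' : H) : ℝ := (‖A.halfMap w‖ ^ 2 + ‖w'‖ ^ 2) / 2

/-! ### Strict solutions of `w'' + A w = f`, admissibility and observability -/

variable (𝕜) in
/-- On `[0, T]` the curve `w : ℝ → H` has derivative `w'` (one-sided at the end points), for the
real structure of `H`. -/
def HasDerivOnIcc (T : ℝ) (w w' : ℝ → H) : Prop :=
  letI : NormedSpace ℝ H := NormedSpace.restrictScalars ℝ 𝕜 H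
  ∀ t ∈ Set.Icc 0 T, HasDerivWithinAt w (w' t) (Set.Icc 0 T) t

/-- `w` is a (strict) solution of `w'' + A w = f` on `[0, T]` with velocity `w'`:
`w ∈ C([0,T]; D(A)) ∩ C²([0,T]; H)` and `f ∈ C([0,T]; H)`. -/
structure IsStrictSolution (T : ℝ) (f : ℝ → H) (w : ℝ → A.H2) (w' : ℝ → H) : Prop where
  continuousOn : ContinuousOn w (Set.Icc 0 T)
  continuousOn_source : ContinuousOn f (Set.Icc 0 T)
  hasDeriv : HasDerivOnIcc 𝕜 T (fun t => A.ofH2 (w t)) w'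
  hasDeriv' : HasDerivOnIcc 𝕜 T w' (fun t => f t - A.opMap (w t))

/-- Admissibility of an observation `𝐁* (w, w')` for the equation `w'' + A w = f`: for every `T > 0`
the integral of `|𝐁* (w, w')|²` over `[0, T]` is controlled by energies of `w` and by `f`. -/
def Admissible (obs : A.H2 → H → G) : Prop :=
  ∀ T : ℝ, 0 < T → ∃ K : ℝ, 0 < K ∧
    ∀ (f : ℝ → H) (w : ℝ → A.H2) (w' : ℝ → H), A.IsStrictSolution T f w w' →
      ∫ t in (0 : ℝ)..T, ‖obs (w t) (w' t)‖ ^ 2 ≤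
        K * (A.energy (A.inclH2H1 (w 0)) (w' 0) + A.energy (A.inclH2H1 (w T)) (w' T)
          + (∫ t in (0 : ℝ)..T, A.energy (A.inclH2H1 (w t)) (w' t))
          + ∫ t in (0 : ℝ)..T, ‖f t‖ ^ 2)

/-- The free equation `w'' + A w = 0` is observable through `𝐁* (w, w')` in every time
`T > T₀`, with a positive constant that may depend on `T`. -/
def Observable (obs : A.H2 → H → G) (T₀ : ℝ) : Prop :=
  ∀ T : ℝ, T₀ < T → ∃ c : ℝ, 0 < c ∧
    ∀ (w : ℝ → A.H2) (w' : ℝ → H), A.IsStrictSolution T (fun _ => 0) w w' →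
      c * A.energy (A.inclH2H1 (w 0)) (w' 0) ≤ ∫ t in (0 : ℝ)..T, ‖obs (w t) (w' t)‖ ^ 2

/-- `𝐁* (w, w') = B* w'` for a bounded control operator `B ∈ L(G, H)`. -/
def boundedObs (B : G →L[𝕜] H) : A.H2 → H → G := fun _ w' => ContinuousLinearMap.adjoint B w'

/-- The adjoint `B* : H₂ → G` of `B ∈ L(G, H₂')`, so that `⟪B* w, g⟫ = (B g) w`. -/
def dualAdjoint (B : G →L[𝕜] A.H2Dual) (w : A.H2) : G :=
  (InnerProductSpace.toDual 𝕜 G).symm (B.flip w)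

theorem inner_dualAdjoint (B : G →L[𝕜] A.H2Dual) (w : A.H2) (g : G) :
    inner 𝕜 (A.dualAdjoint B w) g = B g w := by
  simp [dualAdjoint]

/-- `𝐁* (w, w') = B* w` for an unbounded control operator `B ∈ L(G, H₂')`. -/
def unboundedObs (B : G →L[𝕜] A.H2Dual) : A.H2 → H → G := fun w _ => A.dualAdjoint B w

/-- The coupling operator `C` restricts to bounded operators of `H`, `H₁` and `H₂`, satisfies
`|C w|² ≤ ‖C‖ ⟨C w, w⟩`, and is partially coercive: `α |Π w|² ≤ ⟨C w, w⟩` for some `α > 0`. -/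
structure PartiallyCoercive (C P : H →L[𝕜] H) : Prop where
  bounded_H1 : ∃ C₁ : A.H1 →L[𝕜] A.H1, ∀ u, A.ofH1 (C₁ u) = C (A.ofH1 u)
  bounded_H2 : ∃ C₂ : A.H2 →L[𝕜] A.H2, ∀ u, A.ofH2 (C₂ u) = C (A.ofH2 u)
  sq_le : ∀ w : H, ‖C w‖ ^ 2 ≤ ‖C‖ * re (inner 𝕜 (C w) w)
  coercive : ∃ α : ℝ, 0 < α ∧ ∀ w : H, α * ‖P w‖ ^ 2 ≤ re (inner 𝕜 (C w) w)

/-! ### Solutions of the control system by transposition -/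

/-- `y` is the solution by transposition on `[0, T]` of `y'' + A y = F`, `y(0) = y⁰`,
`y'(0) = y¹`. The source `F s`, the velocity `y' t` and the initial velocity `y¹` are given by their
duality products `F s w`, `y' t w`, `y¹ w` with `w ∈ D(A)`. Test functions are all strict solutions
`θ` of `θ'' + A θ = f` on `[0, t]`, for all continuous `f` and all `t ∈ [0, T]`. -/
def IsTranspositionSolution (T : ℝ) (F : ℝ → A.H2 → 𝕜) (y₀ : H) (y₁ : A.H2 → 𝕜)
    (y : ℝ → H) (y' : ℝ → A.H2 → 𝕜) : Prop :=
  ∀ t ∈ Set.Icc 0 T, ∀ (f : ℝ → H) (θ : ℝ → A.H2) (θ' : ℝ → H), A.IsStrictSolution t f θ θ' →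
    y' t (θ t) - inner 𝕜 (θ' t) (y t) = y₁ (θ 0) - inner 𝕜 (θ' 0) y₀
      + ∫ s in (0 : ℝ)..t, (F s (θ s) - inner 𝕜 (f s) (y s))

/-- `H` inside the functionals on `D(A)`: `u ∈ H` acts as `w ↦ ⟪w, u⟫`. -/
def pivot (u : H) : A.H2 → 𝕜 := fun w => inner 𝕜 (A.ofH2 w) u

/-- `H₋₁` inside the functionals on `D(A)`. -/
def pivotNeg1 (φ : A.HNeg1) : A.H2 → 𝕜 := fun w => φ (A.inclH2H1 w)

/-- `(y₁, y₂, y₁', y₂') ∈ C([0,T]; H₂ × H₁ × H₁ × H)` solves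
`y₁'' + A y₁ + C* y₂ = 0`, `y₂'' + A y₂ = B v` with a bounded control operator `B ∈ L(G, H)` and
initial data `(y₁, y₂, y₁', y₂')(0) = (a₁, a₂, b₁, b₂)`. -/
structure IsBoundedCascadeSolution (C : H →L[𝕜] H) (B : G →L[𝕜] H) (T : ℝ) (v : ℝ → G)
    (a₁ : A.H2) (a₂ : A.H1) (b₁ : A.H1) (b₂ : H)
    (y₁ : ℝ → A.H2) (y₂ : ℝ → A.H1) (z₁ : ℝ → A.H1) (z₂ : ℝ → H) : Prop where
  continuousOn_y₁ : ContinuousOn y₁ (Set.Icc 0 T)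
  continuousOn_y₂ : ContinuousOn y₂ (Set.Icc 0 T)
  continuousOn_z₁ : ContinuousOn z₁ (Set.Icc 0 T)
  continuousOn_z₂ : ContinuousOn z₂ (Set.Icc 0 T)
  eq₁ : A.IsTranspositionSolution T
    (fun s => A.pivot (-(ContinuousLinearMap.adjoint C (A.ofH1 (y₂ s)))))
    (A.ofH2 a₁) (A.pivot (A.ofH1 b₁)) (fun s => A.ofH2 (y₁ s)) (fun s => A.pivot (A.ofH1 (z₁ s)))
  eq₂ : A.IsTranspositionSolution T (fun s => A.pivot (B (v s)))
    (A.ofH1 a₂) (A.pivot b₂) (fun s => A.ofH1 (y₂ s)) (fun s => A.pivot (z₂ s))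

/-- `(y₁, y₂, y₁', y₂') ∈ C([0,T]; H₁ × H × H × H₋₁)` solves
`y₁'' + A y₁ + C* y₂ = 0`, `y₂'' + A y₂ = B v` with an unbounded control operator `B ∈ L(G, H₂')`
and initial data `(y₁, y₂, y₁', y₂')(0) = (a₁, a₂, b₁, b₂)`. -/
structure IsUnboundedCascadeSolution (C : H →L[𝕜] H) (B : G →L[𝕜] A.H2Dual) (T : ℝ) (v : ℝ → G)
    (a₁ : A.H1) (a₂ : H) (b₁ : H) (b₂ : A.HNeg1)
    (y₁ : ℝ → A.H1) (y₂ : ℝ → H) (z₁ : ℝ → H) (z₂ : ℝ → A.HNeg1) : Prop where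
  continuousOn_y₁ : ContinuousOn y₁ (Set.Icc 0 T)
  continuousOn_y₂ : ContinuousOn y₂ (Set.Icc 0 T)
  continuousOn_z₁ : ContinuousOn z₁ (Set.Icc 0 T)
  continuousOn_z₂ : ContinuousOn z₂ (Set.Icc 0 T)
  eq₁ : A.IsTranspositionSolution T
    (fun s => A.pivot (-(ContinuousLinearMap.adjoint C (y₂ s))))
    (A.ofH1 a₁) (A.pivot b₁) (fun s => A.ofH1 (y₁ s)) (fun s => A.pivot (z₁ s))
  eq₂ : A.IsTranspositionSolution T (fun s w => B (v s) w)
    a₂ (A.pivotNeg1 b₂) y₂ (fun s => A.pivotNeg1 (z₂ s))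

end CoerciveOperator

end Cascade

end

/-! The equations are put in first-order form on the real Hilbert space `E = H × H`. With `Q =
A^{-1/2}`, the operator `J (p, q) = (-Q q, Q p)` is bounded, skew and injective, and `J⁻¹` generates
a group `U` of isometries, the wave group (`exists_isometricGroup`). If `x = (-A w, -A^{1/2} w')`,
then `J x = (w', -A^{1/2} w)`: thus `‖J x‖²` is twice the energy of `w`, while `x` controls `A w`.
An observation defined only on `D(A)` becomes a bounded operator `O` on `E`, applied to `x`, and
admissibility bounds it in `L²` of time by the weaker norm `‖J x‖`. Only bounded operators occur.

The adjoint cascade is `Φ₁' = J⁻¹ Φ₁`, `Φ₂' = J⁻¹ Φ₂ - C Φ₁`, where `C` now stands for the coupling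
`(p, q) ↦ (-C q, 0)`; only `O (J⁻¹ Φ₂)` is observed, and `Ob` denotes the integral of its squared
norm. The rotation `ρ (p, q) = (q, -p)` commutes with `U`, so `⟪Φ₂, ρ Φ₁⟫` has derivative `-⟪C Φ₁, ρ
Φ₁⟫ = Re ⟪C q, q⟫ ≥ 0`, with `q` the second component of `Φ₁`. Its integral `X` over `[0, T]` is
therefore at most `‖Φ₁‖ (‖Φ₂ 0‖ + ‖Φ₂ T‖)`. On windows of fixed length at both ends of `[0, T]`,
comparison of `Φ₂` with a free wave bounds `‖Φ₂ 0‖²` and `‖Φ₂ T‖²` by `k (Ob + X)`; this uses `|C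
w|² ≤ β Re ⟪C w, w⟫`, and `k` does not depend on `T`. On the other hand `q` is the velocity of a
free wave, so observability through `Π_p` makes `X / ‖Φ₁‖²` grow linearly with `T`. For large `T`
this forces `X ≤ Ob`, and both energies are observed (`exists_cascade_observable`).

Duality turns this into null controllability (`exists_null_control`): the initial data define a
functional bounded by the observation, hence represented by some `v` in `L²`, and pairing the
controlled system with the adjoint one shows that the final state vanishes.

For unbounded `B` the states are `(A^{1/2} y₁, y₁')` and `(y₂, A^{-1/2} y₂')`. For bounded `B` the
same result is applied one derivative higher, to `(A^{1/2} y₁', y₁'')` and `(y₂', -A^{1/2} y₂)`.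
Weak solutions in state form satisfy the transposition identity by regularising the test functions
(`real_inner_test`); uniqueness follows by testing with free waves
(`IsTranspositionSolution.eq_of_eq`). -/

noncomputable section

namespace Cascade

open Filter Topology
open scoped RealInnerProductSpace

/-! ### Resolvents of nonnegative bounded operators. -/

section Resolvent

variable {X : Type*} [NormedAddCommGroup X] [InnerProductSpace ℝ X] [CompleteSpace X]

/-- The resolvent `(ε + R)⁻¹` of a bounded operator. -/
def resolventAt (R : X →L[ℝ] X) (ε : ℝ) : X →L[ℝ] X := Ring.inverse (ε • 1 + R)

variable {R : X →L[ℝ] X}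

theorem isUnit_smul_one_add (hR : ∀ x, 0 ≤ ⟪R x, x⟫) {ε : ℝ} (hε : 0 < ε) :
    IsUnit (ε • (1 : X →L[ℝ] X) + R) := by
  refine ContinuousLinearMap.isUnit_of_forall_le_norm_inner_map (𝕜 := ℝ) _
    (c := ⟨ε, hε.le⟩) hε fun x => ?_
  have h := hR x
  have : ⟪(ε • (1 : X →L[ℝ] X) + R) x, x⟫ = ε * ‖x‖ ^ 2 + ⟪R x, x⟫ := by
    simp [inner_add_left, inner_smul_left]
  rw [this, Real.norm_of_nonneg (by positivity)]
  change ‖x‖ ^ 2 * ε ≤ _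
  linarith

theorem add_resolventAt (hR : ∀ x, 0 ≤ ⟪R x, x⟫) {ε : ℝ} (hε : 0 < ε) (x : X) :
    ε • resolventAt R ε x + R (resolventAt R ε x) = x := by
  have := congrArg (fun T : X →L[ℝ] X => T x)
    (Ring.mul_inverse_cancel _ (isUnit_smul_one_add hR hε))
  simpa [resolventAt] using this

theorem resolventAt_add (hR : ∀ x, 0 ≤ ⟪R x, x⟫) {ε : ℝ} (hε : 0 < ε) (x : X) :
    resolventAt R ε (ε • x + R x) = x := by
  have := congrArg (fun T : X →L[ℝ] X => T x)
    (Ring.inverse_mul_cancel _ (isUnit_smul_one_add hR hε))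
  simpa [resolventAt] using this

theorem resolventAt_comm (hR : ∀ x, 0 ≤ ⟪R x, x⟫) {ε : ℝ} (hε : 0 < ε) {T : X →L[ℝ] X}
    (hT : ∀ x, T (R x) = R (T x)) (x : X) : T (resolventAt R ε x) = resolventAt R ε (T x) := by
  conv_rhs => rw [← add_resolventAt hR hε x]
  rw [map_add, map_smul, hT, resolventAt_add hR hε]

theorem norm_smul_resolventAt_le (hR : ∀ x, 0 ≤ ⟪R x, x⟫) {ε : ℝ} (hε : 0 < ε) (x : X) :
    ‖ε • resolventAt R ε x‖ ≤ ‖x‖ := by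
  set y := resolventAt R ε x
  have h : ε * ‖y‖ ^ 2 ≤ ‖x‖ * ‖y‖ := by
    have h1 : ⟪ε • y + R y, y⟫ = ε * ‖y‖ ^ 2 + ⟪R y, y⟫ := by
      simp [inner_add_left, inner_smul_left]
    rw [add_resolventAt hR hε] at h1
    linarith [hR y, real_inner_le_norm x y]
  rw [norm_smul, Real.norm_of_nonneg hε.le]
  rcases (norm_nonneg y).eq_or_lt with h0 | h0
  · rw [← h0]; simp
  · exact le_of_mul_le_mul_right (by linarith) h0

theorem norm_sub_smul_resolventAt_le (hR : ∀ x, 0 ≤ ⟪R x, x⟫) {ε : ℝ} (hε : 0 < ε) (x : X) :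
    ‖R (resolventAt R ε x)‖ ≤ 2 * ‖x‖ := by
  have h := add_resolventAt hR hε x
  rw [← eq_sub_iff_add_eq'] at h
  rw [h]
  exact (norm_sub_le _ _).trans (by linarith [norm_smul_resolventAt_le hR hε x])

theorem denseRange_of_injective_of_adjoint {T T' : X →L[ℝ] X}
    (hT : ∀ x y, ⟪T x, y⟫ = ⟪x, T' y⟫) (hinj : Function.Injective T') : DenseRange T := by
  have h : (LinearMap.range (T : X →ₗ[ℝ] X)).topologicalClosure = ⊤ := by
    rw [Submodule.topologicalClosure_eq_top_iff, Submodule.eq_bot_iff]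
    intro y hy
    refine hinj ?_
    rw [map_zero]
    refine ext_inner_left ℝ fun v => ?_
    rw [← hT, inner_zero_right]
    exact Submodule.inner_right_of_mem_orthogonal (K := LinearMap.range (T : X →ₗ[ℝ] X))
      (LinearMap.mem_range_self _ v) hy
  rw [← Submodule.dense_iff_topologicalClosure_eq_top] at h
  exact h

/-- The operators `ε (ε + R)⁻¹` are contractions, and on the range of `R` they are `O(ε)` because
`(ε + R)⁻¹ R z = z - ε (ε + R)⁻¹ z`. That range is dense, `R` being symmetric and injective. -/
theorem tendsto_smul_resolventAt (hR : ∀ x, 0 ≤ ⟪R x, x⟫) (hsym : ∀ x y, ⟪R x, y⟫ = ⟪x, R y⟫)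
    (hinj : Function.Injective R) (x : X) :
    Tendsto (fun ε : ℝ => ε • resolventAt R ε x) (𝓝[>] 0) (𝓝 0) := by
  rw [Metric.tendsto_nhds]
  intro δ hδ
  obtain ⟨z, hz⟩ :=
    (denseRange_of_injective_of_adjoint hsym hinj).exists_dist_lt x (half_pos hδ)
  have hz0 : 0 < 4 * (‖z‖ + 1) := by positivity
  filter_upwards [Ioo_mem_nhdsGT (show (0 : ℝ) < δ / (4 * (‖z‖ + 1)) by positivity)] with ε hε
  have hε0 := hε.1
  rw [dist_zero_right]
  have h1 : resolventAt R ε (R z) = z - ε • resolventAt R ε z := by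
    rw [eq_sub_iff_add_eq', ← map_smul, ← map_add, resolventAt_add hR hε0]
  have h2 : ‖ε • resolventAt R ε (R z)‖ ≤ ε * (2 * ‖z‖) := by
    rw [norm_smul, Real.norm_of_nonneg hε0.le, h1]
    refine mul_le_mul_of_nonneg_left ?_ hε0.le
    exact (norm_sub_le _ _).trans (by linarith [norm_smul_resolventAt_le hR hε0 z])
  have h3 : ε • resolventAt R ε x = ε • resolventAt R ε (x - R z) + ε • resolventAt R ε (R z) := by
    rw [← smul_add, ← map_add, sub_add_cancel]
  have h4 := norm_smul_resolventAt_le hR hε0 (x - R z)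
  have h5 := (lt_div_iff₀ hz0).1 hε.2
  rw [dist_eq_norm] at hz
  rw [h3]
  refine (norm_add_le _ _).trans_lt ?_
  nlinarith [norm_nonneg z]

end Resolvent

/-! ### The isometric group with generator `J⁻¹`. -/

section Group

variable {E : Type*} [NormedAddCommGroup E] [InnerProductSpace ℝ E] [CompleteSpace E]

theorem hasDerivAt_exp_smul_apply (B : E →L[ℝ] E) (x : E) (t : ℝ) :
    HasDerivAt (fun s : ℝ => NormedSpace.exp (s • B) x) (NormedSpace.exp (t • B) (B x)) t :=
  (hasDerivAt_exp_smul_const B t).clm_apply (hasDerivAt_const t x) |>.congr_deriv (by simp)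

theorem norm_exp_smul_apply {B : E →L[ℝ] E} (hB : ∀ x, ⟪B x, x⟫ = 0) (x : E) (t : ℝ) :
    ‖NormedSpace.exp (t • B) x‖ = ‖x‖ := by
  have hc : ∀ s : ℝ, NormedSpace.exp (s • B) (B x) = B (NormedSpace.exp (s • B) x) := fun s => by
    have : Commute B (NormedSpace.exp (s • B)) := ((Commute.refl B).smul_right s).exp_right
    exact congrArg (fun T : E →L[ℝ] E => T x) this.eq.symm
  have hd : ∀ s : ℝ, HasDerivAt (fun s : ℝ => ‖NormedSpace.exp (s • B) x‖ ^ 2) 0 s := fun s => by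
    refine (hasDerivAt_exp_smul_apply B x s).norm_sq.congr_deriv ?_
    rw [hc, real_inner_comm, hB, mul_zero]
  have := is_const_of_deriv_eq_zero (fun s => (hd s).differentiableAt) (fun s => (hd s).deriv) t 0
  simp only [zero_smul, NormedSpace.exp_zero, one_apply_eq_self] at this
  exact (sq_eq_sq₀ (norm_nonneg _) (norm_nonneg _)).1 this

theorem norm_exp_smul_sub_le {B : E →L[ℝ] E} (hB : ∀ x, ⟪B x, x⟫ = 0) (x : E) (t : ℝ) :
    ‖NormedSpace.exp (t • B) x - x‖ ≤ |t| * ‖B x‖ := by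
  have := Convex.norm_image_sub_le_of_norm_hasDerivWithin_le (x := 0) (y := t) (s := Set.univ)
    (fun s _ => (hasDerivAt_exp_smul_apply B x s).hasDerivWithinAt)
    (fun s _ => (norm_exp_smul_apply hB (B x) s).le) convex_univ trivial trivial
  simpa [mul_comm] using this

/-- A strongly continuous group of isometries whose generator is the inverse of the bounded
operator `J`. -/
structure IsometricGroup (J : E →L[ℝ] E) where
  toFun : ℝ → E →L[ℝ] E
  norm_map : ∀ t x, ‖toFun t x‖ = ‖x‖
  toFun_zero : ∀ x, toFun 0 x = x
  toFun_add : ∀ s t x, toFun (s + t) x = toFun s (toFun t x)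
  continuous : ∀ x, Continuous fun t => toFun t x
  hasDerivAt : ∀ x t, HasDerivAt (fun s => toFun s (J x)) (toFun t x) t
  comm : ∀ T : E →L[ℝ] E, (∀ x, T (J x) = J (T x)) → ∀ t x, toFun t (T x) = T (toFun t x)

/-- Yosida approximation. With `R = -J²`, the operators `B n = -J (ε n + R)⁻¹` are bounded, skew,
commute with each other, and `B n (J x) → x`, so they approximate `J⁻¹`. Their exponentials are
isometries that converge on the dense range of `J`, hence everywhere, uniformly on compact time
sets. -/
theorem exists_isometricGroup (J : E →L[ℝ] E) (hJ : ∀ x y, ⟪J x, y⟫ = -⟪x, J y⟫)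
    (hinj : Function.Injective J) : Nonempty (IsometricGroup J) := by
  let _ : NormedAlgebra ℚ (E →L[ℝ] E) := NormedAlgebra.restrictScalars ℚ ℝ _
  set R : E →L[ℝ] E := -(J * J) with hRdef
  have hRa : ∀ x, R x = -J (J x) := fun x => rfl
  have hR : ∀ x, 0 ≤ ⟪R x, x⟫ := fun x => by
    rw [hRa, inner_neg_left, hJ, neg_neg]; exact real_inner_self_nonneg
  have hRs : ∀ x y, ⟪R x, y⟫ = ⟪x, R y⟫ := fun x y => by
    simp only [hRa, inner_neg_left, inner_neg_right, hJ, neg_neg]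
  have hRi : Function.Injective R := fun x y h => hinj (hinj (neg_injective h))
  set ε : ℕ → ℝ := fun n => 1 / ((n : ℝ) + 1) with hεdef
  have hε : ∀ n, 0 < ε n := fun n => Nat.one_div_pos_of_nat
  have hεt : Tendsto ε atTop (𝓝[>] 0) :=
    tendsto_nhdsWithin_iff.2 ⟨tendsto_one_div_add_atTop_nhds_zero_nat,
      Eventually.of_forall hε⟩
  set M : ℕ → E →L[ℝ] E := fun n => resolventAt R (ε n)
  have hMc : ∀ n (T : E →L[ℝ] E), (∀ x, T (J x) = J (T x)) → ∀ x, T (M n x) = M n (T x) :=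
    fun n T hT x => resolventAt_comm hR (hε n) (fun x => by simp [hRa, hT]) x
  set B : ℕ → E →L[ℝ] E := fun n => -(J * M n) with hBdef
  have hBa : ∀ n x, B n x = -J (M n x) := fun n x => rfl
  have hBc : ∀ n (T : E →L[ℝ] E), (∀ x, T (J x) = J (T x)) → ∀ x, T (B n x) = B n (T x) :=
    fun n T hT x => by rw [hBa, hBa, map_neg, hT, hMc n T hT]
  have hBJ : ∀ n x, B n (J x) = x - ε n • M n x := fun n x => by
    have := add_resolventAt hR (hε n) x
    rw [hBa, ← hMc n J (fun _ => rfl), eq_sub_iff_add_eq']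
    exact this
  -- With `y = M n x` one has `x = ε y - J² y` and `B n x = -J y`, and `⟪J z, z⟫ = 0` kills both
  -- terms.
  have hskew : ∀ n x, ⟪B n x, x⟫ = 0 := fun n x => by
    have h0 : ∀ y, ⟪J y, y⟫ = 0 := fun y => by
      have := hJ y y; rw [real_inner_comm y (J y)] at this ⊢; linarith
    obtain ⟨y, hy⟩ : ∃ y, y = M n x := ⟨_, rfl⟩
    have h1 : x = ε n • y - J (J y) := by
      have := add_resolventAt hR (hε n) x
      rw [hRa] at this; rw [← sub_eq_add_neg] at this; rw [hy]; exact this.symm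
    rw [hBa, ← hy, h1, inner_neg_left, inner_sub_right, inner_smul_right, h0, real_inner_comm (J (J y)) (J y), h0]
    simp
  set U : ℕ → ℝ → E →L[ℝ] E := fun n t => NormedSpace.exp (t • B n)
  have hUn : ∀ n t x, ‖U n t x‖ = ‖x‖ := fun n t x => norm_exp_smul_apply (hskew n) x t
  have hBB : ∀ n m, Commute (B n) (B m) := fun n m => by
    refine ContinuousLinearMap.ext fun x => hBc m (B n) (fun x => ?_) x
    exact ((hBc n J (fun _ => rfl)) x).symm
  -- Commuting generators give `U n t = U m t * exp (t (B n - B m))`; since `U m t` is an isometry,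
  -- only the distance of the last factor from the identity remains.
  have hdiff : ∀ n m t x, ‖U n t (J x) - U m t (J x)‖ ≤
      |t| * (‖ε n • M n x‖ + ‖ε m • M m x‖) := fun n m t x => by
    have h1 : U n t = U m t * NormedSpace.exp (t • (B n - B m)) := by
      rw [← NormedSpace.exp_add_of_commute]
      · rw [← smul_add, add_sub_cancel]
      · exact (((hBB m n).sub_right (Commute.refl _)).smul_left t).smul_right t
    have h2 : U n t (J x) - U m t (J x) =
        U m t (NormedSpace.exp (t • (B n - B m)) (J x) - J x) := by
      rw [h1, map_sub]; rfl
    rw [h2, hUn]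
    refine (norm_exp_smul_sub_le (fun y => ?_) _ _).trans ?_
    · rw [sub_apply, inner_sub_left, hskew, hskew, sub_zero]
    · refine mul_le_mul_of_nonneg_left ?_ (abs_nonneg t)
      rw [sub_apply, hBJ, hBJ, sub_sub_sub_cancel_left]
      exact (norm_sub_le _ _).trans (add_comm _ _).le
  have hsmall : ∀ x, Tendsto (fun n => ‖ε n • M n x‖) atTop (𝓝 0) := fun x => by
    have := ((tendsto_smul_resolventAt hR hRs hRi x).comp hεt).norm
    simpa using this
  have hJd : DenseRange J := denseRange_of_injective_of_adjoint (T' := -J)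
    (fun x y => by rw [hJ]; simp) (fun x y h => hinj (neg_injective h))
  have happrox : ∀ (C : ℝ) (y : E) (δ : ℝ), 0 < δ → ∃ N, ∀ n ≥ N, ∀ m ≥ N, ∀ t, |t| ≤ C →
      ‖U n t y - U m t y‖ < δ := by
    intro C y δ hδ
    obtain ⟨x, hx⟩ := hJd.exists_dist_lt y (show 0 < δ / 4 by positivity)
    rw [dist_eq_norm] at hx
    have hCt := (hsmall x).const_mul (4 * |C|)
    rw [mul_zero] at hCt
    obtain ⟨N, hN⟩ := eventually_atTop.1 (hCt.eventually_lt_const hδ)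
    refine ⟨N, fun n hn m hm t ht => ?_⟩
    have e : U n t y - U m t y = U n t (y - J x) - U m t (y - J x) +
        (U n t (J x) - U m t (J x)) := by simp only [map_sub]; abel
    rw [e]
    have h1 := norm_add_le (U n t (y - J x) - U m t (y - J x)) (U n t (J x) - U m t (J x))
    have h2 := norm_sub_le (U n t (y - J x)) (U m t (y - J x))
    rw [hUn, hUn] at h2
    have h3 := hdiff n m t x
    have h4 := hN n hn
    have h5 := hN m hm
    have h6 : |t| ≤ |C| := ht.trans (le_abs_self C)
    have h7 : |t| * (‖ε n • M n x‖ + ‖ε m • M m x‖) ≤ |C| * (‖ε n • M n x‖ + ‖ε m • M m x‖) :=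
      mul_le_mul_of_nonneg_right h6 (by positivity)
    linarith
  have hcau : ∀ t y, CauchySeq fun n => U n t y := fun t y => by
    rw [Metric.cauchySeq_iff]
    intro δ hδ
    obtain ⟨N, hN⟩ := happrox |t| y δ hδ
    exact ⟨N, fun n hn m hm => by rw [dist_eq_norm]; exact hN n hn m hm t le_rfl⟩
  choose V hV using fun t y => cauchySeq_tendsto_of_complete (hcau t y)
  let W : ℝ → E →L[ℝ] E := fun t =>
    continuousLinearMapOfTendsto (fun n => U n t) (tendsto_pi_nhds.2 fun y => hV t y)
  have hW : ∀ t y, Tendsto (fun n => U n t y) atTop (𝓝 (W t y)) := hV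
  have hWn : ∀ t x, ‖W t x‖ = ‖x‖ := fun t x =>
    tendsto_nhds_unique (hW t x).norm (by simp only [hUn]; exact tendsto_const_nhds)
  have hUcont : ∀ n y, Continuous fun t => U n t y := fun n y =>
    continuous_iff_continuousAt.2 fun t => (hasDerivAt_exp_smul_apply (B n) y t).continuousAt
  have hWcont : ∀ y, Continuous fun t => W t y := fun y => by
    refine TendstoLocallyUniformly.continuous (F := fun n t => U n t y) (p := atTop) ?_
      (Eventually.of_forall fun n => hUcont n y).frequently
    rw [tendstoLocallyUniformly_iff_forall_isCompact]
    intro K hK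
    obtain ⟨C, hC⟩ := hK.isBounded.exists_norm_le
    rw [Metric.tendstoUniformlyOn_iff]
    intro δ hδ
    obtain ⟨N, hN⟩ := happrox C y (δ / 2) (half_pos hδ)
    filter_upwards [eventually_ge_atTop N] with n hn t ht
    have h := le_of_tendsto ((tendsto_const_nhds (x := U n t y)).sub (hW t y)).norm
      (eventually_atTop.2 ⟨N, fun m hm => (hN n hn m hm t (hC t ht)).le⟩)
    rw [dist_comm, dist_eq_norm]
    linarith
  refine ⟨⟨W, hWn, fun x => ?_, fun s t x => ?_, hWcont, fun x t => ?_, fun T hT t x => ?_⟩⟩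
  · refine tendsto_nhds_unique (hW 0 x) ?_
    simp [U]
  · refine tendsto_nhds_unique (hW (s + t) x) ?_
    have e : ∀ n, U n (s + t) x = U n s (W t x) + U n s (U n t x - W t x) := fun n => by
      rw [← map_add, add_sub_cancel]
      have : U n (s + t) = U n s * U n t := by
        rw [← NormedSpace.exp_add_of_commute, ← add_smul]
        exact ((Commute.refl _).smul_left s).smul_right t
      rw [this]; rfl
    simp only [e]
    have h0 : Tendsto (fun n => U n s (U n t x - W t x)) atTop (𝓝 0) := by
      rw [tendsto_zero_iff_norm_tendsto_zero]
      simp only [hUn]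
      exact tendsto_iff_norm_sub_tendsto_zero.1 (hW t x)
    simpa using (hW s (W t x)).add h0
  -- The derivative is obtained from the integral equation, which survives the limit by dominated
  -- convergence.
  · have hint : ∀ t, W t (J x) = J x + ∫ s in (0 : ℝ)..t, W s x := fun t => by
      have h1 : ∀ n, U n t (J x) = J x + ∫ s in (0 : ℝ)..t, U n s (B n (J x)) := fun n => by
        rw [intervalIntegral.integral_eq_sub_of_hasDerivAt
          (fun s _ => hasDerivAt_exp_smul_apply (B n) (J x) s)
          ((hUcont n _).intervalIntegrable _ _)]
        simp [U]
      refine tendsto_nhds_unique (hW t (J x)) ?_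
      simp only [h1]
      refine tendsto_const_nhds.add ?_
      refine intervalIntegral.tendsto_integral_filter_of_dominated_convergence (fun _ => 2 * ‖x‖)
        (Eventually.of_forall fun n => (hUcont n _).aestronglyMeasurable)
        (Eventually.of_forall fun n => Eventually.of_forall fun s _ => ?_)
        (intervalIntegrable_const) (Eventually.of_forall fun s _ => ?_)
      · rw [hUn, hBJ]
        exact (norm_sub_le _ _).trans (by linarith [norm_smul_resolventAt_le hR (hε n) x])
      · simp only [hBJ, map_sub]
        have h0 : Tendsto (fun n => U n s (ε n • M n x)) atTop (𝓝 0) := by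
          rw [tendsto_zero_iff_norm_tendsto_zero]
          simp only [hUn]
          exact hsmall x
        simpa using (hW s x).sub h0
    have : HasDerivAt (fun t => J x + ∫ s in (0 : ℝ)..t, W s x) (W t x) t :=
      (intervalIntegral.integral_hasDerivAt_right ((hWcont x).intervalIntegrable _ _)
        (hWcont x).aestronglyMeasurable.stronglyMeasurableAtFilter
        (hWcont x).continuousAt).const_add _
    exact this.congr_of_eventuallyEq (Eventually.of_forall hint)
  · refine tendsto_nhds_unique (hW t (T x)) ?_
    have e : ∀ n, U n t (T x) = T (U n t x) := fun n => by
      have h1 : Commute T (B n) := ContinuousLinearMap.ext fun y => hBc n T hT y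
      have : Commute T (U n t) := (h1.smul_right t).exp_right
      exact congrArg (fun S : E →L[ℝ] E => S x) this.eq.symm
    simp only [e]
    exact (T.continuous.tendsto _).comp (hW t x)

end Group

end Cascade

end

noncomputable section

set_option linter.unusedSectionVars false

namespace Cascade

open Filter Topology Set
open scoped RealInnerProductSpace

/-! ### A product rule for curves that are only weakly differentiable. -/

section Integration

theorem intervalIntegrable_clm_comp {E F : Type*} [NormedAddCommGroup E] [NormedSpace ℝ E]
    [NormedAddCommGroup F] [NormedSpace ℝ F] (L : E →L[ℝ] F) {f : ℝ → E} {a b : ℝ}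
    (hf : IntervalIntegrable f volume a b) : IntervalIntegrable (fun s => L (f s)) volume a b :=
  ⟨L.integrable_comp hf.1, L.integrable_comp hf.2⟩

/-- Summing the local estimate over a fine uniform partition gives a total error `ε ∫ ω`, and `ε` is
arbitrary. This replaces differentiation when the derivatives are merely integrable. -/
theorem sub_eq_integral_of_abs_sub_le {φ ψ ω : ℝ → ℝ} {T : ℝ} (hT : 0 ≤ T)
    (hψ : IntervalIntegrable ψ volume 0 T) (hω : IntervalIntegrable ω volume 0 T)
    (h : ∀ ε > 0, ∃ δ > 0, ∀ s ∈ Icc 0 T, ∀ t ∈ Icc 0 T, s ≤ t → t - s < δ →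
      |φ t - φ s - ∫ r in s..t, ψ r| ≤ ε * ∫ r in s..t, ω r) :
    φ T - φ 0 = ∫ r in (0 : ℝ)..T, ψ r := by
  have key : ∀ ε > 0, |φ T - φ 0 - ∫ r in (0 : ℝ)..T, ψ r| ≤ ε * ∫ r in (0 : ℝ)..T, ω r := by
    intro ε hε
    obtain ⟨δ, hδ, hd⟩ := h ε hε
    obtain ⟨n, hn⟩ := exists_nat_gt (T / δ)
    have hn0 : (0 : ℝ) < n := (div_nonneg hT hδ.le).trans_lt hn
    set a : ℕ → ℝ := fun k => k * (T / n) with ha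
    have h0 : a 0 = 0 := by simp [ha]
    have hN : a n = T := by simp only [ha]; field_simp
    have hmem : ∀ k ≤ n, a k ∈ Icc 0 T := fun k hk => by
      refine ⟨by positivity, ?_⟩
      rw [← hN]
      exact mul_le_mul_of_nonneg_right (by exact_mod_cast hk) (by positivity)
    have hstep : ∀ k, a (k + 1) - a k = T / n := fun k => by simp only [ha]; push_cast; ring
    have hmono : ∀ k, a k ≤ a (k + 1) := fun k => by
      linarith [hstep k, div_nonneg hT hn0.le]
    have hsub : ∀ {f : ℝ → ℝ}, IntervalIntegrable f volume 0 T → ∀ k < n,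
        IntervalIntegrable f volume (a k) (a (k + 1)) := fun hf k hk =>
      hf.mono_set (by
        rw [uIcc_of_le (hmono k), uIcc_of_le hT]
        exact Icc_subset_Icc (hmem k hk.le).1 (hmem (k + 1) hk).2)
    have e1 := intervalIntegral.sum_integral_adjacent_intervals (fun k hk => hsub hψ k hk)
    have e2 := intervalIntegral.sum_integral_adjacent_intervals (fun k hk => hsub hω k hk)
    have e3 := Finset.sum_range_sub (fun k => φ (a k)) n
    rw [h0, hN] at e1 e2 e3
    rw [← e1, ← e2, ← e3, ← Finset.sum_sub_distrib, Finset.mul_sum]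
    refine (Finset.abs_sum_le_sum_abs _ _).trans (Finset.sum_le_sum fun k hk => ?_)
    have hk' := Finset.mem_range.1 hk
    refine hd _ (hmem k hk'.le) _ (hmem (k + 1) hk') (hmono k) ?_
    rw [hstep, div_lt_iff₀ hn0]
    rw [div_lt_iff₀ hδ] at hn
    linarith
  have hlim : Tendsto (fun ε : ℝ => ε * ∫ r in (0 : ℝ)..T, ω r) (𝓝[>] 0) (𝓝 0) := by
    have : Tendsto (fun ε : ℝ => ε * ∫ r in (0 : ℝ)..T, ω r) (𝓝 0) (𝓝 (0 * _)) :=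
      tendsto_id.mul_const _
    rw [zero_mul] at this
    exact this.mono_left nhdsWithin_le_nhds
  have := ge_of_tendsto hlim (eventually_nhdsWithin_of_forall fun ε hε => key ε hε)
  exact sub_eq_zero.1 (abs_eq_zero.1 (le_antisymm this (abs_nonneg _)))

theorem integrable_inner_of_continuousOn {𝕜 E : Type*} [RCLike 𝕜] [NormedAddCommGroup E]
    [InnerProductSpace 𝕜 E] {a b : ℝ} {m γ : ℝ → E} (hm : ContinuousOn m (uIcc a b))
    (hγ : IntervalIntegrable γ volume a b) :
    IntervalIntegrable (fun s => inner 𝕜 (m s) (γ s)) volume a b := by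
  obtain ⟨C, hC⟩ := (isCompact_uIcc.image_of_continuousOn hm).isBounded.exists_norm_le
  have hms : AEStronglyMeasurable m (volume.restrict (uIoc a b)) :=
    (hm.mono uIoc_subset_uIcc).aestronglyMeasurable measurableSet_uIoc
  refine (hγ.norm.const_mul C).mono_fun (hms.inner hγ.def'.aestronglyMeasurable) ?_
  refine (ae_restrict_mem measurableSet_uIoc).mono fun s hs => ?_
  have hs' := hC _ (mem_image_of_mem m (uIoc_subset_uIcc hs))
  refine (norm_inner_le_norm _ _).trans ?_
  simp only
  rw [Real.norm_of_nonneg (mul_nonneg ((norm_nonneg _).trans hs') (norm_nonneg _))]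
  exact mul_le_mul_of_nonneg_right hs' (norm_nonneg _)

variable {E : Type*} [NormedAddCommGroup E] [InnerProductSpace ℝ E] [CompleteSpace E]

/-- Only `J m` and `J k` are primitives; `m` and `k` are merely continuous. Skewness gives `⟪m t, J
(k t)⟫ - ⟪m s, J (k s)⟫ = ∫ (⟪m t, γ⟫ - ⟪k s, β⟫)` over `[s, t]` with frozen `m t` and `k s`;
uniform continuity makes the freezing error small relative to `∫ (‖γ‖ + ‖β‖)`. -/
theorem inner_sub_inner_eq_integral {J : E →L[ℝ] E} (hJ : ∀ x y, ⟪J x, y⟫ = -⟪x, J y⟫)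
    {T : ℝ} (hT : 0 ≤ T) {m k β γ : ℝ → E} (hm : ContinuousOn m (Icc 0 T))
    (hk : ContinuousOn k (Icc 0 T)) (hβ : IntervalIntegrable β volume 0 T)
    (hγ : IntervalIntegrable γ volume 0 T)
    (hJm : ∀ t ∈ Icc 0 T, J (m t) = J (m 0) + ∫ s in (0 : ℝ)..t, β s)
    (hJk : ∀ t ∈ Icc 0 T, J (k t) = J (k 0) + ∫ s in (0 : ℝ)..t, γ s) :
    ⟪m T, J (k T)⟫ - ⟪m 0, J (k 0)⟫ = ∫ s in (0 : ℝ)..T, (⟪m s, γ s⟫ - ⟪β s, k s⟫) := by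
  have hm' : ContinuousOn m (uIcc 0 T) := by rwa [uIcc_of_le hT]
  have hk' : ContinuousOn k (uIcc 0 T) := by rwa [uIcc_of_le hT]
  have hψ : IntervalIntegrable (fun s => ⟪m s, γ s⟫ - ⟪β s, k s⟫) volume 0 T := by
    refine (integrable_inner_of_continuousOn hm' hγ).sub ?_
    simp_rw [real_inner_comm]
    exact integrable_inner_of_continuousOn hk' hβ
  refine sub_eq_integral_of_abs_sub_le (φ := fun t => ⟪m t, J (k t)⟫) (ω := fun s => ‖γ s‖ + ‖β s‖)
    hT hψ (hγ.norm.add hβ.norm) fun ε hε => ?_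
  have hum := isCompact_Icc.uniformContinuousOn_of_continuous hm
  have huk := isCompact_Icc.uniformContinuousOn_of_continuous hk
  obtain ⟨δ₁, hδ₁, h1⟩ := Metric.uniformContinuousOn_iff.1 hum ε hε
  obtain ⟨δ₂, hδ₂, h2⟩ := Metric.uniformContinuousOn_iff.1 huk ε hε
  refine ⟨min δ₁ δ₂, lt_min hδ₁ hδ₂, fun s hs t ht hst hlt => ?_⟩
  have hsub : uIcc s t ⊆ uIcc 0 T := by
    rw [uIcc_of_le hst, uIcc_of_le hT]; exact Icc_subset_Icc hs.1 ht.2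
  have h0s : uIcc 0 s ⊆ uIcc 0 T := by
    rw [uIcc_of_le hs.1, uIcc_of_le hT]; exact Icc_subset_Icc le_rfl hs.2
  have h0t : uIcc 0 t ⊆ uIcc 0 T := by
    rw [uIcc_of_le ht.1, uIcc_of_le hT]; exact Icc_subset_Icc le_rfl ht.2
  have hβs := hβ.mono_set hsub
  have hγs := hγ.mono_set hsub
  have e1 : J (m t) - J (m s) = ∫ r in s..t, β r := by
    rw [hJm t ht, hJm s hs, add_sub_add_left_eq_sub,
      intervalIntegral.integral_interval_sub_left (hβ.mono_set h0t) (hβ.mono_set h0s)]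
  have e2 : J (k t) - J (k s) = ∫ r in s..t, γ r := by
    rw [hJk t ht, hJk s hs, add_sub_add_left_eq_sub,
      intervalIntegral.integral_interval_sub_left (hγ.mono_set h0t) (hγ.mono_set h0s)]
  have i1 : ∫ r in s..t, ⟪m t, γ r⟫ = ⟪m t, ∫ r in s..t, γ r⟫ :=
    (innerSL ℝ (m t)).intervalIntegral_comp_comm hγs
  have i2 : ∫ r in s..t, ⟪k s, β r⟫ = ⟪k s, ∫ r in s..t, β r⟫ :=
    (innerSL ℝ (k s)).intervalIntegral_comp_comm hβs
  have j1 : IntervalIntegrable (fun r => ⟪m t, γ r⟫) volume s t :=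
    intervalIntegrable_clm_comp (innerSL ℝ (m t)) hγs
  have j2 : IntervalIntegrable (fun r => ⟪k s, β r⟫) volume s t :=
    intervalIntegrable_clm_comp (innerSL ℝ (k s)) hβs
  have e3 : ⟪m t, J (k t)⟫ - ⟪m s, J (k s)⟫ = ∫ r in s..t, (⟪m t, γ r⟫ - ⟪k s, β r⟫) := by
    have hks : ∀ x, ⟪k s, J x⟫ = -⟪x, J (k s)⟫ := fun x => by rw [real_inner_comm, hJ]
    rw [intervalIntegral.integral_sub j1 j2, i1, i2, ← e1, ← e2, inner_sub_right, inner_sub_right,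
      hks, hks]
    ring
  rw [e3, ← intervalIntegral.integral_sub
    (j1.sub j2) (hψ.mono_set hsub),
    ← intervalIntegral.integral_const_mul]
  rw [← Real.norm_eq_abs]
  refine intervalIntegral.norm_integral_le_of_norm_le hst ?_ ((hγs.norm.add hβs.norm).const_mul ε)
  refine Eventually.of_forall fun r hr => ?_
  have hr' : r ∈ Icc 0 T := ⟨hs.1.trans hr.1.le, hr.2.trans ht.2⟩
  have d1 : ‖m t - m r‖ ≤ ε := by
    rw [← dist_eq_norm]
    refine (h1 t ht r hr' ?_).le
    rw [Real.dist_eq, abs_of_nonneg (by linarith [hr.2])]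
    linarith [min_le_left δ₁ δ₂, hr.1]
  have d2 : ‖k r - k s‖ ≤ ε := by
    rw [← dist_eq_norm]
    refine (h2 r hr' s hs ?_).le
    rw [Real.dist_eq, abs_of_nonneg (by linarith [hr.1])]
    linarith [min_le_right δ₁ δ₂, hr.2]
  have e4 : ⟪m t, γ r⟫ - ⟪k s, β r⟫ - (⟪m r, γ r⟫ - ⟪β r, k r⟫) =
      ⟪m t - m r, γ r⟫ + ⟪k r - k s, β r⟫ := by
    rw [inner_sub_left, inner_sub_left, real_inner_comm (k r) (β r)]; ring
  rw [e4]
  refine (norm_add_le _ _).trans ?_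
  rw [mul_add]
  refine add_le_add ?_ ?_
  · exact (norm_inner_le_norm _ _).trans (mul_le_mul_of_nonneg_right d1 (norm_nonneg _))
  · exact (norm_inner_le_norm _ _).trans (mul_le_mul_of_nonneg_right d2 (norm_nonneg _))

end Integration

/-- The bound makes `l` factor through the range of `O`; Hahn–Banach extends it to `V` and Riesz
represents it. It serves twice: with `O = J` to invert `J` on a vector, and with `O` the observation
to produce the control. -/
theorem exists_inner_eq_of_abs_le {X V : Type*} [AddCommGroup X] [Module ℝ X]
    [NormedAddCommGroup V] [InnerProductSpace ℝ V] [CompleteSpace V] (O : X →ₗ[ℝ] V)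
    (l : X →ₗ[ℝ] ℝ) {M : ℝ} (hM : 0 ≤ M) (h : ∀ x, |l x| ≤ M * ‖O x‖) :
    ∃ v : V, ‖v‖ ≤ M ∧ ∀ x, ⟪v, O x⟫ = l x := by
  have hker : LinearMap.ker O ≤ LinearMap.ker l := fun x hx => by
    rw [LinearMap.mem_ker] at hx ⊢
    have := h x
    rw [hx, norm_zero, mul_zero] at this
    exact abs_eq_zero.1 (le_antisymm this (abs_nonneg _))
  let g₀ : LinearMap.range O →ₗ[ℝ] ℝ :=
    ((LinearMap.ker O).liftQ l hker).comp O.quotKerEquivRange.symm.toLinearMap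
  have hg₀ : ∀ x, g₀ ⟨O x, x, rfl⟩ = l x := fun x => by
    have : O.quotKerEquivRange.symm ⟨O x, x, rfl⟩ = (LinearMap.ker O).mkQ x :=
      O.quotKerEquivRange_symm_apply_image x ⟨x, rfl⟩
    change ((LinearMap.ker O).liftQ l hker) (O.quotKerEquivRange.symm ⟨O x, x, rfl⟩) = l x
    rw [this]; rfl
  let g : StrongDual ℝ (LinearMap.range O) := g₀.mkContinuous M (by
    rintro ⟨_, x, rfl⟩
    rw [hg₀]; exact h x)
  obtain ⟨G, hG, hGn⟩ := exists_extension_norm_eq _ g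
  refine ⟨(InnerProductSpace.toDual ℝ V).symm G, ?_, fun x => ?_⟩
  · rw [LinearIsometryEquiv.norm_map, hGn]
    exact LinearMap.mkContinuous_norm_le _ hM _
  · rw [InnerProductSpace.toDual_symm_apply]
    exact (hG ⟨O x, x, rfl⟩).trans (hg₀ x)

/-! ### Duhamel's formula and integration by parts for an isometric group. -/

namespace IsometricGroup

variable {E : Type*} [NormedAddCommGroup E] [InnerProductSpace ℝ E] [CompleteSpace E]
  {J : E →L[ℝ] E} (U : IsometricGroup J)

theorem map_neg_map (t : ℝ) (x : E) : U.toFun (-t) (U.toFun t x) = x := by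
  rw [← U.toFun_add, neg_add_cancel, U.toFun_zero]

theorem map_map_neg (t : ℝ) (x : E) : U.toFun t (U.toFun (-t) x) = x := by
  rw [← U.toFun_add, add_neg_cancel, U.toFun_zero]

theorem inner_map_map (t : ℝ) (x y : E) : ⟪U.toFun t x, U.toFun t y⟫ = ⟪x, y⟫ :=
  LinearIsometry.inner_map_map ⟨(U.toFun t).toLinearMap, U.norm_map t⟩ x y

theorem inner_map (t : ℝ) (x y : E) : ⟪U.toFun t x, y⟫ = ⟪x, U.toFun (-t) y⟫ := by
  rw [← U.inner_map_map t x, U.map_map_neg]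

theorem comm_self (t : ℝ) (x : E) : U.toFun t (J x) = J (U.toFun t x) := U.comm J (fun _ => rfl) t x

theorem continuous_uncurry : Continuous fun p : ℝ × E => U.toFun p.1 p.2 := by
  rw [continuous_iff_continuousAt]
  rintro ⟨t, x⟩
  rw [ContinuousAt, tendsto_iff_norm_sub_tendsto_zero]
  have h1 : Tendsto (fun p : ℝ × E => ‖p.2 - x‖) (𝓝 (t, x)) (𝓝 0) := by
    have : Continuous fun p : ℝ × E => ‖p.2 - x‖ := by fun_prop
    simpa using this.tendsto (t, x)
  have h2 : Tendsto (fun p : ℝ × E => ‖U.toFun p.1 x - U.toFun t x‖) (𝓝 (t, x)) (𝓝 0) := by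
    have : Continuous fun p : ℝ × E => ‖U.toFun p.1 x - U.toFun t x‖ :=
      (((U.continuous x).comp continuous_fst).sub continuous_const).norm
    simpa using this.tendsto (t, x)
  refine squeeze_zero (fun _ => norm_nonneg _) (fun p => ?_) (by simpa using h1.add h2)
  rw [← U.norm_map p.1 (p.2 - x), map_sub]
  exact norm_sub_le_norm_sub_add_norm_sub _ _ _

theorem continuousOn_map {s : Set ℝ} {τ : ℝ → ℝ} {x : ℝ → E} (hτ : ContinuousOn τ s)
    (hx : ContinuousOn x s) : ContinuousOn (fun t => U.toFun (τ t) (x t)) s :=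
  U.continuous_uncurry.comp_continuousOn (hτ.prodMk hx)

theorem intervalIntegrable_map {a b : ℝ} {f : ℝ → E} (hf : IntervalIntegrable f volume a b) :
    IntervalIntegrable (fun s => U.toFun (-s) (f s)) volume a b := by
  refine hf.mono_fun ?_ (Eventually.of_forall fun s => (U.norm_map _ _).le)
  exact U.continuous_uncurry.comp_aestronglyMeasurable
    (continuous_neg.aestronglyMeasurable.prodMk hf.def'.aestronglyMeasurable)

/-- `U` is only strongly continuous, so the product rule needs the frozen vector in the domain of
the generator. This is ensured by `J`: the part `J (x t)` is differentiated through the group, the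
part `J (x r - x t)` through joint continuity of `U` applied to slopes. -/
theorem hasDerivWithinAt_map_mul (σ : ℝ) {s : Set ℝ} {x : ℝ → E} {x' : E} {t : ℝ}
    (hx : HasDerivWithinAt x x' s t) :
    HasDerivWithinAt (fun r => U.toFun (σ * r) (J (x r))) (U.toFun (σ * t) (J x' + σ • x t)) s t := by
  have h1 : HasDerivWithinAt (fun r => U.toFun (σ * r) (J (x t))) (σ • U.toFun (σ * t) (x t)) s t := by
    have := (U.hasDerivAt (x t) (σ * t)).scomp t (hasDerivAt_const_mul σ)
    simpa [Function.comp_def] using this.hasDerivWithinAt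
  have h2 : HasDerivWithinAt (fun r => U.toFun (σ * r) (J (x r - x t)))
      (U.toFun (σ * t) (J x')) s t := by
    rw [hasDerivWithinAt_iff_tendsto_slope] at hx ⊢
    have h3 : Tendsto (fun r => (σ * r, J (slope x t r))) (𝓝[s \ {t}] t) (𝓝 (σ * t, J x')) :=
      (((continuous_const_mul σ).tendsto t).mono_left nhdsWithin_le_nhds).prodMk_nhds
        ((J.continuous.tendsto _).comp hx)
    refine ((U.continuous_uncurry.tendsto _).comp h3).congr fun r => ?_
    simp [slope_def_module]
  refine (h2.add h1).congr_deriv ?_ |>.congr (fun r _ => ?_) ?_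
  · rw [map_add, map_smul]
  · simp
  · simp

theorem hasDerivWithinAt_map_neg {s : Set ℝ} {x : ℝ → E} {x' : E} {t : ℝ}
    (hx : HasDerivWithinAt x x' s t) :
    HasDerivWithinAt (fun r => U.toFun (-r) (J (x r))) (U.toFun (-t) (J x' - x t)) s t := by
  simpa [sub_eq_add_neg] using U.hasDerivWithinAt_map_mul (-1) hx

/-- The source term `∫₀ᵗ U(-s) f(s) ds` of the variation of constants formula. -/
def source (f : ℝ → E) (t : ℝ) : E := ∫ s in (0 : ℝ)..t, U.toFun (-s) (f s)

theorem source_zero (f : ℝ → E) : U.source f 0 = 0 := by simp [source]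

theorem continuousOn_source {f : ℝ → E} {T : ℝ} (hT : 0 ≤ T) (hf : IntervalIntegrable f volume 0 T) :
    ContinuousOn (U.source f) (Icc 0 T) := by
  have := intervalIntegral.continuousOn_primitive_interval'
    (U.intervalIntegrable_map hf) left_mem_uIcc
  rwa [uIcc_of_le hT] at this

theorem map_source {f : ℝ → E} {t : ℝ} (hf : IntervalIntegrable f volume 0 t) {T : E →L[ℝ] E}
    (hT : ∀ x, T (J x) = J (T x)) : T (U.source f t) = U.source (fun s => T (f s)) t := by
  simp only [source, U.comm T hT]
  exact (T.intervalIntegral_comp_comm (U.intervalIntegrable_map hf)).symm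

theorem inner_source {f : ℝ → E} {t : ℝ} (hf : IntervalIntegrable f volume 0 t) (x : E) :
    ⟪x, U.source f t⟫ = ∫ s in (0 : ℝ)..t, ⟪U.toFun s x, f s⟫ := by
  simp only [source, U.inner_map]
  exact ((innerSL ℝ x).intervalIntegral_comp_comm (U.intervalIntegrable_map hf)).symm

theorem norm_source_le {f : ℝ → E} {t : ℝ} (ht : 0 ≤ t) :
    ‖U.source f t‖ ≤ ∫ s in (0 : ℝ)..t, ‖f s‖ := by
  refine (intervalIntegral.norm_integral_le_integral_norm ht).trans_eq ?_
  simp only [U.norm_map]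

/-- Integration by parts: the derivative of `U (-r) (J (f r))` is `U (-r) (J (f' r) - f r)`. A
differentiable source thus contributes a vector in the range of `J`. -/
theorem source_eq_of_hasDerivWithinAt {f f' : ℝ → E} {t : ℝ} (ht : 0 ≤ t)
    (hf : ∀ s ∈ Icc 0 t, HasDerivWithinAt f (f' s) (Icc 0 t) s) (hf' : ContinuousOn f' (Icc 0 t)) :
    U.source f t = J (f 0) - U.toFun (-t) (J (f t)) + J (U.source f' t) := by
  have hfc : ContinuousOn f (Icc 0 t) := fun s hs => (hf s hs).continuousWithinAt
  have hfi : IntervalIntegrable f volume 0 t := hfc.intervalIntegrable_of_Icc ht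
  have hfi' : IntervalIntegrable f' volume 0 t := hf'.intervalIntegrable_of_Icc ht
  have hJi : IntervalIntegrable (fun s => J (f' s)) volume 0 t := intervalIntegrable_clm_comp J hfi'
  have h := intervalIntegral.integral_eq_sub_of_hasDerivAt_of_le ht
    (f := fun r => U.toFun (-r) (J (f r))) (f' := fun s => U.toFun (-s) (J (f' s) - f s))
    (U.continuousOn_map (continuous_neg.continuousOn) (J.continuous.comp_continuousOn hfc))
    (fun s hs => (U.hasDerivWithinAt_map_neg (hf s (Ioo_subset_Icc_self hs))).hasDerivAt
      (Icc_mem_nhds hs.1 hs.2)) (U.intervalIntegrable_map (hJi.sub hfi))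
  rw [U.map_source hfi' (fun _ => rfl)]
  simp only [map_sub, neg_zero, U.toFun_zero] at h
  rw [intervalIntegral.integral_sub (U.intervalIntegrable_map hJi) (U.intervalIntegrable_map hfi)]
    at h
  simp only [source]
  rw [sub_eq_iff_eq_add] at h
  rw [h]
  abel

/-- Every `C¹` curve solves `x' = J⁻¹ (x + F)` with `F = J x' - x`; this is Duhamel's formula for
it, multiplied by `J`. -/
theorem map_eq_of_hasDerivWithinAt {x x' : ℝ → E} {t : ℝ} (ht : 0 ≤ t)
    (hx : ∀ s ∈ Icc 0 t, HasDerivWithinAt x (x' s) (Icc 0 t) s) (hx' : ContinuousOn x' (Icc 0 t)) :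
    J (x t) = U.toFun t (J (x 0) + U.source (fun s => J (x' s) - x s) t) := by
  have hxc : ContinuousOn x (Icc 0 t) := fun s hs => (hx s hs).continuousWithinAt
  have hi' := hx'.intervalIntegrable_of_Icc (μ := volume) ht
  have h := U.source_eq_of_hasDerivWithinAt ht hx hx'
  have e : U.source (fun s => J (x' s) - x s) t = J (U.source x' t) - U.source x t := by
    rw [U.map_source hi' fun _ => rfl]
    simp only [source, map_sub]
    exact intervalIntegral.integral_sub (U.intervalIntegrable_map (intervalIntegrable_clm_comp J hi'))
      (U.intervalIntegrable_map (hxc.intervalIntegrable_of_Icc ht))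
  rw [e, h]
  simp only [map_add, map_sub, U.map_map_neg]
  abel

/-- Duality between a weak solution with source `J⁻¹ b` and a strong one with source `F`. -/
theorem inner_sub_inner_eq_integral (hJ : ∀ x y, ⟪J x, y⟫ = -⟪x, J y⟫) {T : ℝ} (hT : 0 ≤ T)
    {Y b Θ F : ℝ → E} (hY : ContinuousOn Y (Icc 0 T)) (hb : IntervalIntegrable b volume 0 T)
    (hJY : ∀ t ∈ Icc 0 T, J (Y t) = U.toFun t (J (Y 0) + U.source b t))
    (hΘ : ContinuousOn Θ (Icc 0 T)) (hF : IntervalIntegrable F volume 0 T)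
    (hJΘ : ∀ t ∈ Icc 0 T, J (Θ t) = U.toFun t (J (Θ 0) + U.source F t)) :
    ⟪Y T, J (Θ T)⟫ - ⟪Y 0, J (Θ 0)⟫ = ∫ s in (0 : ℝ)..T, (⟪Y s, F s⟫ - ⟪b s, Θ s⟫) := by
  have h := Cascade.inner_sub_inner_eq_integral hJ hT
    (m := fun t => U.toFun (-t) (Y t)) (k := fun t => U.toFun (-t) (Θ t))
    (U.continuousOn_map continuous_neg.continuousOn hY)
    (U.continuousOn_map continuous_neg.continuousOn hΘ)
    (U.intervalIntegrable_map hb) (U.intervalIntegrable_map hF)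
    (fun t ht => by
      simp only [← U.comm_self, hJY t ht, U.map_neg_map, neg_zero, U.toFun_zero]; rfl)
    (fun t ht => by
      simp only [← U.comm_self, hJΘ t ht, U.map_neg_map, neg_zero, U.toFun_zero]; rfl)
  simpa only [← U.comm_self, U.inner_map_map] using h

end IsometricGroup

end Cascade

end

/-! ### Observability of the adjoint cascade. -/

noncomputable section

set_option linter.unusedSectionVars false

namespace Cascade

open Filter Topology Set
open scoped RealInnerProductSpace

theorem sq_integral_le {g : ℝ → ℝ} {t : ℝ} (ht : 0 ≤ t) (hg : ContinuousOn g (Icc 0 t)) :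
    (∫ s in (0 : ℝ)..t, g s) ^ 2 ≤ t * ∫ s in (0 : ℝ)..t, g s ^ 2 := by
  rcases ht.eq_or_lt with rfl | h0
  · simp
  have i1 : IntervalIntegrable g volume 0 t := hg.intervalIntegrable_of_Icc ht
  have i2 : IntervalIntegrable (fun s => g s ^ 2) volume 0 t :=
    (hg.pow 2).intervalIntegrable_of_Icc ht
  set I := ∫ s in (0 : ℝ)..t, g s
  have h : 0 ≤ ∫ s in (0 : ℝ)..t, (g s - I / t) ^ 2 :=
    intervalIntegral.integral_nonneg ht fun s _ => sq_nonneg _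
  have e : ∫ s in (0 : ℝ)..t, (g s - I / t) ^ 2 =
      (∫ s in (0 : ℝ)..t, g s ^ 2) - 2 * (I / t) * I + t * (I / t) ^ 2 := by
    have : ∀ s, (g s - I / t) ^ 2 = g s ^ 2 - 2 * (I / t) * g s + (I / t) ^ 2 := fun s => by ring
    simp only [this]
    rw [intervalIntegral.integral_add (i2.sub (i1.const_mul _)) intervalIntegrable_const,
      intervalIntegral.integral_sub i2 (i1.const_mul _), intervalIntegral.integral_const_mul,
      intervalIntegral.integral_const, sub_zero, smul_eq_mul]
  rw [e] at h
  have := mul_nonneg ht h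
  field_simp at this
  nlinarith

namespace IsometricGroup

variable {E : Type*} [NormedAddCommGroup E] [InnerProductSpace ℝ E] [CompleteSpace E]
  {J : E →L[ℝ] E} (U : IsometricGroup J) (C : E →L[ℝ] E)

theorem sq_norm_source_le {f : ℝ → E} {t : ℝ} (ht : 0 ≤ t) (hf : ContinuousOn f (Icc 0 t)) :
    ‖U.source f t‖ ^ 2 ≤ t * ∫ s in (0 : ℝ)..t, ‖f s‖ ^ 2 :=
  (pow_le_pow_left₀ (norm_nonneg _) (U.norm_source_le ht) 2).trans (sq_integral_le ht hf.norm)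

/-- With `Φ₁ t = U t (J x₁)` and `Φ₂` the solution of `Φ₂' = J⁻¹ Φ₂ - C Φ₁`, `Φ₂ 0 = J x₂`, this is
`J⁻¹ (Φ₂ t)`. -/
def cascade (x₁ x₂ : E) (t : ℝ) : E :=
  U.toFun t x₂ + C (U.toFun t (J x₁)) - U.toFun t (C (J x₁))
    - U.toFun t (U.source (fun s => C (U.toFun s x₁)) t)

theorem continuous_source {f : ℝ → E} (hf : Continuous f) : Continuous (U.source f) :=
  intervalIntegral.continuous_primitive (fun _ _ =>
    (U.continuous_uncurry.comp (continuous_neg.prodMk hf)).intervalIntegrable _ _) 0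

theorem continuous_comp_map (x : E) : Continuous fun s => C (U.toFun s x) :=
  C.continuous.comp (U.continuous x)

theorem continuous_cascade (x₁ x₂ : E) : Continuous (U.cascade C x₁ x₂) := by
  have h := U.continuous_source (U.continuous_comp_map C x₁)
  exact (((U.continuous x₂).add (U.continuous_comp_map C _)).sub (U.continuous _)).sub
    (U.continuous_uncurry.comp (continuous_id.prodMk h))

/-- The four terms of `cascade` are what integration by parts makes of `J⁻¹` applied to the Duhamel
formula. In this form `J⁻¹` is never applied, and `C` need not commute with `J`. -/
theorem map_cascade (x₁ x₂ : E) {t : ℝ} (ht : 0 ≤ t) :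
    J (U.cascade C x₁ x₂ t) =
      U.toFun t (J x₂ - U.source (fun s => C (U.toFun s (J x₁))) t) := by
  have h := U.source_eq_of_hasDerivWithinAt ht (f := fun s => C (U.toFun s (J x₁)))
    (f' := fun s => C (U.toFun s x₁))
    (fun s _ => (C.hasFDerivAt.comp_hasDerivAt s (U.hasDerivAt x₁ s)).hasDerivWithinAt)
    (U.continuous_comp_map C x₁).continuousOn
  rw [h]
  simp only [cascade, map_add, map_sub, ← U.comm_self, U.toFun_zero, U.map_map_neg]
  abel

/-- The adjoint equation in the strong sense, for all data in `E`; it is what makes the cascade a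
strict solution of a forced wave equation. -/
theorem hasDerivAt_map_cascade (x₁ x₂ : E) (t : ℝ) :
    HasDerivAt (fun t => J (U.cascade C x₁ x₂ t))
      (U.cascade C x₁ x₂ t - C (U.toFun t (J x₁))) t := by
  have hc : Continuous fun s => U.toFun (-s) (C (U.toFun s x₁)) :=
    U.continuous_uncurry.comp (continuous_neg.prodMk (U.continuous_comp_map C x₁))
  have hσ : HasDerivAt (U.source fun s => C (U.toFun s x₁)) (U.toFun (-t) (C (U.toFun t x₁))) t :=
    intervalIntegral.integral_hasDerivAt_right (hc.intervalIntegrable _ _)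
      hc.aestronglyMeasurable.stronglyMeasurableAtFilter hc.continuousAt
  have h4 := U.hasDerivWithinAt_map_mul 1 hσ.hasDerivWithinAt (s := univ)
  rw [hasDerivWithinAt_univ] at h4
  simp only [one_mul, one_smul] at h4
  have h2 := (J.comp C).hasFDerivAt.comp_hasDerivAt t (U.hasDerivAt x₁ t)
  have h := (((U.hasDerivAt x₂ t).add h2).sub (U.hasDerivAt (C (J x₁)) t)).sub h4
  refine (h.congr_of_eventuallyEq (Eventually.of_forall fun r => ?_)).congr_deriv ?_
  · simp [cascade, U.comm_self]
  · simp only [cascade, ContinuousLinearMap.comp_apply, map_add, U.comm_self, U.map_map_neg]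
    abel

theorem source_cascade_shift (x : E) (τ t : ℝ) :
    U.source (fun s => C (U.toFun s x)) (τ + t) = U.source (fun s => C (U.toFun s x)) τ +
      U.toFun (-τ) (U.source (fun s => C (U.toFun s (U.toFun τ x))) t) := by
  have hc : Continuous fun s => U.toFun (-s) (C (U.toFun s x)) :=
    U.continuous_uncurry.comp (continuous_neg.prodMk (U.continuous_comp_map C x))
  have hc' : Continuous fun s => U.toFun (-s) (C (U.toFun s (U.toFun τ x))) :=
    U.continuous_uncurry.comp (continuous_neg.prodMk (U.continuous_comp_map C _))
  simp only [source]
  rw [← (U.toFun (-τ)).intervalIntegral_comp_comm (hc'.intervalIntegrable _ _),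
    ← intervalIntegral.integral_add_adjacent_intervals (hc.intervalIntegrable 0 τ)
      (hc.intervalIntegrable τ (τ + t))]
  congr 1
  have := intervalIntegral.integral_comp_add_left (a := 0) (b := t)
    (fun s => U.toFun (-s) (C (U.toFun s x))) τ
  rw [add_zero] at this
  rw [← this]
  refine intervalIntegral.integral_congr fun s _ => ?_
  rw [← U.toFun_add, ← U.toFun_add, neg_add, add_comm s τ]

/-- Restarting the cascade at time `τ`. It allows estimates on an initial window to be used on the
final window of `[0, T]`. -/
theorem cascade_add (hinj : Function.Injective J) (x₁ x₂ : E) {τ t : ℝ} (hτ : 0 ≤ τ)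
    (ht : 0 ≤ t) : U.cascade C x₁ x₂ (τ + t) =
      U.cascade C (U.toFun τ x₁) (U.cascade C x₁ x₂ τ) t := by
  refine hinj ?_
  rw [U.map_cascade C _ _ ht, U.map_cascade C _ _ hτ, U.map_cascade C _ _ (add_nonneg hτ ht),
    add_comm τ t, U.toFun_add, add_comm t τ, source_cascade_shift, U.comm_self τ x₁ |>.symm]
  simp only [map_sub, map_add, U.map_map_neg]
  abel

/-- The adjoint cascade as a linear function of its data. -/
def cascadeₗ (t : ℝ) : E × E →ₗ[ℝ] E where
  toFun x := U.cascade C x.1 x.2 t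
  map_add' x y := by
    have hc : ∀ z, IntervalIntegrable (fun s => U.toFun (-s) (C (U.toFun s z))) volume 0 t :=
      fun z => (U.continuous_uncurry.comp
        (continuous_neg.prodMk (U.continuous_comp_map C z))).intervalIntegrable _ _
    simp only [cascade, source, Prod.fst_add, Prod.snd_add, map_add]
    rw [intervalIntegral.integral_add (hc _) (hc _)]
    simp only [map_add]
    abel
  map_smul' c x := by
    simp only [cascade, source, Prod.smul_fst, Prod.smul_snd, map_smul,
      intervalIntegral.integral_smul, RingHom.id_apply, smul_sub, smul_add]

theorem cascade_zero_left (x : E) (t : ℝ) : U.cascade C 0 x t = U.toFun t x := by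
  simp [cascade, source]

theorem cascade_sub_cascade (x₁ x₂ : E) (t : ℝ) :
    U.cascade C x₁ x₂ t - U.cascade C x₁ 0 t = U.toFun t x₂ := by
  simp [cascade]

/-- In the frame moving with `U`, `Φ₁` is constant and `Φ₂` changes only through the coupling. As
`ρ` commutes with `U`, the pairing `⟪Φ₂, ρ Φ₁⟫` changes exactly by the coupling term. -/
theorem integral_inner_eq {ρ : E →L[ℝ] E} (hρ : ∀ x, ρ (J x) = J (ρ x)) (x₁ x₂ : E) {T : ℝ}
    (hT : 0 ≤ T) :
    ∫ s in (0 : ℝ)..T, -⟪C (U.toFun s (J x₁)), ρ (U.toFun s (J x₁))⟫ =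
      ⟪J (U.cascade C x₁ x₂ T), ρ (U.toFun T (J x₁))⟫ - ⟪J x₂, ρ (J x₁)⟫ := by
  rw [U.map_cascade C _ _ hT, ← U.comm ρ hρ, U.inner_map_map, inner_sub_left, sub_sub_cancel_left,
    real_inner_comm, U.inner_source ((U.continuous_comp_map C _).intervalIntegrable _ _),
    ← intervalIntegral.integral_neg]
  refine intervalIntegral.integral_congr fun s _ => ?_
  rw [real_inner_comm, U.comm ρ hρ]

variable {G : Type*} [NormedAddCommGroup G] [InnerProductSpace ℝ G] (O : E →L[ℝ] G)

/-- The free wave from `x₂` is the cascade minus the cascade with `x₂ = 0`. The free wave is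
observable, and admissibility bounds the observation of the subtracted part by `∫ ‖C Φ₁‖²`, hence by
`β` times the coupling integral. -/
theorem mul_sq_norm_le {ρ : E →L[ℝ] E} {β K c T₀ : ℝ} (hT₀ : 0 ≤ T₀) (hK : 0 ≤ K)
    (hC : ∀ x, ‖C x‖ ^ 2 ≤ β * -⟪C x, ρ x⟫)
    (hadm : ∀ x₁ x₂, ∫ t in (0 : ℝ)..T₀, ‖O (U.cascade C x₁ x₂ t)‖ ^ 2 ≤
      K * (‖J x₂‖ ^ 2 + ∫ t in (0 : ℝ)..T₀, ‖C (U.toFun t (J x₁))‖ ^ 2))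
    (hobs : ∀ x, c * ‖J x‖ ^ 2 ≤ ∫ t in (0 : ℝ)..T₀, ‖O (U.toFun t x)‖ ^ 2) (x₁ x₂ : E) :
    c * ‖J x₂‖ ^ 2 ≤ 2 * (∫ t in (0 : ℝ)..T₀, ‖O (U.cascade C x₁ x₂ t)‖ ^ 2) +
      2 * K * β * ∫ t in (0 : ℝ)..T₀, -⟪C (U.toFun t (J x₁)), ρ (U.toFun t (J x₁))⟫ := by
  have hi : ∀ y₁ y₂, IntervalIntegrable (fun t => ‖O (U.cascade C y₁ y₂ t)‖ ^ 2) volume 0 T₀ :=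
    fun y₁ y₂ => ((O.continuous.comp (U.continuous_cascade C y₁ y₂)).norm.pow 2).intervalIntegrable
      _ _
  have h1 : ∫ t in (0 : ℝ)..T₀, ‖O (U.toFun t x₂)‖ ^ 2 ≤
      ∫ t in (0 : ℝ)..T₀, (2 * ‖O (U.cascade C x₁ x₂ t)‖ ^ 2 + 2 * ‖O (U.cascade C x₁ 0 t)‖ ^ 2) := by
    refine intervalIntegral.integral_mono_on hT₀
      (((O.continuous.comp (U.continuous x₂)).norm.pow 2).intervalIntegrable _ _)
      (((hi _ _).const_mul _).add ((hi _ _).const_mul _)) fun t _ => ?_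
    rw [← U.cascade_sub_cascade C x₁, map_sub]
    nlinarith [norm_sub_le (O (U.cascade C x₁ x₂ t)) (O (U.cascade C x₁ 0 t)),
      norm_nonneg (O (U.cascade C x₁ x₂ t) - O (U.cascade C x₁ 0 t)),
      sq_nonneg (‖O (U.cascade C x₁ x₂ t)‖ - ‖O (U.cascade C x₁ 0 t)‖)]
  rw [intervalIntegral.integral_add ((hi _ _).const_mul _) ((hi _ _).const_mul _),
    intervalIntegral.integral_const_mul, intervalIntegral.integral_const_mul] at h1
  have h2 := hadm x₁ 0
  rw [map_zero, norm_zero, zero_pow two_ne_zero, zero_add] at h2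
  have h3 : ∫ t in (0 : ℝ)..T₀, ‖C (U.toFun t (J x₁))‖ ^ 2 ≤
      ∫ t in (0 : ℝ)..T₀, β * -⟪C (U.toFun t (J x₁)), ρ (U.toFun t (J x₁))⟫ := by
    refine intervalIntegral.integral_mono_on hT₀
      (((U.continuous_comp_map C _).norm.pow 2).intervalIntegrable _ _) ?_ fun t _ => hC _
    exact (((U.continuous_comp_map C _).inner (U.continuous_comp_map ρ _)).neg.const_mul
      β).intervalIntegrable _ _
  rw [intervalIntegral.integral_const_mul] at h3
  have h4 := mul_le_mul_of_nonneg_left h3 hK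
  linarith [hobs x₂]

/-- The inequality on one window of length `τ` is applied on `n` consecutive windows; `U` preserves
`‖J x‖`, so each contributes the same amount. -/
theorem nsmul_mul_sq_norm_le {ρ : E →L[ℝ] E} {c τ : ℝ}
    (hcoer : ∀ x, c * ‖J x‖ ^ 2 ≤
      ∫ t in (0 : ℝ)..τ, -⟪C (U.toFun t (J x)), ρ (U.toFun t (J x))⟫) (x : E) (n : ℕ) :
    n * (c * ‖J x‖ ^ 2) ≤
      ∫ t in (0 : ℝ)..n * τ, -⟪C (U.toFun t (J x)), ρ (U.toFun t (J x))⟫ := by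
  have hc : Continuous fun t => -⟪C (U.toFun t (J x)), ρ (U.toFun t (J x))⟫ :=
    ((U.continuous_comp_map C _).inner (U.continuous_comp_map ρ _)).neg
  induction n with
  | zero => simp
  | succ n ih =>
    rw [← intervalIntegral.integral_add_adjacent_intervals (hc.intervalIntegrable 0 (n * τ))
      (hc.intervalIntegrable (n * τ) _)]
    have h := hcoer (U.toFun (n * τ) x)
    rw [← U.comm_self, U.norm_map] at h
    simp only [← U.toFun_add] at h
    have e := intervalIntegral.integral_comp_add_right (a := 0) (b := τ)
      (fun t => -⟪C (U.toFun t (J x)), ρ (U.toFun t (J x))⟫) (n * τ)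
    rw [e, zero_add] at h
    have : τ + n * τ = ((n + 1 : ℕ) : ℝ) * τ := by push_cast; ring
    rw [this] at h
    push_cast at h ⊢
    linarith

/-- Observability of the adjoint cascade from its second component, in large time. -/
theorem exists_cascade_observable (hinj : Function.Injective J) {ρ : E →L[ℝ] E}
    (hρ : ∀ x, ρ (J x) = J (ρ x)) (hρn : ∀ x, ‖ρ x‖ = ‖x‖) {β K c₁ c₂ T₀ τ : ℝ} (hT₀ : 0 < T₀)
    (hτ : 0 < τ) (hK : 0 ≤ K) (hβ : 0 ≤ β) (hc₁ : 0 < c₁) (hc₂ : 0 < c₂)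
    (hC : ∀ x, ‖C x‖ ^ 2 ≤ β * -⟪C x, ρ x⟫) (hC0 : ∀ x, 0 ≤ -⟪C x, ρ x⟫)
    (hadm : ∀ x₁ x₂, ∫ t in (0 : ℝ)..T₀, ‖O (U.cascade C x₁ x₂ t)‖ ^ 2 ≤
      K * (‖J x₂‖ ^ 2 + ∫ t in (0 : ℝ)..T₀, ‖C (U.toFun t (J x₁))‖ ^ 2))
    (hobs : ∀ x, c₁ * ‖J x‖ ^ 2 ≤ ∫ t in (0 : ℝ)..T₀, ‖O (U.toFun t x)‖ ^ 2)
    (hcoer : ∀ x, c₂ * ‖J x‖ ^ 2 ≤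
      ∫ t in (0 : ℝ)..τ, -⟪C (U.toFun t (J x)), ρ (U.toFun t (J x))⟫) :
    ∃ Tstar : ℝ, ∀ T, Tstar ≤ T → ∃ c > 0, ∀ x₁ x₂, c * (‖J x₁‖ ^ 2 + ‖J x₂‖ ^ 2) ≤
      ∫ t in (0 : ℝ)..T, ‖O (U.cascade C x₁ x₂ t)‖ ^ 2 := by
  -- From `c₁ ‖J y‖² ≤ 2 P + 2 K β Q` with `P ≤ Ob` and `Q ≤ X`.
  set k₀ := (2 + 2 * K * β) / c₁ with hk₀
  have hk₀0 : 0 < k₀ := by positivity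
  -- The extra term pays for transporting the bound across the last window, where the source adds at
  -- most `T₀ β X` to the squared norm. Neither `k₀` nor `k` involves `T`.
  set k := 2 * k₀ + 2 * (T₀ * β) with hk
  have hk0 : 0 < k := by positivity
  -- After `n` windows, `X ≥ n c₂ ‖J x₁‖² ≥ 8 k ‖J x₁‖²`; the factor `8` is what the absorption in
  -- `hXOb` requires.
  obtain ⟨n, hn⟩ := exists_nat_gt (8 * k / c₂)
  rw [div_lt_iff₀ hc₂] at hn
  -- In the end `‖J x₁‖² ≤ Ob / (8 k)` and `‖J x₂‖² ≤ k (Ob + X) ≤ 2 k Ob`, which gives the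
  -- constant.
  refine ⟨max T₀ (n * τ), fun T hT => ⟨(1 / (8 * k) + 2 * k)⁻¹, by positivity, fun x₁ x₂ => ?_⟩⟩
  have hT₀T : T₀ ≤ T := (le_max_left _ _).trans hT
  have hnT : n * τ ≤ T := (le_max_right _ _).trans hT
  have hT0 : 0 ≤ T := hT₀.le.trans hT₀T
  have hd : 0 ≤ T - T₀ := sub_nonneg.2 hT₀T
  set q : ℝ → ℝ := fun t => -⟪C (U.toFun t (J x₁)), ρ (U.toFun t (J x₁))⟫ with hq
  have hqc : Continuous q :=
    ((U.continuous_comp_map C _).inner (U.continuous_comp_map ρ _)).neg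
  set p : ℝ → ℝ := fun t => ‖O (U.cascade C x₁ x₂ t)‖ ^ 2 with hp
  have hpc : Continuous p := (O.continuous.comp (U.continuous_cascade C x₁ x₂)).norm.pow 2
  have hmono : ∀ {g : ℝ → ℝ}, Continuous g → (∀ t, 0 ≤ g t) → ∀ a b, 0 ≤ a → a ≤ b → b ≤ T →
      ∫ t in a..b, g t ≤ ∫ t in (0 : ℝ)..T, g t := fun hg h0 a b ha hab hb =>
    intervalIntegral.integral_mono_interval ha hab hb (Eventually.of_forall h0)
      (hg.intervalIntegrable _ _)
  have hq0 : ∀ t, 0 ≤ q t := fun t => hC0 _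
  have hp0 : ∀ t, 0 ≤ p t := fun t => sq_nonneg _
  set X := ∫ t in (0 : ℝ)..T, q t with hX
  set Ob := ∫ t in (0 : ℝ)..T, p t with hOb
  have hX0 : 0 ≤ X := intervalIntegral.integral_nonneg hT0 fun t _ => hq0 t
  have hOb0 : 0 ≤ Ob := intervalIntegral.integral_nonneg hT0 fun t _ => hp0 t
  have bound : ∀ (y : E) (P Q : ℝ), P ≤ Ob → Q ≤ X →
      c₁ * ‖J y‖ ^ 2 ≤ 2 * P + 2 * K * β * Q → ‖J y‖ ^ 2 ≤ k₀ * (Ob + X) := by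
    intro y P Q hP hQ h
    rw [hk₀, div_mul_eq_mul_div, le_div_iff₀ hc₁]
    have : 2 * K * β * Q ≤ 2 * K * β * X := mul_le_mul_of_nonneg_left hQ (by positivity)
    have : 0 ≤ 2 * K * β * Ob := by positivity
    linarith
  have hb0 : ‖J x₂‖ ^ 2 ≤ k₀ * (Ob + X) :=
    bound _ _ _ (hmono hpc hp0 0 T₀ le_rfl hT₀.le hT₀T) (hmono hqc hq0 0 T₀ le_rfl hT₀.le hT₀T)
      (U.mul_sq_norm_le C O hT₀.le hK hC hadm hobs x₁ x₂)
  set z := U.cascade C x₁ x₂ (T - T₀) with hz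
  have hshift : ∀ g : ℝ → ℝ, ∫ t in (0 : ℝ)..T₀, g (t + (T - T₀)) = ∫ t in (T - T₀)..T, g t :=
    fun g => by rw [intervalIntegral.integral_comp_add_right, zero_add, add_sub_cancel]
  have hqshift : ∫ t in (0 : ℝ)..T₀, -⟪C (U.toFun t (J (U.toFun (T - T₀) x₁))),
      ρ (U.toFun t (J (U.toFun (T - T₀) x₁)))⟫ ≤ X := by
    simp only [← U.comm_self, ← U.toFun_add]
    rw [hshift q]
    exact hmono hqc hq0 _ _ hd (by linarith) le_rfl
  -- The same window estimate for the cascade restarted at `T - T₀`.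
  have hb1 : ‖J z‖ ^ 2 ≤ k₀ * (Ob + X) := by
    refine bound _ _ _ ?_ hqshift
      (U.mul_sq_norm_le C O hT₀.le hK hC hadm hobs (U.toFun (T - T₀) x₁) z)
    have e : ∫ t in (0 : ℝ)..T₀, ‖O (U.cascade C (U.toFun (T - T₀) x₁) z t)‖ ^ 2 =
        ∫ t in (0 : ℝ)..T₀, p (t + (T - T₀)) := by
      refine intervalIntegral.integral_congr fun t ht => ?_
      rw [uIcc_of_le hT₀.le] at ht
      simp only [hp, hz]
      rw [← U.cascade_add C hinj _ _ hd ht.1, add_comm]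
    rw [e, hshift p]
    exact hmono hpc hp0 _ _ hd (by linarith) le_rfl
  set w := U.cascade C x₁ x₂ T with hw
  have hb2 : ‖J w‖ ^ 2 ≤ k * (Ob + X) := by
    have e : J w = U.toFun T₀ (J z - U.source
        (fun s => C (U.toFun s (J (U.toFun (T - T₀) x₁)))) T₀) := by
      rw [← U.map_cascade C _ _ hT₀.le, hz, ← U.cascade_add C hinj _ _ hd hT₀.le, hw,
        sub_add_cancel]
    set σ := U.source (fun s => C (U.toFun s (J (U.toFun (T - T₀) x₁)))) T₀
    have h1 : ‖σ‖ ^ 2 ≤ T₀ * (β * X) := by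
      refine (U.sq_norm_source_le hT₀.le (U.continuous_comp_map C _).continuousOn).trans
        (mul_le_mul_of_nonneg_left ?_ hT₀.le)
      refine le_trans ?_ (mul_le_mul_of_nonneg_left hqshift hβ)
      rw [← intervalIntegral.integral_const_mul]
      refine intervalIntegral.integral_mono_on hT₀.le
        (((U.continuous_comp_map C _).norm.pow 2).intervalIntegrable _ _) ?_ fun t _ => hC _
      exact (((U.continuous_comp_map C _).inner (U.continuous_comp_map ρ _)).neg.const_mul
        β).intervalIntegrable _ _
    rw [e, U.norm_map]
    have h2 := norm_sub_le (J z) σ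
    have h3 : ‖J z - σ‖ ^ 2 ≤ 2 * ‖J z‖ ^ 2 + 2 * ‖σ‖ ^ 2 := by
      nlinarith [norm_nonneg (J z - σ), sq_nonneg (‖J z‖ - ‖σ‖)]
    have : 0 ≤ 2 * (T₀ * β) * Ob := by positivity
    rw [hk]
    linarith
  have hXle : X ≤ ‖J x₁‖ * (‖J x₂‖ + ‖J w‖) := by
    rw [hX, hq, U.integral_inner_eq C hρ x₁ x₂ hT0]
    have h1 := real_inner_le_norm (J w) (ρ (U.toFun T (J x₁)))
    have h2 := neg_le_of_abs_le (abs_real_inner_le_norm (J x₂) (ρ (J x₁)))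
    rw [hρn, U.norm_map] at h1
    rw [hρn] at h2
    linarith
  have hXge : 8 * k * ‖J x₁‖ ^ 2 ≤ X := by
    have h1 := U.nsmul_mul_sq_norm_le C hcoer x₁ n
    have h2 := hmono hqc hq0 0 (n * τ) le_rfl (by positivity) hnT
    nlinarith [sq_nonneg ‖J x₁‖]
  -- `X² ≤ ‖J x₁‖² (‖J x₂‖ + ‖J w‖)² ≤ ‖J x₁‖² · 4 k (Ob + X) ≤ X (Ob + X) / 2`, so `X` is absorbed
  -- by the observation.
  have hXOb : X ≤ Ob := by
    have h1 : X ^ 2 ≤ ‖J x₁‖ ^ 2 * (4 * k * (Ob + X)) := by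
      have h2 := pow_le_pow_left₀ hX0 hXle 2
      rw [mul_pow] at h2
      refine h2.trans (mul_le_mul_of_nonneg_left ?_ (sq_nonneg _))
      have h3 : k₀ * (Ob + X) ≤ k * (Ob + X) := by
        refine mul_le_mul_of_nonneg_right ?_ (by positivity)
        have : 0 ≤ T₀ * β := by positivity
        linarith
      nlinarith [sq_nonneg (‖J x₂‖ - ‖J w‖)]
    have h4 : ‖J x₁‖ ^ 2 * (4 * k * (Ob + X)) ≤ X * (Ob + X) / 2 := by
      have := mul_le_mul_of_nonneg_right hXge (show 0 ≤ Ob + X by positivity)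
      linarith
    rcases hX0.eq_or_lt with h | h
    · rw [← h]; exact hOb0
    · have : X * X ≤ X * ((Ob + X) / 2) := by nlinarith
      linarith [le_of_mul_le_mul_left this h]
  rw [inv_mul_le_iff₀ (by positivity), add_mul]
  have h5 : ‖J x₁‖ ^ 2 ≤ 1 / (8 * k) * Ob := by
    rw [div_mul_eq_mul_div, one_mul, le_div_iff₀ (by positivity)]
    linarith
  have h6 : k₀ * (Ob + X) ≤ k * (Ob + Ob) := by
    have : k₀ ≤ k := by
      have : 0 ≤ T₀ * β := by positivity
      linarith
    exact mul_le_mul this (by linarith) (by positivity) hk0.le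
  linarith

end IsometricGroup

end Cascade

end

/-! ### Admissible controls, and null controllability by duality. -/

noncomputable section

set_option linter.unusedSectionVars false

namespace Cascade

open Filter Topology Set
open scoped RealInnerProductSpace

theorem integral_mul_le_sqrt_mul_sqrt {α : Type*} [MeasurableSpace α] {μ : Measure α} {f g : α → ℝ}
    (hf0 : ∀ x, 0 ≤ f x) (hg0 : ∀ x, 0 ≤ g x) (hf : MemLp f 2 μ) (hg : MemLp g 2 μ) :
    ∫ x, f x * g x ∂μ ≤ √(∫ x, f x ^ 2 ∂μ) * √(∫ x, g x ^ 2 ∂μ) := by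
  have h := integral_mul_le_Lp_mul_Lq_of_nonneg (μ := μ) (f := f) (g := g)
    Real.HolderConjugate.two_two (Eventually.of_forall hf0) (Eventually.of_forall hg0)
    (by simpa using hf) (by simpa using hg)
  simpa [Real.sqrt_eq_rpow] using h

theorem abs_integral_inner_le {G : Type*} [NormedAddCommGroup G] [InnerProductSpace ℝ G]
    {a b : ℝ} (hab : a ≤ b) {v w : ℝ → G} (hv : MemLp v 2 (volume.restrict (Ioc a b)))
    (hw : MemLp w 2 (volume.restrict (Ioc a b))) :
    |∫ s in a..b, ⟪v s, w s⟫| ≤ √(∫ s in a..b, ‖v s‖ ^ 2) * √(∫ s in a..b, ‖w s‖ ^ 2) := by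
  have h1 : |∫ s in a..b, ⟪v s, w s⟫| ≤ ∫ s in a..b, ‖v s‖ * ‖w s‖ := by
    rw [← Real.norm_eq_abs]
    refine intervalIntegral.norm_integral_le_of_norm_le hab
      (Eventually.of_forall fun s _ => norm_inner_le_norm _ _) ?_
    rw [intervalIntegrable_iff_integrableOn_Ioc_of_le hab]
    exact hv.norm.integrable_mul hw.norm
  refine h1.trans ?_
  simp only [intervalIntegral.integral_of_le hab]
  exact integral_mul_le_sqrt_mul_sqrt (fun _ => norm_nonneg _) (fun _ => norm_nonneg _)
    hv.norm hw.norm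

theorem memLp_two_of_continuous {G : Type*} [NormedAddCommGroup G] {w : ℝ → G} (hw : Continuous w)
    (a b : ℝ) : MemLp w 2 (volume.restrict (Ioc a b)) := by
  obtain ⟨M, hM⟩ := ((isCompact_Icc (a := a) (b := b)).image hw).isBounded.exists_norm_le
  exact MemLp.of_bound hw.aestronglyMeasurable M ((ae_restrict_mem measurableSet_Ioc).mono
    fun s hs => hM _ (mem_image_of_mem w (Ioc_subset_Icc_self hs)))

namespace IsometricGroup

variable {E : Type*} [NormedAddCommGroup E] [InnerProductSpace ℝ E] [CompleteSpace E]
  {J : E →L[ℝ] E} (U : IsometricGroup J)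
  {G : Type*} [NormedAddCommGroup G] [InnerProductSpace ℝ G] {O : E →L[ℝ] G} {D : G →L[ℝ] E}

theorem intervalIntegrable_control {T : ℝ} (hT : 0 ≤ T) {v : ℝ → G}
    (hv : MemLp v 2 (volume.restrict (Ioc 0 T))) :
    IntervalIntegrable (fun s => D (v s)) volume 0 T := by
  refine intervalIntegrable_clm_comp D ?_
  rw [intervalIntegrable_iff_integrableOn_Ioc_of_le hT]
  exact hv.integrable one_le_two

/-- The dual form of admissibility. Paired with `x`, the integral equals `∫ ⟪v, O (U s x)⟫`, of size
at most `‖v‖ √K ‖J x‖` with the `L²` norm of `v`; a functional bounded by `‖J x‖` is `x ↦ ⟪y, J x⟫`,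
so the integral is `-J y` by skewness. -/
theorem exists_preimage_integral (hJ : ∀ x y, ⟪J x, y⟫ = -⟪x, J y⟫)
    (hO : ∀ x g, ⟪O x, g⟫ = ⟪x, D g⟫) {T K : ℝ} (hT : 0 ≤ T) (hK : 0 ≤ K)
    (hadm : ∀ x, ∫ t in (0 : ℝ)..T, ‖O (U.toFun t x)‖ ^ 2 ≤ K * ‖J x‖ ^ 2) {v : ℝ → G}
    (hv : MemLp v 2 (volume.restrict (Ioc 0 T))) {a b : ℝ} (ha : 0 ≤ a) (hab : a ≤ b)
    (hb : b ≤ T) :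
    ∃ y, J y = ∫ s in a..b, U.toFun (-s) (D (v s)) ∧ ‖y‖ ≤ √(∫ s in a..b, ‖v s‖ ^ 2) * √K := by
  have hsub : Ioc a b ⊆ Ioc 0 T := Ioc_subset_Ioc ha hb
  have hvab : MemLp v 2 (volume.restrict (Ioc a b)) :=
    hv.mono_measure (Measure.restrict_mono hsub le_rfl)
  have hDi : IntervalIntegrable (fun s => U.toFun (-s) (D (v s))) volume a b :=
    (U.intervalIntegrable_map (intervalIntegrable_control hT hv)).mono_set (by
      rw [uIcc_of_le hab, uIcc_of_le hT]; exact Icc_subset_Icc ha hb)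
  set z := ∫ s in a..b, U.toFun (-s) (D (v s))
  have hz : ∀ x, ⟪z, x⟫ = ∫ s in a..b, ⟪v s, O (U.toFun s x)⟫ := fun x => by
    have : ⟪x, z⟫ = ∫ s in a..b, ⟪x, U.toFun (-s) (D (v s))⟫ :=
      ((innerSL ℝ x).intervalIntegral_comp_comm hDi).symm
    rw [real_inner_comm, this]
    refine intervalIntegral.integral_congr fun s _ => ?_
    rw [← U.inner_map, ← hO, real_inner_comm]
  obtain ⟨y, hy, hyz⟩ := exists_inner_eq_of_abs_le (J : E →ₗ[ℝ] E) (innerₗ E z)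
    (M := √(∫ s in a..b, ‖v s‖ ^ 2) * √K) (by positivity) (fun x => by
      have hc : Continuous fun t => O (U.toFun t x) := O.continuous.comp (U.continuous x)
      rw [innerₗ_apply_apply, hz x]
      refine (abs_integral_inner_le hab hvab (memLp_two_of_continuous hc a b)).trans ?_
      rw [mul_assoc]
      refine mul_le_mul_of_nonneg_left ?_ (Real.sqrt_nonneg _)
      rw [← Real.sqrt_sq (norm_nonneg ((J : E →ₗ[ℝ] E) x)), ← Real.sqrt_mul hK]
      refine Real.sqrt_le_sqrt (le_trans ?_ (hadm x))
      exact intervalIntegral.integral_mono_interval ha hab hb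
        (Eventually.of_forall fun s => sq_nonneg _) ((hc.norm.pow 2).intervalIntegrable _ _))
  refine ⟨-y, ?_, by rwa [norm_neg]⟩
  refine ext_inner_right ℝ fun x => ?_
  have := hyz x
  rw [innerₗ_apply_apply] at this
  rw [map_neg, inner_neg_left, hJ, neg_neg, ← this]
  rfl

/-- The control enters the evolution as `J⁻¹ D v`, possibly outside `E`, so the equation is stated
after applying `J`. Admissibility puts the Duhamel integral in the range of `J`, and its preimage is
the contribution of the control. -/
theorem exists_weak_solution (hJ : ∀ x y, ⟪J x, y⟫ = -⟪x, J y⟫) (hinj : Function.Injective J)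
    (hO : ∀ x g, ⟪O x, g⟫ = ⟪x, D g⟫) {T K : ℝ} (hT : 0 ≤ T) (hK : 0 ≤ K)
    (hadm : ∀ x, ∫ t in (0 : ℝ)..T, ‖O (U.toFun t x)‖ ^ 2 ≤ K * ‖J x‖ ^ 2) {v : ℝ → G}
    (hv : MemLp v 2 (volume.restrict (Ioc 0 T))) (Y₀ : E) :
    ∃ Y : ℝ → E, ContinuousOn Y (Icc 0 T) ∧ Y 0 = Y₀ ∧
      ∀ t ∈ Icc 0 T, J (Y t) = U.toFun t (J Y₀ + U.source (fun s => D (v s)) t) := by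
  have hvi : IntervalIntegrable (fun s => ‖v s‖ ^ 2) volume 0 T := by
    rw [intervalIntegrable_iff_integrableOn_Ioc_of_le hT]
    exact hv.integrable_norm_pow two_ne_zero
  have hDi := U.intervalIntegrable_map (intervalIntegrable_control (D := D) hT hv)
  have h0 : ∀ t, ∃ y, t ∈ Icc 0 T → J y = U.source (fun s => D (v s)) t := fun t => by
    by_cases ht : t ∈ Icc 0 T
    · obtain ⟨y, hy, -⟩ := U.exists_preimage_integral hJ hO hT hK hadm hv le_rfl ht.1 ht.2
      exact ⟨y, fun _ => hy⟩
    · exact ⟨0, fun h => absurd h ht⟩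
  choose Λ hΛ using h0
  set F : ℝ → ℝ := fun t => ∫ s in (0 : ℝ)..t, ‖v s‖ ^ 2 with hF
  have hFc : ContinuousOn F (Icc 0 T) := by
    have := intervalIntegral.continuousOn_primitive_interval' hvi left_mem_uIcc
    rwa [uIcc_of_le hT] at this
  have hst : ∀ {t}, t ∈ Icc 0 T → uIcc 0 t ⊆ uIcc 0 T := fun {t} ht => by
    rw [uIcc_of_le ht.1, uIcc_of_le hT]; exact Icc_subset_Icc le_rfl ht.2
  -- The preimage bound on `[s, t]` involves only the `L²` norm of `v` there, so continuity of `Λ`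
  -- follows from that of the primitive `F`.
  have hle : ∀ s ∈ Icc 0 T, ∀ t ∈ Icc 0 T, s ≤ t → ‖Λ t - Λ s‖ ≤ √(F t - F s) * √K := by
    intro s hs t ht hst'
    obtain ⟨y, hy, hyn⟩ := U.exists_preimage_integral hJ hO hT hK hadm hv hs.1 hst' ht.2
    have : Λ t - Λ s = y := hinj (by
      rw [map_sub, hΛ t ht, hΛ s hs, hy, source, source,
        intervalIntegral.integral_interval_sub_left (hDi.mono_set (hst ht))
          (hDi.mono_set (hst hs))])
    rw [this, hF, intervalIntegral.integral_interval_sub_left (hvi.mono_set (hst ht))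
          (hvi.mono_set (hst hs))]
    exact hyn
  have hle' : ∀ s ∈ Icc 0 T, ∀ t ∈ Icc 0 T, ‖Λ t - Λ s‖ ≤ √|F t - F s| * √K := by
    intro s hs t ht
    rcases le_total s t with h | h
    · exact (hle s hs t ht h).trans
        (mul_le_mul_of_nonneg_right (Real.sqrt_le_sqrt (le_abs_self _)) (Real.sqrt_nonneg _))
    · rw [norm_sub_rev, abs_sub_comm]
      exact (hle t ht s hs h).trans
        (mul_le_mul_of_nonneg_right (Real.sqrt_le_sqrt (le_abs_self _)) (Real.sqrt_nonneg _))
  have hΛc : ContinuousOn Λ (Icc 0 T) := fun s hs => by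
    rw [ContinuousWithinAt, tendsto_iff_norm_sub_tendsto_zero]
    have h1 : Tendsto (fun t => √|F t - F s| * √K) (𝓝[Icc 0 T] s) (𝓝 (√|F s - F s| * √K)) :=
      (((hFc s hs).sub continuousWithinAt_const).abs.sqrt).mul_const _
    rw [sub_self, abs_zero, Real.sqrt_zero, zero_mul] at h1
    exact squeeze_zero' (Eventually.of_forall fun _ => norm_nonneg _)
      (eventually_nhdsWithin_of_forall fun t ht => hle' s hs t ht) h1
  have hΛ0 : Λ 0 = 0 := hinj (by
    rw [hΛ 0 (left_mem_Icc.2 hT), source_zero, map_zero])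
  refine ⟨fun t => U.toFun t (Y₀ + Λ t),
    U.continuousOn_map continuousOn_id (continuousOn_const.add hΛc), ?_, fun t ht => ?_⟩
  · simp only [hΛ0, add_zero, U.toFun_zero]
  · rw [← U.comm_self, map_add J, hΛ t ht]

variable [CompleteSpace G]

/-- Null controllability of the cascade system from observability of the adjoint cascade. -/
theorem exists_null_control (hJ : ∀ x y, ⟪J x, y⟫ = -⟪x, J y⟫) (hinj : Function.Injective J)
    (hO : ∀ x g, ⟪O x, g⟫ = ⟪x, D g⟫) {C C' : E →L[ℝ] E} (hC' : ∀ x y, ⟪C' x, y⟫ = ⟪x, C y⟫)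
    {T K c : ℝ} (hT : 0 ≤ T) (hK : 0 ≤ K) (hc : 0 < c)
    (hadm : ∀ x, ∫ t in (0 : ℝ)..T, ‖O (U.toFun t x)‖ ^ 2 ≤ K * ‖J x‖ ^ 2)
    (hobs : ∀ x₁ x₂, c * (‖J x₁‖ ^ 2 + ‖J x₂‖ ^ 2) ≤
      ∫ t in (0 : ℝ)..T, ‖O (U.cascade C x₁ x₂ t)‖ ^ 2) (Z₁ Z₂ : E) :
    ∃ v : ℝ → G, MemLp v 2 (volume.restrict (Ioc 0 T)) ∧ ∃ Y₁ Y₂ : ℝ → E,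
      ContinuousOn Y₁ (Icc 0 T) ∧ ContinuousOn Y₂ (Icc 0 T) ∧ Y₁ 0 = Z₁ ∧ Y₂ 0 = Z₂ ∧
      (∀ t, Y₁ t = U.toFun t (Z₁ + U.source (fun s => C' (Y₂ s)) t)) ∧
      (∀ t ∈ Icc 0 T, J (Y₂ t) = U.toFun t (J Z₂ + U.source (fun s => D (v s)) t)) ∧
      Y₁ T = 0 ∧ Y₂ T = 0 := by
  set μ := volume.restrict (Ioc 0 T) with hμ
  have hcc : ∀ x : E × E, Continuous fun t => O (U.cascadeₗ C t x) := fun x =>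
    O.continuous.comp (U.continuous_cascade C x.1 x.2)
  have hmem : ∀ x : E × E, MemLp (fun t => O (U.cascadeₗ C t x)) 2 μ := fun x =>
    memLp_two_of_continuous (hcc x) 0 T
  let Obs : E × E →ₗ[ℝ] Lp G 2 μ :=
    { toFun := fun x => (hmem x).toLp
      map_add' := fun x y => by
        rw [← MemLp.toLp_add]
        refine MemLp.toLp_congr _ _ (Eventually.of_forall fun t => ?_)
        simp only [map_add, Pi.add_apply]
      map_smul' := fun r x => by
        rw [RingHom.id_apply, ← MemLp.toLp_const_smul]
        refine MemLp.toLp_congr _ _ (Eventually.of_forall fun t => ?_)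
        simp only [map_smul, Pi.smul_apply] }
  have hObs : ∀ x : E × E, (Obs x : ℝ → G) =ᵐ[μ] fun t => O (U.cascadeₗ C t x) :=
    fun x => (hmem x).coeFn_toLp
  have hinner : ∀ (w : Lp G 2 μ) x, ⟪w, Obs x⟫ = ∫ t in (0 : ℝ)..T, ⟪w t, O (U.cascadeₗ C t x)⟫ :=
    fun w x => by
      rw [L2.inner_def, intervalIntegral.integral_of_le hT]
      refine integral_congr_ae ((hObs x).mono fun t ht => ?_)
      simp only [ht]
  have hnorm : ∀ x, ‖Obs x‖ ^ 2 = ∫ t in (0 : ℝ)..T, ‖O (U.cascadeₗ C t x)‖ ^ 2 := fun x => by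
    rw [← real_inner_self_eq_norm_sq, L2.inner_def, intervalIntegral.integral_of_le hT]
    refine integral_congr_ae ((hObs x).mono fun t ht => ?_)
    simp only [ht, real_inner_self_eq_norm_sq]
  let l : E × E →ₗ[ℝ] ℝ := (innerₗ E Z₁ ∘ₗ (J : E →ₗ[ℝ] E) ∘ₗ LinearMap.fst ℝ E E) +
    (innerₗ E Z₂ ∘ₗ (J : E →ₗ[ℝ] E) ∘ₗ LinearMap.snd ℝ E E)
  have hl : ∀ x, l x = ⟪Z₁, J x.1⟫ + ⟪Z₂, J x.2⟫ := fun x => rfl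
  -- Observability gives `‖J x₁‖, ‖J x₂‖ ≤ ‖Obs x‖ / √c`, so the pairing with the initial data is
  -- bounded by the observation. The representing element of `L²` is the control.
  obtain ⟨v, -, hv⟩ := exists_inner_eq_of_abs_le Obs l (M := (‖Z₁‖ + ‖Z₂‖) / √c) (by positivity)
    (fun x => by
      have h1 : c * (‖J x.1‖ ^ 2 + ‖J x.2‖ ^ 2) ≤ ‖Obs x‖ ^ 2 := (hobs x.1 x.2).trans (hnorm x).ge
      have hbd : ∀ y : E, ‖y‖ ^ 2 ≤ ‖J x.1‖ ^ 2 + ‖J x.2‖ ^ 2 → ‖y‖ ≤ ‖Obs x‖ / √c := fun y hy => by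
        rw [le_div_iff₀ (Real.sqrt_pos.2 hc)]
        refine le_of_sq_le_sq ?_ (norm_nonneg _)
        rw [mul_pow, Real.sq_sqrt hc.le]
        nlinarith
      have h2 := hbd (J x.1) (by nlinarith [sq_nonneg ‖J x.2‖])
      have h3 := hbd (J x.2) (by nlinarith [sq_nonneg ‖J x.1‖])
      rw [hl]
      refine (abs_add_le _ _).trans ?_
      have h4 := (abs_real_inner_le_norm Z₁ (J x.1)).trans
        (mul_le_mul_of_nonneg_left h2 (norm_nonneg _))
      have h5 := (abs_real_inner_le_norm Z₂ (J x.2)).trans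
        (mul_le_mul_of_nonneg_left h3 (norm_nonneg _))
      refine (add_le_add h4 h5).trans_eq ?_
      ring)
  have hvm : MemLp v 2 μ := Lp.memLp v
  obtain ⟨Y₂, hY₂c, hY₂0, hY₂⟩ := U.exists_weak_solution hJ hinj hO hT hK hadm hvm Z₂
  have hC'c : ContinuousOn (fun s => C' (Y₂ s)) (Icc 0 T) := C'.continuous.comp_continuousOn hY₂c
  have hC'i : IntervalIntegrable (fun s => C' (Y₂ s)) volume 0 T :=
    hC'c.intervalIntegrable_of_Icc hT
  let Y₁ : ℝ → E := fun t => U.toFun t (Z₁ + U.source (fun s => C' (Y₂ s)) t)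
  -- In the sum of the two duality identities the coupling terms cancel, `C'` being adjoint to `C`;
  -- what remains is `l x` minus the pairing of `v` with the observation, zero by the choice of `v`.
  have hdual : ∀ x₁ x₂, ⟪Y₁ T, U.toFun T (J x₁)⟫ + ⟪Y₂ T, J (U.cascade C x₁ x₂ T)⟫ = 0 := by
    intro x₁ x₂
    have hΦ := U.continuous_comp_map C (J x₁)
    have hcas := U.continuous_cascade C x₁ x₂
    have hDi := intervalIntegrable_control (D := D) hT hvm
    have c0 : U.cascade C x₁ x₂ 0 = x₂ := by simp [cascade, U.toFun_zero, source_zero]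
    have e1 := U.inner_sub_inner_eq_integral hJ hT hY₂c hDi
      (fun t ht => by rw [hY₂0]; exact hY₂ t ht) (Θ := U.cascade C x₁ x₂)
      (F := fun s => -C (U.toFun s (J x₁))) hcas.continuousOn
      (hΦ.neg.intervalIntegrable _ _) (fun t ht => by
        rw [U.map_cascade C _ _ ht.1, c0, sub_eq_add_neg]
        simp only [source, map_neg, intervalIntegral.integral_neg])
    have e2 : ⟪Y₁ T, U.toFun T (J x₁)⟫ = ⟪Z₁, J x₁⟫ +
        ∫ s in (0 : ℝ)..T, ⟪Y₂ s, C (U.toFun s (J x₁))⟫ := by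
      rw [U.inner_map_map, inner_add_left, real_inner_comm (J x₁) (U.source _ _),
        U.inner_source hC'i]
      congr 1
      refine intervalIntegral.integral_congr fun s _ => ?_
      rw [real_inner_comm, hC']
    have e3 := (hinner v (x₁, x₂)).symm.trans (hv (x₁, x₂))
    have e4 : ∀ s, ⟪v s, O (U.cascadeₗ C s (x₁, x₂))⟫ = ⟪D (v s), U.cascade C x₁ x₂ s⟫ := fun s => by
      rw [real_inner_comm, hO, real_inner_comm]; rfl
    simp only [e4, hl] at e3
    have i1 : IntervalIntegrable (fun s => ⟪Y₂ s, C (U.toFun s (J x₁))⟫) volume 0 T :=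
      (hY₂c.inner hΦ.continuousOn).intervalIntegrable_of_Icc hT
    have i1n : IntervalIntegrable (fun s => -⟪Y₂ s, C (U.toFun s (J x₁))⟫) volume 0 T := i1.neg
    have i2 : IntervalIntegrable (fun s => ⟪D (v s), U.cascade C x₁ x₂ s⟫) volume 0 T := by
      simp_rw [real_inner_comm]
      exact integrable_inner_of_continuousOn hcas.continuousOn hDi
    simp only [inner_neg_right] at e1
    rw [intervalIntegral.integral_sub i1n i2, intervalIntegral.integral_neg, e3, c0, hY₂0] at e1
    linarith
  -- Final data of the adjoint cascade are arbitrary: `y₁` is `x₁` transported backwards, and the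
  -- second datum corrects the contribution `r` of the coupling.
  have hY₁T : ∀ x₁ x₂, ⟪Y₁ T, J x₁⟫ + ⟪Y₂ T, J x₂⟫ = 0 := by
    intro x₁ x₂
    set y₁ := U.toFun (-T) x₁
    set r := U.cascade C y₁ 0 T
    have h := hdual y₁ (U.toFun (-T) (x₂ - r))
    have e1 : U.toFun T (J y₁) = J x₁ := by rw [U.comm_self, U.map_map_neg]
    have e2 : U.cascade C y₁ (U.toFun (-T) (x₂ - r)) T = x₂ := by
      rw [← sub_add_cancel (U.cascade C y₁ (U.toFun (-T) (x₂ - r)) T) r, U.cascade_sub_cascade,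
        U.map_map_neg, sub_add_cancel]
    rwa [e1, e2] at h
  have hzero : ∀ y, (∀ x, ⟪y, J x⟫ = 0) → y = 0 := fun y hy => by
    refine hinj ?_
    rw [map_zero]
    refine ext_inner_right ℝ fun x => ?_
    rw [hJ, hy, neg_zero, inner_zero_left]
  refine ⟨v, hvm, Y₁, Y₂, ?_, hY₂c, ?_, hY₂0, fun t => rfl, hY₂, hzero _ fun x => ?_,
    hzero _ fun x => ?_⟩
  · exact U.continuousOn_map continuousOn_id
      (continuousOn_const.add (U.continuousOn_source hT hC'i))
  · simp only [Y₁, source_zero, add_zero, U.toFun_zero]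
  · simpa using hY₁T x 0
  · simpa using hY₁T 0 x

end IsometricGroup

end Cascade

end

/-! ### The state space `H × H`. -/

noncomputable section

set_option linter.unusedSectionVars false

namespace Cascade

open Filter Topology Set
open scoped RealInnerProductSpace

section State

/-- The state space `H × H` with its Hilbert norm. -/
abbrev State (H : Type*) := WithLp 2 (H × H)

namespace State

variable {H X : Type*} [NormedAddCommGroup H] [InnerProductSpace ℝ H]
  [NormedAddCommGroup X] [NormedSpace ℝ X]

variable (H) in
/-- The first component of a state. -/
def fstL : State H →L[ℝ] H :=
  (ContinuousLinearMap.fst ℝ H H).comp (WithLp.prodContinuousLinearEquiv 2 ℝ H H).toContinuousLinearMap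

variable (H) in
/-- The second component of a state. -/
def sndL : State H →L[ℝ] H :=
  (ContinuousLinearMap.snd ℝ H H).comp (WithLp.prodContinuousLinearEquiv 2 ℝ H H).toContinuousLinearMap

/-- The operator into the state space with given components. -/
def pair (f g : X →L[ℝ] H) : X →L[ℝ] State H :=
  (WithLp.prodContinuousLinearEquiv 2 ℝ H H).symm.toContinuousLinearMap.comp (f.prod g)

/-- The state with given components. -/
def mk (p q : H) : State H := WithLp.toLp 2 (p, q)

@[simp] theorem fstL_mk (p q : H) : fstL H (mk p q) = p := rfl
@[simp] theorem sndL_mk (p q : H) : sndL H (mk p q) = q := rfl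
@[simp] theorem fstL_pair (f g : X →L[ℝ] H) (x : X) : fstL H (pair f g x) = f x := rfl
@[simp] theorem sndL_pair (f g : X →L[ℝ] H) (x : X) : sndL H (pair f g x) = g x := rfl

theorem ext {x y : State H} (h1 : fstL H x = fstL H y) (h2 : sndL H x = sndL H y) : x = y :=
  (WithLp.prodContinuousLinearEquiv 2 ℝ H H).injective (Prod.ext h1 h2)

theorem inner_def (x y : State H) : ⟪x, y⟫ = ⟪fstL H x, fstL H y⟫ + ⟪sndL H x, sndL H y⟫ :=
  WithLp.prod_inner_apply x y

theorem norm_sq (x : State H) : ‖x‖ ^ 2 = ‖fstL H x‖ ^ 2 + ‖sndL H x‖ ^ 2 := by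
  simp only [← real_inner_self_eq_norm_sq, inner_def]

theorem hasDerivWithinAt_mk {p q : ℝ → H} {p' q' : H} {s : Set ℝ} {t : ℝ}
    (hp : HasDerivWithinAt p p' s t) (hq : HasDerivWithinAt q q' s t) :
    HasDerivWithinAt (fun r => mk (p r) (q r)) (mk p' q') s t :=
  (pair (ContinuousLinearMap.fst ℝ H H) (ContinuousLinearMap.snd ℝ H H)).hasFDerivAt.comp_hasDerivWithinAt
    t (hp.prodMk hq)

theorem continuousOn_mk {p q : ℝ → H} {s : Set ℝ} (hp : ContinuousOn p s) (hq : ContinuousOn q s) :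
    ContinuousOn (fun r => mk (p r) (q r)) s :=
  (pair (ContinuousLinearMap.fst ℝ H H)
    (ContinuousLinearMap.snd ℝ H H)).continuous.comp_continuousOn (hp.prodMk hq)

/-- The rotation `(p, q) ↦ (q, -p)`. -/
def rot : State H →L[ℝ] State H := pair (sndL H) (-fstL H)

/-- The operator `(p, q) ↦ (-Q q, Q p)`. -/
def waveInv (Q : H →L[ℝ] H) : State H →L[ℝ] State H := pair (-Q.comp (sndL H)) (Q.comp (fstL H))

@[simp] theorem fstL_rot (x : State H) : fstL H (rot x) = sndL H x := rfl
@[simp] theorem sndL_rot (x : State H) : sndL H (rot x) = -fstL H x := rfl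
@[simp] theorem fstL_waveInv (Q : H →L[ℝ] H) (x : State H) :
    fstL H (waveInv Q x) = -Q (sndL H x) := rfl
@[simp] theorem sndL_waveInv (Q : H →L[ℝ] H) (x : State H) :
    sndL H (waveInv Q x) = Q (fstL H x) := rfl

theorem norm_rot (x : State H) : ‖rot x‖ = ‖x‖ := by
  refine (sq_eq_sq₀ (norm_nonneg _) (norm_nonneg _)).1 ?_
  rw [norm_sq, norm_sq, fstL_rot, sndL_rot, norm_neg, add_comm]

theorem rot_waveInv (Q : H →L[ℝ] H) (x : State H) : rot (waveInv Q x) = waveInv Q (rot x) := by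
  refine ext ?_ ?_ <;> simp

theorem waveInv_skew {Q : H →L[ℝ] H} (hQ : ∀ x y, ⟪Q x, y⟫ = ⟪x, Q y⟫) (x y : State H) :
    ⟪waveInv Q x, y⟫ = -⟪x, waveInv Q y⟫ := by
  simp only [inner_def, fstL_waveInv, sndL_waveInv, inner_neg_left, inner_neg_right, hQ]
  ring

theorem waveInv_injective {Q : H →L[ℝ] H} (hQ : Function.Injective Q) :
    Function.Injective (waveInv Q) := fun x y h => by
  have h1 := congrArg (fstL H) h
  have h2 := congrArg (sndL H) h
  simp only [fstL_waveInv, sndL_waveInv] at h1 h2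
  exact ext (hQ h2) (hQ (neg_injective h1))

/-- The coupling `(p, q) ↦ (-C q, 0)`. -/
def coupling (C : H →L[ℝ] H) : State H →L[ℝ] State H := pair (-C.comp (sndL H)) 0

/-- The coupling `(p, q) ↦ (0, -C p)`. -/
def dualCoupling (C : H →L[ℝ] H) : State H →L[ℝ] State H := pair 0 (-C.comp (fstL H))

@[simp] theorem fstL_coupling (C : H →L[ℝ] H) (x : State H) :
    fstL H (coupling C x) = -C (sndL H x) := rfl
@[simp] theorem sndL_coupling (C : H →L[ℝ] H) (x : State H) : sndL H (coupling C x) = 0 := rfl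
@[simp] theorem fstL_dualCoupling (C : H →L[ℝ] H) (x : State H) :
    fstL H (dualCoupling C x) = 0 := rfl
@[simp] theorem sndL_dualCoupling (C : H →L[ℝ] H) (x : State H) :
    sndL H (dualCoupling C x) = -C (fstL H x) := rfl

/-- The coupling of the controlled system is the adjoint of the coupling of the observed one, as the
cancellation in the duality argument requires. -/
theorem inner_dualCoupling {C C' : H →L[ℝ] H} (h : ∀ x y, ⟪C' x, y⟫ = ⟪x, C y⟫) (x y : State H) :
    ⟪dualCoupling C' x, y⟫ = ⟪x, coupling C y⟫ := by
  simp only [inner_def, fstL_dualCoupling, sndL_dualCoupling, fstL_coupling, sndL_coupling,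
    inner_neg_left, inner_neg_right, inner_zero_left, inner_zero_right, h, zero_add, add_zero]

theorem neg_inner_coupling_rot (C : H →L[ℝ] H) (x : State H) :
    -⟪coupling C x, rot x⟫ = ⟪C (sndL H x), sndL H x⟫ := by
  simp only [inner_def, fstL_coupling, sndL_coupling, fstL_rot, inner_neg_left, inner_zero_left,
    add_zero, neg_neg]

theorem norm_coupling (C : H →L[ℝ] H) (x : State H) : ‖coupling C x‖ = ‖C (sndL H x)‖ := by
  refine (sq_eq_sq₀ (norm_nonneg _) (norm_nonneg _)).1 ?_
  rw [norm_sq]; simp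

end State

end State

/-! ### The wave group of `A`, and the hypotheses in state form. -/

variable {𝕜 H G : Type*} [RCLike 𝕜]
  [NormedAddCommGroup H] [InnerProductSpace 𝕜 H] [CompleteSpace H]
  [NormedAddCommGroup G] [InnerProductSpace 𝕜 G] [CompleteSpace G]

/-- A normed group carries at most one real normed structure: the identity is additive and
continuous, hence real-linear. Derivatives taken with restricted scalars can thus be used with the
real inner product. -/
theorem hasDerivWithinAt_congr_normedSpace {H : Type*} [NormedAddCommGroup H]
    (i j : NormedSpace ℝ H) {w : ℝ → H} {w' : H} {s : Set ℝ} {t : ℝ} :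
    (letI := i; HasDerivWithinAt w w' s t) ↔ (letI := j; HasDerivWithinAt w w' s t) := by
  have : i = j := by
    refine NormedSpace.ext ?_
    ext r x
    exact @map_real_smul H _ i.toModule _ _ H _ j.toModule _ _ _ (H →+ H) _ _
      (AddMonoidHom.id H) continuous_id r x
  rw [this]

/-- By polarisation both sides depend only on the norm, so no compatibility between the two inner
product structures has to be assumed. -/
theorem real_inner_eq_re (𝕜 : Type*) {H : Type*} [RCLike 𝕜] [NormedAddCommGroup H]
    [InnerProductSpace 𝕜 H] [InnerProductSpace ℝ H] (x y : H) : ⟪x, y⟫ = re (inner 𝕜 x y) := by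
  rw [re_inner_eq_norm_add_mul_self_sub_norm_sub_mul_self_div_four (𝕜 := 𝕜),
    ← re_inner_eq_norm_add_mul_self_sub_norm_sub_mul_self_div_four (𝕜 := ℝ)]
  rfl

theorem real_inner_eq_of_inner_eq {H G : Type*} [NormedAddCommGroup H]
    [InnerProductSpace 𝕜 H] [InnerProductSpace ℝ H] [NormedAddCommGroup G]
    [InnerProductSpace 𝕜 G] [InnerProductSpace ℝ G] {a b : H} {c d : G}
    (h : inner 𝕜 a b = inner 𝕜 c d) : ⟪a, b⟫ = ⟪c, d⟫ := by
  rw [real_inner_eq_re 𝕜, real_inner_eq_re 𝕜, h]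

namespace CoerciveOperator

variable (A : CoerciveOperator 𝕜 H)

theorem half_symm (x y : A.half.domain) :
    inner 𝕜 (A.half x) (y : H) = inner 𝕜 (x : H) (A.half y) := by
  have h := LinearPMap.adjoint_isFormalAdjoint A.half_spec.selfAdjoint.dense_domain
  rw [LinearPMap.isSelfAdjoint_def.1 A.half_spec.selfAdjoint] at h
  exact h x y

theorem half_surjective : Function.Surjective A.half.toFun := fun z => by
  obtain ⟨u, hu⟩ := A.surjective z
  obtain ⟨y, -, hy⟩ := (A.half_spec.sq _ _).1 (A.op.mem_graph u)
  obtain ⟨w, -, hw⟩ := (LinearPMap.mem_graph_iff _).1 hy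
  exact ⟨w, hw.trans hu⟩

/-- `A^{1/2}` as an isometry of `H₁` onto `H`. -/
def equivH1 : A.H1 ≃ₗᵢ[𝕜] H where
  toLinearEquiv := LinearEquiv.ofBijective A.halfMap ⟨A.half_injective, A.half_surjective⟩
  norm_map' _ := rfl

/-- `A` as an isometry of `H₂` onto `H`. -/
def equivH2 : A.H2 ≃ₗᵢ[𝕜] H where
  toLinearEquiv := LinearEquiv.ofBijective A.opMap ⟨A.injective, A.surjective⟩
  norm_map' _ := rfl

theorem equivH2_apply (u : A.H2) : A.equivH2 u = A.opMap u := rfl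

/-- Symmetry and everywhere-definedness give boundedness of `A^{-1/2}` by Hellinger–Toeplitz. -/
theorem isSymmetric_halfInv :
    (A.ofH1 ∘ₗ A.equivH1.symm.toLinearEquiv.toLinearMap).IsSymmetric := fun z w => by
  have h := A.half_symm (A.equivH1.symm w) (A.equivH1.symm z)
  have e : ∀ z, A.half (A.equivH1.symm z) = z := fun z => A.equivH1.apply_symm_apply z
  rw [e, e] at h
  change inner 𝕜 (A.ofH1 (A.equivH1.symm z)) w = inner 𝕜 z (A.ofH1 (A.equivH1.symm w))
  rw [← inner_conj_symm, ← inner_conj_symm z]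
  exact congrArg _ h

/-- The bounded operator `A^{-1/2}`. -/
def halfInv : H →L[𝕜] H :=
  ⟨A.ofH1 ∘ₗ A.equivH1.symm.toLinearEquiv.toLinearMap, A.isSymmetric_halfInv.continuous⟩

theorem halfInv_symm (x y : H) : inner 𝕜 (A.halfInv x) y = inner 𝕜 x (A.halfInv y) :=
  A.isSymmetric_halfInv x y

theorem ofH1_eq (u : A.H1) : A.ofH1 u = A.halfInv (A.halfMap u) :=
  congrArg A.ofH1 (A.equivH1.symm_apply_apply u).symm

theorem ofH1_symm (z : H) : A.ofH1 (A.equivH1.symm z) = A.halfInv z := rfl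

theorem ofH1_injective : Function.Injective A.ofH1 := fun _ _ h => Subtype.ext h

theorem ofH2_injective : Function.Injective A.ofH2 := fun _ _ h => Subtype.ext h

theorem halfInv_injective : Function.Injective A.halfInv := fun _ _ h =>
  A.equivH1.symm.injective (A.ofH1_injective h)

theorem halfMap_inclH2H1 (u : A.H2) : A.halfMap (A.inclH2H1 u) = A.halfInv (A.opMap u) := by
  obtain ⟨y, hy1, hy2⟩ := (A.half_spec.sq _ _).1 (A.op.mem_graph u)
  obtain ⟨w, hw1, hw2⟩ := (LinearPMap.mem_graph_iff _).1 hy2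
  obtain ⟨x, hx1, hx2⟩ := (LinearPMap.mem_graph_iff _).1 hy1
  have e1 : A.halfMap (A.inclH2H1 u) = y :=
    (congrArg A.halfMap (Subtype.ext hx1.symm : A.inclH2H1 u = x)).trans hx2
  have e2 : A.halfMap w = A.opMap u := hw2
  have e3 : A.ofH1 w = y := hw1
  exact e1.trans (e3.symm.trans ((A.ofH1_eq w).trans (congrArg A.halfInv e2)))

theorem ofH2_eq (u : A.H2) : A.ofH2 u = A.halfInv (A.halfInv (A.opMap u)) := by
  rw [← A.halfMap_inclH2H1, ← A.ofH1_eq]; rfl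

theorem opMap_symm (z : H) : A.opMap (A.equivH2.symm z) = z := A.equivH2.apply_symm_apply z

variable [InnerProductSpace ℝ H]

theorem hasDerivOnIcc_iff {T : ℝ} {w w' : ℝ → H} : HasDerivOnIcc 𝕜 T w w' ↔
    ∀ t ∈ Icc 0 T, HasDerivWithinAt w (w' t) (Icc 0 T) t := by
  exact forall₂_congr fun t _ => hasDerivWithinAt_congr_normedSpace
    (NormedSpace.restrictScalars ℝ 𝕜 H) InnerProductSpace.toNormedSpace

/-- `A^{-1/2}` as an operator of the underlying real Hilbert space. -/
def realHalfInv : H →L[ℝ] H := A.halfInv.restrictScalars ℝ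

theorem realHalfInv_apply (x : H) : A.realHalfInv x = A.halfInv x := rfl

theorem realHalfInv_symm (x y : H) : ⟪A.realHalfInv x, y⟫ = ⟪x, A.realHalfInv y⟫ :=
  real_inner_eq_of_inner_eq (A.halfInv_symm x y)

/-- The wave group of `A`. -/
def waveGroup : IsometricGroup (State.waveInv A.realHalfInv) :=
  (exists_isometricGroup _ (State.waveInv_skew A.realHalfInv_symm)
    (State.waveInv_injective A.halfInv_injective)).some

/-- Here `Ψ = (-A w, -A^{1/2} w')` and `J Ψ = (w', -A^{1/2} w)`. Continuity of `Ψ` is continuity of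
`w` in `D(A)`, and the two components of the evolution equation give `w'` and `w''`. -/
theorem isStrictSolution_of_state {T : ℝ} {Ψ : ℝ → State H} {f : ℝ → H}
    (hΨ : ContinuousOn Ψ (Icc 0 T)) (hf : ContinuousOn f (Icc 0 T))
    (hd : ∀ t ∈ Icc 0 T, HasDerivWithinAt (fun t => State.waveInv A.realHalfInv (Ψ t))
      (Ψ t + State.mk (f t) 0) (Icc 0 T) t) :
    A.IsStrictSolution T f (fun t => A.equivH2.symm (-State.fstL H (Ψ t)))
      (fun t => State.fstL H (State.waveInv A.realHalfInv (Ψ t))) where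
  continuousOn := A.equivH2.symm.continuous.comp_continuousOn
    ((State.fstL H).continuous.comp_continuousOn hΨ).neg
  continuousOn_source := hf
  hasDeriv := hasDerivOnIcc_iff.2 fun t ht => by
    have h := ((-(A.realHalfInv.comp (State.sndL H))).hasFDerivAt).comp_hasDerivWithinAt t (hd t ht)
    refine (h.congr_deriv ?_).congr (fun r _ => ?_) ?_
    · simp [map_add]
    · simp [ofH2_eq, opMap_symm, realHalfInv_apply]
    · simp [ofH2_eq, opMap_symm, realHalfInv_apply]
  hasDeriv' := hasDerivOnIcc_iff.2 fun t ht => by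
    have h := ((State.fstL H).hasFDerivAt).comp_hasDerivWithinAt t (hd t ht)
    refine h.congr_deriv ?_
    simp [opMap_symm, add_comm]

theorem energy_state (ψ : State H) :
    A.energy (A.inclH2H1 (A.equivH2.symm (-State.fstL H ψ)))
      (State.fstL H (State.waveInv A.realHalfInv ψ)) = ‖State.waveInv A.realHalfInv ψ‖ ^ 2 / 2 := by
  rw [energy, State.norm_sq, halfMap_inclH2H1, opMap_symm, map_neg, norm_neg, State.sndL_waveInv,
    realHalfInv_apply, add_comm]

theorem isStrictSolution_free (x : State H) (T : ℝ) :
    A.IsStrictSolution T (fun _ => 0)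
      (fun t => A.equivH2.symm (-State.fstL H (A.waveGroup.toFun t x)))
      (fun t => State.fstL H (State.waveInv A.realHalfInv (A.waveGroup.toFun t x))) := by
  refine A.isStrictSolution_of_state (A.waveGroup.continuous x).continuousOn continuousOn_const
    fun t _ => ?_
  have h := A.waveGroup.hasDerivAt x t
  simp only [A.waveGroup.comm_self] at h
  refine h.hasDerivWithinAt.congr_deriv ?_
  have : State.mk (0 : H) 0 = 0 := rfl
  rw [this, add_zero]

theorem isStrictSolution_cascade (C : H →L[ℝ] H) (x₁ x₂ : State H) (T : ℝ) :
    A.IsStrictSolution T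
      (fun t => C (State.sndL H (A.waveGroup.toFun t (State.waveInv A.realHalfInv x₁))))
      (fun t => A.equivH2.symm
        (-State.fstL H (A.waveGroup.cascade (State.coupling C) x₁ x₂ t)))
      (fun t => State.fstL H (State.waveInv A.realHalfInv
        (A.waveGroup.cascade (State.coupling C) x₁ x₂ t))) := by
  refine A.isStrictSolution_of_state (A.waveGroup.continuous_cascade _ x₁ x₂).continuousOn
    (C.continuous.comp ((State.sndL H).continuous.comp (A.waveGroup.continuous _))).continuousOn
    fun t _ => ?_
  refine (A.waveGroup.hasDerivAt_map_cascade _ x₁ x₂ t).hasDerivWithinAt.congr_deriv ?_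
  refine State.ext ?_ ?_ <;> simp

variable [InnerProductSpace ℝ G] {obs : A.H2 → H → G} {O : State H →L[ℝ] G}

/-- Since `U` is isometric and the first wave is free, Duhamel's formula bounds the energy of the
second wave at all times by `‖J x₂‖²` and the integral of `‖C Φ₁‖²`. The energies in the
admissibility inequality, also the final one, are thereby removed. -/
theorem cascade_admissible (hobs : ∀ ψ : State H, ‖obs (A.equivH2.symm (-State.fstL H ψ))
      (State.fstL H (State.waveInv A.realHalfInv ψ))‖ = ‖O ψ‖) (hadm : A.Admissible obs)
    (C : H →L[ℝ] H) {T : ℝ} (hT : 0 < T) : ∃ K : ℝ, 0 ≤ K ∧ ∀ x₁ x₂ : State H,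
      ∫ t in (0 : ℝ)..T, ‖O (A.waveGroup.cascade (State.coupling C) x₁ x₂ t)‖ ^ 2 ≤
      K * (‖State.waveInv A.realHalfInv x₂‖ ^ 2 + ∫ t in (0 : ℝ)..T,
        ‖State.coupling C (A.waveGroup.toFun t (State.waveInv A.realHalfInv x₁))‖ ^ 2) := by
  obtain ⟨K, hK, h⟩ := hadm T hT
  -- With each energy at most `‖J x₂‖² + T I`, the two end points, the time integral and the source
  -- add up to `(2 + T) ‖J x₂‖² + (1 + T)² I`; the constant dominates both coefficients.
  refine ⟨K * (2 + 3 * T + T ^ 2), by positivity, fun x₁ x₂ => ?_⟩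
  have h1 := h _ _ _ (A.isStrictSolution_cascade C x₁ x₂ T)
  simp only [hobs, energy_state, ← State.norm_coupling] at h1
  set Φ : ℝ → ℝ := fun t => ‖State.coupling C (A.waveGroup.toFun t ((State.waveInv A.realHalfInv) x₁))‖ ^ 2 with hΦ
  have hΦc : Continuous Φ := (A.waveGroup.continuous_comp_map _ _).norm.pow 2
  set I := ∫ t in (0 : ℝ)..T, Φ t with hI
  have hI0 : 0 ≤ I := intervalIntegral.integral_nonneg hT.le fun _ _ => sq_nonneg _
  have hb : ∀ t ∈ Icc 0 T, ‖(State.waveInv A.realHalfInv) (A.waveGroup.cascade (State.coupling C) x₁ x₂ t)‖ ^ 2 / 2 ≤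
      ‖(State.waveInv A.realHalfInv) x₂‖ ^ 2 + T * I := fun t ht => by
    rw [A.waveGroup.map_cascade _ _ _ ht.1, A.waveGroup.norm_map]
    have h2 := A.waveGroup.sq_norm_source_le ht.1
      (A.waveGroup.continuous_comp_map (State.coupling C) ((State.waveInv A.realHalfInv) x₁)).continuousOn
    have h3 : t * ∫ s in (0 : ℝ)..t, Φ s ≤ T * I :=
      mul_le_mul ht.2 (intervalIntegral.integral_mono_interval le_rfl ht.1 ht.2
        (Eventually.of_forall fun _ => sq_nonneg _) (hΦc.intervalIntegrable _ _))
        (intervalIntegral.integral_nonneg ht.1 fun _ _ => sq_nonneg _) hT.le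
    have h4 := norm_sub_le ((State.waveInv A.realHalfInv) x₂) (A.waveGroup.source (fun s => State.coupling C (A.waveGroup.toFun s ((State.waveInv A.realHalfInv) x₁))) t)
    nlinarith [norm_nonneg ((State.waveInv A.realHalfInv) x₂ - A.waveGroup.source (fun s => State.coupling C (A.waveGroup.toFun s ((State.waveInv A.realHalfInv) x₁))) t),
      sq_nonneg (‖(State.waveInv A.realHalfInv) x₂‖ - ‖A.waveGroup.source (fun s => State.coupling C (A.waveGroup.toFun s ((State.waveInv A.realHalfInv) x₁))) t‖)]
  have hint : ∫ t in (0 : ℝ)..T, ‖(State.waveInv A.realHalfInv) (A.waveGroup.cascade (State.coupling C) x₁ x₂ t)‖ ^ 2 / 2 ≤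
      T * (‖(State.waveInv A.realHalfInv) x₂‖ ^ 2 + T * I) := by
    have := intervalIntegral.integral_mono_on hT.le
      (((((State.waveInv A.realHalfInv).continuous.comp (A.waveGroup.continuous_cascade (State.coupling C) x₁ x₂)).norm.pow
        2).div_const 2).intervalIntegrable (μ := volume) 0 T)
      (intervalIntegrable_const (c := ‖(State.waveInv A.realHalfInv) x₂‖ ^ 2 + T * I)) hb
    simpa [mul_add] using this
  refine h1.trans ?_
  rw [mul_assoc]
  refine mul_le_mul_of_nonneg_left ?_ hK.le
  have h0 := hb 0 (left_mem_Icc.2 hT.le)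
  have hT' := hb T (right_mem_Icc.2 hT.le)
  have p1 : 0 ≤ T * ‖(State.waveInv A.realHalfInv) x₂‖ ^ 2 := by positivity
  have p2 : 0 ≤ T ^ 2 * ‖(State.waveInv A.realHalfInv) x₂‖ ^ 2 := by positivity
  have p3 : 0 ≤ T * I := by positivity
  nlinarith

theorem state_observable (hobs : ∀ ψ : State H, ‖obs (A.equivH2.symm (-State.fstL H ψ))
      (State.fstL H (State.waveInv A.realHalfInv ψ))‖ = ‖O ψ‖) {T₁ T : ℝ}
    (h : A.Observable obs T₁) (hT : T₁ < T) : ∃ c : ℝ, 0 < c ∧ ∀ x : State H,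
      c * ‖State.waveInv A.realHalfInv x‖ ^ 2 ≤
        ∫ t in (0 : ℝ)..T, ‖O (A.waveGroup.toFun t x)‖ ^ 2 := by
  obtain ⟨c, hc, h⟩ := h T hT
  refine ⟨c / 2, half_pos hc, fun x => ?_⟩
  have := h _ _ (A.isStrictSolution_free x T)
  simp only [hobs, energy_state, A.waveGroup.toFun_zero] at this
  linarith

/-- The second component of `U t (J x)` is the velocity of the free wave started from `rot x`, which
has the same energy. Observability of velocities through `P` therefore applies to the component seen
by the coupling. -/
theorem state_coercive {C P : H →L[𝕜] H} (hC : A.PartiallyCoercive C P) {T₂ T : ℝ} (hT : 0 ≤ T)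
    (h : A.Observable (fun _ w' => P w') T₂) (hT₂ : T₂ < T) : ∃ c : ℝ, 0 < c ∧ ∀ x : State H,
      c * ‖State.waveInv A.realHalfInv x‖ ^ 2 ≤ ∫ t in (0 : ℝ)..T,
        -⟪State.coupling (C.restrictScalars ℝ)
            (A.waveGroup.toFun t (State.waveInv A.realHalfInv x)),
          State.rot (A.waveGroup.toFun t (State.waveInv A.realHalfInv x))⟫ := by
  obtain ⟨c, hc, h⟩ := h T hT₂
  obtain ⟨α, hα, hαC⟩ := hC.coercive
  refine ⟨α * (c / 2), by positivity, fun x => ?_⟩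
  have h1 := h _ _ (A.isStrictSolution_free (State.rot x) T)
  simp only [energy_state, A.waveGroup.toFun_zero] at h1
  rw [← State.rot_waveInv, State.norm_rot] at h1
  have e : ∀ t, State.fstL H ((State.waveInv A.realHalfInv) (A.waveGroup.toFun t (State.rot x))) =
      State.sndL H (A.waveGroup.toFun t ((State.waveInv A.realHalfInv) x)) := fun t => by
    rw [A.waveGroup.comm State.rot (State.rot_waveInv _), ← State.rot_waveInv, State.fstL_rot, ← A.waveGroup.comm_self]
  simp only [e] at h1
  have hc' : Continuous fun t => State.sndL H (A.waveGroup.toFun t ((State.waveInv A.realHalfInv) x)) :=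
    (State.sndL H).continuous.comp (A.waveGroup.continuous _)
  have h2 : α * ∫ t in (0 : ℝ)..T, ‖P (State.sndL H (A.waveGroup.toFun t ((State.waveInv A.realHalfInv) x)))‖ ^ 2 ≤
      ∫ t in (0 : ℝ)..T, -⟪State.coupling (C.restrictScalars ℝ) (A.waveGroup.toFun t ((State.waveInv A.realHalfInv) x)),
        State.rot (A.waveGroup.toFun t ((State.waveInv A.realHalfInv) x))⟫ := by
    rw [← intervalIntegral.integral_const_mul]
    refine intervalIntegral.integral_mono_on hT
      ((((P.continuous.comp hc').norm.pow 2).const_mul α).intervalIntegrable _ _) ?_ fun t _ => ?_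
    · exact ((A.waveGroup.continuous_comp_map _ _).inner (A.waveGroup.continuous_comp_map _ _)).neg.intervalIntegrable
        _ _
    · rw [State.neg_inner_coupling_rot, real_inner_eq_re 𝕜]
      exact hαC _
  have h3 := mul_le_mul_of_nonneg_left h1 hα.le
  linarith

/-- Null controllability in state form, for a control operator that is dual to the observation. -/
theorem exists_state_control (hobs : ∀ ψ : State H, ‖obs (A.equivH2.symm (-State.fstL H ψ))
      (State.fstL H (State.waveInv A.realHalfInv ψ))‖ = ‖O ψ‖) {D : G →L[ℝ] State H}
    (hO : ∀ x g, ⟪O x, g⟫ = ⟪x, D g⟫) {C P : H →L[𝕜] H} (hC : A.PartiallyCoercive C P)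
    {T₁ T₂ : ℝ} (hT₁ : 0 < T₁) (hT₂ : 0 < T₂) (hP : A.Observable (fun _ w' => P w') T₂)
    (hadm : A.Admissible obs) (hob : A.Observable obs T₁) :
    ∃ Tstar : ℝ, max T₁ T₂ ≤ Tstar ∧ ∀ T : ℝ, Tstar < T → ∀ Z₁ Z₂ : State H,
      ∃ v : ℝ → G, MemLp v 2 (volume.restrict (Ioc 0 T)) ∧ ∃ Y₁ Y₂ : ℝ → State H,
      ContinuousOn Y₁ (Icc 0 T) ∧ ContinuousOn Y₂ (Icc 0 T) ∧ Y₁ 0 = Z₁ ∧ Y₂ 0 = Z₂ ∧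
      (∀ t, Y₁ t = A.waveGroup.toFun t (Z₁ + A.waveGroup.source (fun s => State.dualCoupling
        ((ContinuousLinearMap.adjoint C).restrictScalars ℝ) (Y₂ s)) t)) ∧
      (∀ t ∈ Icc 0 T, State.waveInv A.realHalfInv (Y₂ t) =
        A.waveGroup.toFun t (State.waveInv A.realHalfInv Z₂ +
          A.waveGroup.source (fun s => D (v s)) t)) ∧
      Y₁ T = 0 ∧ Y₂ T = 0 := by
  have hinj := State.waveInv_injective (Q := A.realHalfInv) A.halfInv_injective
  have hskew := State.waveInv_skew A.realHalfInv_symm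
  -- Any window lengths above `T₁` and `T₂` would do; they are fixed once and for all, so that the
  -- constants do not depend on `T`.
  have hT₀ : 0 < T₁ + 1 := by positivity
  have hτ : 0 < T₂ + 1 := by positivity
  obtain ⟨K, hK, hadm₀⟩ := A.cascade_admissible hobs hadm (C.restrictScalars ℝ) hT₀
  obtain ⟨c₁, hc₁, hob₁⟩ := A.state_observable hobs hob (lt_add_one T₁)
  obtain ⟨c₂, hc₂, hco⟩ := A.state_coercive hC hτ.le hP (lt_add_one T₂)
  have hCle : ∀ x : State H, ‖State.coupling (C.restrictScalars ℝ) x‖ ^ 2 ≤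
      ‖C‖ * -⟪State.coupling (C.restrictScalars ℝ) x, State.rot x⟫ := fun x => by
    rw [State.neg_inner_coupling_rot, real_inner_eq_re 𝕜, State.norm_coupling]
    exact hC.sq_le _
  have hC0 : ∀ x : State H, 0 ≤ -⟪State.coupling (C.restrictScalars ℝ) x, State.rot x⟫ := fun x => by
    obtain ⟨α, hα, hαC⟩ := hC.coercive
    rw [State.neg_inner_coupling_rot, real_inner_eq_re 𝕜]
    exact (mul_nonneg hα.le (sq_nonneg _)).trans (hαC _)
  obtain ⟨S, hS⟩ := A.waveGroup.exists_cascade_observable _ O hinj (State.rot_waveInv _)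
    State.norm_rot hT₀ hτ hK (norm_nonneg C) hc₁ hc₂ hCle hC0 hadm₀ hob₁ hco
  refine ⟨max S (max T₁ T₂), le_max_right _ _, fun T hT Z₁ Z₂ => ?_⟩
  have hT0 : 0 < T := hT₁.trans_le ((le_max_left _ _).trans ((le_max_right _ _).trans hT.le))
  obtain ⟨c, hc, hobsT⟩ := hS T ((le_max_left _ _).trans hT.le)
  -- Admissibility on the whole of `[0, T]`, with a constant depending on `T`, is needed only for
  -- solving the controlled equation.
  obtain ⟨K', hK', hadmT⟩ := A.cascade_admissible hobs hadm (C.restrictScalars ℝ) hT0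
  refine A.waveGroup.exists_null_control hskew hinj hO
    (State.inner_dualCoupling (C := C.restrictScalars ℝ) fun x y => ?_) hT0.le hK' hc
    (fun x => ?_) hobsT Z₁ Z₂
  · exact real_inner_eq_of_inner_eq (ContinuousLinearMap.adjoint_inner_left C y x)
  · have := hadmT 0 x
    simpa [IsometricGroup.cascade_zero_left] using this

end CoerciveOperator

end Cascade

end

/-! ### The transposition identity, and uniqueness. -/

noncomputable section

set_option linter.unusedSectionVars false

namespace Cascade

open Filter Topology Set
open scoped RealInnerProductSpace

namespace CoerciveOperator

variable {𝕜 H : Type*} [RCLike 𝕜]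
  [NormedAddCommGroup H] [InnerProductSpace 𝕜 H] [CompleteSpace H] [InnerProductSpace ℝ H]
  (A : CoerciveOperator 𝕜 H)

/-- With `e = A θ`, this is the transposition identity tested with `A⁻¹ θ`. The extra smoothing
makes `Θ = (A⁻¹ e, A^{-1/2} θ')` a `C¹` curve in `E` with `J Θ' - Θ = (-A⁻¹ f, 0)`, to which the
duality of weak and strong solutions applies. -/
theorem inner_smooth_test {t : ℝ} (ht : 0 ≤ t) {Y : ℝ → State H} {b : ℝ → H}
    (hY : ContinuousOn Y (Icc 0 t)) (hb : IntervalIntegrable b volume 0 t)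
    (hJY : ∀ s ∈ Icc 0 t, State.waveInv A.realHalfInv (Y s) = A.waveGroup.toFun s
      (State.waveInv A.realHalfInv (Y 0) + A.waveGroup.source (fun s => State.mk (-b s) 0) s))
    {e f θ' : ℝ → H} (he : ContinuousOn e (Icc 0 t)) (hf : ContinuousOn f (Icc 0 t))
    (h1 : ∀ s ∈ Icc 0 t,
      HasDerivWithinAt (fun s => A.realHalfInv (A.realHalfInv (e s))) (θ' s) (Icc 0 t) s)
    (h2 : ∀ s ∈ Icc 0 t, HasDerivWithinAt θ' (f s - e s) (Icc 0 t) s) :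
    ⟪State.sndL H (Y t), A.realHalfInv (A.realHalfInv (A.realHalfInv (e t)))⟫ -
        ⟪State.fstL H (Y t), A.realHalfInv (A.realHalfInv (θ' t))⟫ =
      ⟪State.sndL H (Y 0), A.realHalfInv (A.realHalfInv (A.realHalfInv (e 0)))⟫ -
        ⟪State.fstL H (Y 0), A.realHalfInv (A.realHalfInv (θ' 0))⟫ +
      ∫ s in (0 : ℝ)..t, (⟪b s, A.realHalfInv (A.realHalfInv (e s))⟫ -
        ⟪State.fstL H (Y s), A.realHalfInv (A.realHalfInv (f s))⟫) := by
  set Q := A.realHalfInv with hQ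
  have hθ' : ContinuousOn θ' (Icc 0 t) := fun s hs => (h2 s hs).continuousWithinAt
  set Θ : ℝ → State H := fun s => State.mk (Q (Q (e s))) (Q (θ' s)) with hΘ
  set Θ' : ℝ → State H := fun s => State.mk (θ' s) (Q (f s - e s))
  have hΘd : ∀ s ∈ Icc 0 t, HasDerivWithinAt Θ (Θ' s) (Icc 0 t) s := fun s hs =>
    State.hasDerivWithinAt_mk (h1 s hs) (Q.hasFDerivAt.comp_hasDerivWithinAt s (h2 s hs))
  have hΘ'c : ContinuousOn Θ' (Icc 0 t) :=
    State.continuousOn_mk hθ' (Q.continuous.comp_continuousOn (hf.sub he))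
  have hΘc : ContinuousOn Θ (Icc 0 t) := fun s hs => (hΘd s hs).continuousWithinAt
  have hF : ∀ s, State.waveInv Q (Θ' s) - Θ s = State.mk (-Q (Q (f s))) 0 := fun s => by
    refine State.ext ?_ ?_ <;> simp [Θ, Θ']
  have hFc : ContinuousOn (fun s => State.mk (-Q (Q (f s))) 0) (Icc 0 t) :=
    State.continuousOn_mk (Q.continuous.comp_continuousOn (Q.continuous.comp_continuousOn hf)).neg
      continuousOn_const
  have hbi : IntervalIntegrable (fun s => State.mk (-b s) (0 : H)) volume 0 t :=
    intervalIntegrable_clm_comp (State.pair (-ContinuousLinearMap.id ℝ H) 0) hb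
  have key := A.waveGroup.inner_sub_inner_eq_integral (State.waveInv_skew A.realHalfInv_symm) ht
    hY hbi hJY hΘc (hFc.intervalIntegrable_of_Icc ht) (fun s hs => by
      have := A.waveGroup.map_eq_of_hasDerivWithinAt hs.1
        (fun r hr => (hΘd r ⟨hr.1, hr.2.trans hs.2⟩).mono (Icc_subset_Icc le_rfl hs.2))
        (hΘ'c.mono (Icc_subset_Icc le_rfl hs.2))
      simpa only [← hQ, hF] using this)
  simp only [State.inner_def, State.fstL_mk, State.sndL_mk, State.fstL_waveInv,
    State.sndL_waveInv, inner_neg_right, inner_neg_left, inner_zero_left, inner_zero_right,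
    add_zero, hΘ, ← hQ] at key
  rw [sub_eq_iff_eq_add] at key
  have e1 : ∫ s in (0 : ℝ)..t, (⟪b s, Q (Q (e s))⟫ - ⟪State.fstL H (Y s), Q (Q (f s))⟫) =
      ∫ s in (0 : ℝ)..t, (-⟪State.fstL H (Y s), Q (Q (f s))⟫ - -⟪b s, Q (Q (e s))⟫) :=
    intervalIntegral.integral_congr fun s _ => by ring
  rw [e1]
  linarith

/-- The smooth identity is applied to `(ε + R)⁻¹ e`, `(ε + R)⁻¹ f` and `(ε + R)⁻¹ θ'` with `R =
A⁻¹`. The operators `R (ε + R)⁻¹` commute with `A^{-1/2}`, are bounded by `2` and tend strongly to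
the identity, so dominated convergence removes the regularisation. -/
theorem real_inner_test {t : ℝ} (ht : 0 ≤ t) {Y : ℝ → State H} {b : ℝ → H}
    (hY : ContinuousOn Y (Icc 0 t)) (hb : IntervalIntegrable b volume 0 t)
    (hJY : ∀ s ∈ Icc 0 t, State.waveInv A.realHalfInv (Y s) = A.waveGroup.toFun s
      (State.waveInv A.realHalfInv (Y 0) + A.waveGroup.source (fun s => State.mk (-b s) 0) s))
    {e f θ' : ℝ → H} (he : ContinuousOn e (Icc 0 t)) (hf : ContinuousOn f (Icc 0 t))
    (h1 : ∀ s ∈ Icc 0 t,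
      HasDerivWithinAt (fun s => A.realHalfInv (A.realHalfInv (e s))) (θ' s) (Icc 0 t) s)
    (h2 : ∀ s ∈ Icc 0 t, HasDerivWithinAt θ' (f s - e s) (Icc 0 t) s) :
    ⟪State.sndL H (Y t), A.realHalfInv (e t)⟫ - ⟪State.fstL H (Y t), θ' t⟫ =
      ⟪State.sndL H (Y 0), A.realHalfInv (e 0)⟫ - ⟪State.fstL H (Y 0), θ' 0⟫ +
      ∫ s in (0 : ℝ)..t, (⟪b s, e s⟫ - ⟪State.fstL H (Y s), f s⟫) := by
  set Q := A.realHalfInv with hQ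
  set R : H →L[ℝ] H := Q * Q with hR
  have hRa : ∀ x, R x = Q (Q x) := fun _ => rfl
  have hRpos : ∀ x, 0 ≤ ⟪R x, x⟫ := fun x => by
    rw [hRa, A.realHalfInv_symm]; exact real_inner_self_nonneg
  have hRsym : ∀ x y, ⟪R x, y⟫ = ⟪x, R y⟫ := fun x y => by
    rw [hRa, hRa, A.realHalfInv_symm, A.realHalfInv_symm]
  have hRinj : Function.Injective R := fun x y h => A.halfInv_injective (A.halfInv_injective h)
  set N : ℝ → H →L[ℝ] H := fun ε => R * resolventAt R ε with hN
  have hNlim : ∀ x, Tendsto (fun ε => N ε x) (𝓝[>] 0) (𝓝 x) := fun x => by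
    have h0 := (tendsto_const_nhds (x := x)).sub (tendsto_smul_resolventAt hRpos hRsym hRinj x)
    rw [sub_zero] at h0
    refine h0.congr' (eventually_nhdsWithin_of_forall fun ε hε => ?_)
    rw [sub_eq_iff_eq_add']
    exact (add_resolventAt hRpos hε x).symm
  have hNn : ∀ ε > 0, ∀ x, ‖N ε x‖ ≤ 2 * ‖x‖ := fun ε hε x => norm_sub_smul_resolventAt_le hRpos hε x
  have hNQ : ∀ ε > 0, ∀ x, Q (N ε x) = N ε (Q x) := fun ε hε x => by
    change Q (R (resolventAt R ε x)) = R (resolventAt R ε (Q x))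
    rw [← resolventAt_comm hRpos hε (T := Q) fun x => rfl]; rfl
  have hp : ContinuousOn (fun s => State.fstL H (Y s)) (Icc 0 t) :=
    (State.fstL H).continuous.comp_continuousOn hY
  have happ : ∀ ε > 0,
      ⟪State.sndL H (Y t), Q (N ε (e t))⟫ - ⟪State.fstL H (Y t), N ε (θ' t)⟫ =
      ⟪State.sndL H (Y 0), Q (N ε (e 0))⟫ - ⟪State.fstL H (Y 0), N ε (θ' 0)⟫ +
      ∫ s in (0 : ℝ)..t, (⟪b s, N ε (e s)⟫ - ⟪State.fstL H (Y s), N ε (f s)⟫) := by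
    intro ε hε
    have hcomm : ∀ x, resolventAt R ε (Q x) = Q (resolventAt R ε x) := fun x =>
      (resolventAt_comm hRpos hε (T := Q) (fun x => rfl) x).symm
    refine A.inner_smooth_test ht hY hb hJY (e := fun s => resolventAt R ε (e s))
      (f := fun s => resolventAt R ε (f s)) (θ' := fun s => resolventAt R ε (θ' s))
      ((resolventAt R ε).continuous.comp_continuousOn he)
      ((resolventAt R ε).continuous.comp_continuousOn hf) (fun s hs => ?_) (fun s hs => ?_)
    · have := (resolventAt R ε).hasFDerivAt.comp_hasDerivWithinAt s (h1 s hs)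
      refine this.congr (fun r _ => ?_) ?_ <;> simp only [Function.comp_apply, hcomm, ← hQ]
    · have := (resolventAt R ε).hasFDerivAt.comp_hasDerivWithinAt s (h2 s hs)
      exact this.congr_deriv (map_sub _ _ _)
  have hQlim : ∀ x, Tendsto (fun ε => Q (N ε x)) (𝓝[>] 0) (𝓝 (Q x)) := fun x =>
    (Q.continuous.tendsto _).comp (hNlim x)
  have huIcc : uIcc 0 t = Icc 0 t := uIcc_of_le ht
  have hint : Tendsto (fun ε => ∫ s in (0 : ℝ)..t,
      (⟪b s, N ε (e s)⟫ - ⟪State.fstL H (Y s), N ε (f s)⟫)) (𝓝[>] 0)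
      (𝓝 (∫ s in (0 : ℝ)..t, (⟪b s, e s⟫ - ⟪State.fstL H (Y s), f s⟫))) := by
    refine intervalIntegral.tendsto_integral_filter_of_dominated_convergence
      (fun s => ‖b s‖ * (2 * ‖e s‖) + ‖State.fstL H (Y s)‖ * (2 * ‖f s‖)) ?_ ?_ ?_ ?_
    · refine Eventually.of_forall fun ε => ?_
      have i1 : IntervalIntegrable (fun s => ⟪b s, N ε (e s)⟫) volume 0 t := by
        have : (fun s => ⟪b s, N ε (e s)⟫) = fun s => ⟪N ε (e s), b s⟫ :=
          funext fun s => real_inner_comm _ _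
        rw [this]
        exact integrable_inner_of_continuousOn (huIcc ▸ (N ε).continuous.comp_continuousOn he) hb
      have i2 : IntervalIntegrable (fun s => ⟪State.fstL H (Y s), N ε (f s)⟫) volume 0 t :=
        (hp.inner ((N ε).continuous.comp_continuousOn hf)).intervalIntegrable_of_Icc ht
      exact (i1.sub i2).def'.aestronglyMeasurable
    · refine eventually_nhdsWithin_of_forall fun ε hε => Eventually.of_forall fun s _ => ?_
      refine (norm_sub_le _ _).trans (add_le_add ?_ ?_)
      · exact (norm_inner_le_norm _ _).trans
          (mul_le_mul_of_nonneg_left (hNn ε hε _) (norm_nonneg _))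
      · exact (norm_inner_le_norm _ _).trans
          (mul_le_mul_of_nonneg_left (hNn ε hε _) (norm_nonneg _))
    · refine (hb.norm.mul_continuousOn (huIcc ▸ continuousOn_const.mul he.norm)).add ?_
      exact (hp.norm.mul (continuousOn_const.mul hf.norm)).intervalIntegrable_of_Icc ht
    · exact Eventually.of_forall fun s _ =>
        (tendsto_const_nhds.inner (hNlim _)).sub (tendsto_const_nhds.inner (hNlim _))
  refine tendsto_nhds_unique
    ((tendsto_const_nhds.inner (hQlim _)).sub (tendsto_const_nhds.inner (hNlim _))) ?_
  refine ((((tendsto_const_nhds.inner (hQlim _)).sub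
    (tendsto_const_nhds.inner (hNlim _))).add hint).congr'
    (eventually_nhdsWithin_of_forall fun ε hε => (happ ε hε).symm))

theorem inner_test {t : ℝ} (ht : 0 ≤ t) {Y : ℝ → State H} {b : ℝ → H}
    (hY : ContinuousOn Y (Icc 0 t)) (hb : IntervalIntegrable b volume 0 t)
    (hJY : ∀ s ∈ Icc 0 t, State.waveInv A.realHalfInv (Y s) = A.waveGroup.toFun s
      (State.waveInv A.realHalfInv (Y 0) + A.waveGroup.source (fun s => State.mk (-b s) 0) s))
    {e f θ' : ℝ → H} (he : ContinuousOn e (Icc 0 t)) (hf : ContinuousOn f (Icc 0 t))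
    (h1 : ∀ s ∈ Icc 0 t,
      HasDerivWithinAt (fun s => A.realHalfInv (A.realHalfInv (e s))) (θ' s) (Icc 0 t) s)
    (h2 : ∀ s ∈ Icc 0 t, HasDerivWithinAt θ' (f s - e s) (Icc 0 t) s) :
    inner 𝕜 (A.halfInv (e t)) (State.sndL H (Y t)) - inner 𝕜 (θ' t) (State.fstL H (Y t)) =
      inner 𝕜 (A.halfInv (e 0)) (State.sndL H (Y 0)) - inner 𝕜 (θ' 0) (State.fstL H (Y 0)) +
      ∫ s in (0 : ℝ)..t, (inner 𝕜 (e s) (b s) - inner 𝕜 (f s) (State.fstL H (Y s))) := by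
  have hp : ContinuousOn (fun s => State.fstL H (Y s)) (Icc 0 t) :=
    (State.fstL H).continuous.comp_continuousOn hY
  have hre : ∀ {e f θ' : ℝ → H}, ContinuousOn e (Icc 0 t) → ContinuousOn f (Icc 0 t) →
      (∀ s ∈ Icc 0 t,
        HasDerivWithinAt (fun s => A.realHalfInv (A.realHalfInv (e s))) (θ' s) (Icc 0 t) s) →
      (∀ s ∈ Icc 0 t, HasDerivWithinAt θ' (f s - e s) (Icc 0 t) s) →
      re (inner 𝕜 (A.halfInv (e t)) (State.sndL H (Y t)) - inner 𝕜 (θ' t) (State.fstL H (Y t))) =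
      re (inner 𝕜 (A.halfInv (e 0)) (State.sndL H (Y 0)) - inner 𝕜 (θ' 0) (State.fstL H (Y 0)) +
      ∫ s in (0 : ℝ)..t, (inner 𝕜 (e s) (b s) - inner 𝕜 (f s) (State.fstL H (Y s)))) := by
    intro e f θ' he hf h1 h2
    have h := A.real_inner_test ht hY hb hJY he hf h1 h2
    have i1 : IntervalIntegrable (fun s => inner 𝕜 (e s) (b s)) volume 0 t :=
      integrable_inner_of_continuousOn (by rwa [uIcc_of_le ht]) hb
    have i2 : IntervalIntegrable (fun s => inner 𝕜 (f s) (State.fstL H (Y s))) volume 0 t :=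
      (hf.inner hp).intervalIntegrable_of_Icc ht
    have e1 : re (∫ s in (0 : ℝ)..t, (inner 𝕜 (e s) (b s) - inner 𝕜 (f s) (State.fstL H (Y s)))) =
        ∫ s in (0 : ℝ)..t, (⟪b s, e s⟫ - ⟪State.fstL H (Y s), f s⟫) := by
      refine ((reCLM (K := 𝕜)).intervalIntegral_comp_comm (i1.sub i2)).symm.trans ?_
      refine intervalIntegral.integral_congr fun s _ => ?_
      rw [real_inner_comm (e s), real_inner_comm (f s), real_inner_eq_re 𝕜, real_inner_eq_re 𝕜]
      exact map_sub re _ _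
    rw [map_add, map_sub, map_sub, e1, ← real_inner_eq_re, ← real_inner_eq_re, ← real_inner_eq_re,
      ← real_inner_eq_re, real_inner_comm, real_inner_comm (State.fstL H (Y t)),
      real_inner_comm (State.sndL H (Y 0)), real_inner_comm (State.fstL H (Y 0))]
    exact h
  have hIm : ∀ z : 𝕜, re ((starRingEnd 𝕜) I * z) = im z := fun z => by
    rw [conj_I, neg_mul, map_neg, I_mul_re, neg_neg]
  refine RCLike.ext (hre he hf h1 h2) ?_
  -- The imaginary part is the real part of the identity for the test function `I • θ`; over `ℝ` it
  -- reads `0 = 0`.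
  have h := hre (e := fun s => (I : 𝕜) • e s) (f := fun s => (I : 𝕜) • f s)
    (θ' := fun s => (I : 𝕜) • θ' s) (he.const_smul _) (hf.const_smul _)
    (fun s hs => ((h1 s hs).const_smul (I : 𝕜)).congr
      (fun r _ => by simp only [realHalfInv_apply, map_smul, Pi.smul_apply])
      (by simp only [realHalfInv_apply, map_smul, Pi.smul_apply]))
    (fun s hs => ((h2 s hs).const_smul (I : 𝕜)).congr_deriv (smul_sub _ _ _))
  simp only [map_smul, inner_smul_left, ← mul_sub, intervalIntegral.integral_const_mul,
    ← mul_add, hIm] at h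
  exact h

/-- The state is `Y = (y, A^{-1/2} y')` with `y ∈ H`: formally `y'` is `A^{1/2}` of the second
component, and the source is `A b`, a functional on `D(A)`. -/
theorem isTranspositionSolution_of_state {T : ℝ} {Y : ℝ → State H} {b : ℝ → H}
    (hY : ContinuousOn Y (Icc 0 T)) (hb : IntervalIntegrable b volume 0 T)
    (hJY : ∀ s ∈ Icc 0 T, State.waveInv A.realHalfInv (Y s) = A.waveGroup.toFun s
      (State.waveInv A.realHalfInv (Y 0) + A.waveGroup.source (fun s => State.mk (-b s) 0) s)) :
    A.IsTranspositionSolution T (fun s w => inner 𝕜 (A.opMap w) (b s)) (State.fstL H (Y 0))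
      (fun w => inner 𝕜 (A.halfInv (A.opMap w)) (State.sndL H (Y 0)))
      (fun s => State.fstL H (Y s))
      (fun s w => inner 𝕜 (A.halfInv (A.opMap w)) (State.sndL H (Y s))) := by
  intro t ht f θ θ' hθ
  have hsub : Icc 0 t ⊆ Icc 0 T := Icc_subset_Icc le_rfl ht.2
  refine A.inner_test ht.1 (hY.mono hsub)
    (hb.mono_set (by rwa [uIcc_of_le ht.1, uIcc_of_le (ht.1.trans ht.2)]))
    (fun s hs => hJY s (hsub hs)) (e := fun s => A.opMap (θ s))
    (A.equivH2.continuous.comp_continuousOn hθ.continuousOn) hθ.continuousOn_source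
    (fun s hs => ?_) (hasDerivOnIcc_iff.1 hθ.hasDeriv')
  have := hasDerivOnIcc_iff.1 hθ.hasDeriv s hs
  refine this.congr (fun r _ => ?_) ?_ <;> exact (A.ofH2_eq _).symm

/-- One level smoother: `Y = (A^{1/2} y, y')` with a source `-x` in `H`. Since `rot (J Y) = (y,
A^{-1/2} y')`, the weaker case applies with `b = -A⁻¹ x`; `J ∘ rot ∘ J` commutes with `J`, hence
with the group. -/
theorem isTranspositionSolution_of_mild {T : ℝ} (hT : 0 ≤ T) {Y : ℝ → State H} {x : ℝ → H}
    (hY : ContinuousOn Y (Icc 0 T)) (hx : ContinuousOn x (Icc 0 T))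
    (hmild : ∀ s ∈ Icc 0 T, Y s = A.waveGroup.toFun s
      (Y 0 + A.waveGroup.source (fun s => State.mk 0 (-x s)) s)) :
    A.IsTranspositionSolution T (fun s => A.pivot (-x s)) (A.halfInv (State.fstL H (Y 0)))
      (A.pivot (State.sndL H (Y 0))) (fun s => A.halfInv (State.fstL H (Y s)))
      (fun s => A.pivot (State.sndL H (Y s))) := by
  set Q := A.realHalfInv with hQ
  set J := State.waveInv Q with hJ
  have hxi : IntervalIntegrable (fun s => State.mk 0 (-x s)) volume 0 T :=
    (State.continuousOn_mk continuousOn_const hx.neg).intervalIntegrable_of_Icc hT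
  set V : State H →L[ℝ] State H := J.comp (State.rot.comp J) with hV
  have hcomm : ∀ y, V (J y) = J (V y) := fun y =>
    congrArg J (State.rot_waveInv Q (J y))
  have h := A.isTranspositionSolution_of_state (T := T) (Y := fun s => State.rot (J (Y s)))
    (b := fun s => -Q (Q (x s)))
    ((State.rot.continuous.comp J.continuous).comp_continuousOn hY)
    (((Q.continuous.comp Q.continuous).comp_continuousOn hx).neg.intervalIntegrable_of_Icc hT)
    (fun s hs => by
      have e1 : (fun r => State.mk (- -Q (Q (x r))) (0 : H)) =
          fun r => V (State.mk 0 (-x r)) := funext fun r => by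
        refine State.ext ?_ ?_ <;> simp [hV, hJ]
      have hsub : IntervalIntegrable (fun s => State.mk 0 (-x s)) volume 0 s :=
        hxi.mono_set (by
          rw [uIcc_of_le hs.1, uIcc_of_le hT]; exact Icc_subset_Icc le_rfl hs.2)
      rw [e1, ← A.waveGroup.map_source hsub hcomm]
      change _ = A.waveGroup.toFun s (V (Y 0) + _)
      rw [← map_add, A.waveGroup.comm _ hcomm, ← hmild s hs]
      rfl)
  have p1 : ∀ s w, inner 𝕜 (A.opMap w) (-Q (Q (x s))) = A.pivot (-x s) w := fun s w => by
    rw [pivot, ofH2_eq, halfInv_symm, halfInv_symm, map_neg, map_neg]; rfl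
  have p2 : ∀ s w, inner 𝕜 (A.halfInv (A.opMap w)) (State.sndL H (State.rot (J (Y s)))) =
      A.pivot (State.sndL H (Y s)) w := fun s w => by
    rw [pivot, ofH2_eq, halfInv_symm _ (A.halfInv _) , State.sndL_rot, State.fstL_waveInv, neg_neg]
    rfl
  simp only [p1, p2] at h
  exact h

/-- The right-hand side of the identity is the same for both solutions when the test function is a
free wave, and the wave group allows its state at time `t` to be prescribed. Zero velocity isolates
`y' t`; zero displacement then isolates `y t`, tested on the range of `A^{-1/2}`. -/
theorem IsTranspositionSolution.eq_of_eq {T : ℝ} {F F' : ℝ → A.H2 → 𝕜} {y₀ : H} {y₁ : A.H2 → 𝕜}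
    {y z : ℝ → H} {y' z' : ℝ → A.H2 → 𝕜} (hy : A.IsTranspositionSolution T F y₀ y₁ y y')
    (hz : A.IsTranspositionSolution T F' y₀ y₁ z z') (hF : ∀ s ∈ Icc 0 T, F s = F' s) {t : ℝ}
    (ht : t ∈ Icc 0 T) : y t = z t ∧ y' t = z' t := by
  have key : ∀ x : State H, y' t (A.equivH2.symm (-State.fstL H x)) -
      inner 𝕜 (State.fstL H (State.waveInv A.realHalfInv x)) (y t) =
      z' t (A.equivH2.symm (-State.fstL H x)) -
      inner 𝕜 (State.fstL H (State.waveInv A.realHalfInv x)) (z t) := fun x => by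
    have hs := A.isStrictSolution_free (A.waveGroup.toFun (-t) x) t
    have h1 := hy t ht _ _ _ hs
    have h2 := hz t ht _ _ _ hs
    simp only [A.waveGroup.map_map_neg, inner_zero_left, sub_zero] at h1 h2
    rw [h1, h2]
    congr 1
    refine intervalIntegral.integral_congr fun s hs => ?_
    rw [uIcc_of_le ht.1] at hs
    simp only [hF s ⟨hs.1, hs.2.trans ht.2⟩]
  have hy' : y' t = z' t := funext fun w => by
    have := key (State.mk (-A.opMap w) 0)
    simpa [← A.equivH2_apply] using this
  refine ⟨A.halfInv_injective (ext_inner_left 𝕜 fun v => ?_), hy'⟩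
  have := key (State.mk 0 (-v))
  rw [hy', sub_right_inj] at this
  simp only [State.fstL_waveInv, State.sndL_mk, map_neg, neg_neg, realHalfInv_apply] at this
  rw [← halfInv_symm, this, halfInv_symm]

end CoerciveOperator

end Cascade

end

/-! ### Return to the spaces `H₂`, `H₁`, `H`, `H₋₁`. -/

noncomputable section

set_option linter.unusedSectionVars false

namespace Cascade

open Filter Topology Set
open scoped RealInnerProductSpace

namespace CoerciveOperator

variable {𝕜 H G : Type*} [RCLike 𝕜]
  [NormedAddCommGroup H] [InnerProductSpace 𝕜 H] [CompleteSpace H]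
  [NormedAddCommGroup G] [InnerProductSpace 𝕜 G] [CompleteSpace G]
  (A : CoerciveOperator 𝕜 H)

/-- `H` as the space of duality products with `A^{1/2} w`. -/
def toHNeg1 : H →L[𝕜] A.HNeg1 :=
  LinearMap.mkContinuous
    { toFun := fun q => (((innerSL 𝕜).flip q).comp A.equivH1.toContinuousLinearEquiv.toContinuousLinearMap)
      map_add' := fun q r => by ext w; simp
      map_smul' := fun c q => by ext w; simp } 1 fun q => by
    rw [one_mul]
    refine ContinuousLinearMap.opNorm_le_bound _ (norm_nonneg _) fun w => ?_
    have := norm_inner_le_norm (𝕜 := 𝕜) (A.equivH1 w) q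
    rw [A.equivH1.norm_map, mul_comm] at this
    simpa using this

theorem toHNeg1_apply (q : H) (w : A.H1) : A.toHNeg1 q w = inner 𝕜 (A.halfMap w) q := rfl

/-- Riesz representation carried over by the isometry `A^{1/2} : H₁ → H`; formally `φ = A^{1/2} q`.
-/
theorem exists_toHNeg1_eq (φ : A.HNeg1) : ∃ q, A.toHNeg1 q = φ := by
  let g : StrongDual 𝕜 H := LinearMap.mkContinuous
    { toFun := fun z => (starRingEnd 𝕜) (φ (A.equivH1.symm z))
      map_add' := fun x y => by simp
      map_smul' := fun c x => by simp } ‖φ‖ fun z => by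
    have := φ.le_opNorm (A.equivH1.symm z)
    rw [A.equivH1.symm.norm_map] at this
    simpa using this
  refine ⟨(InnerProductSpace.toDual 𝕜 H).symm g, ?_⟩
  ext w
  rw [toHNeg1_apply, ← inner_conj_symm, InnerProductSpace.toDual_symm_apply]
  change (starRingEnd 𝕜) ((starRingEnd 𝕜) (φ (A.equivH1.symm (A.equivH1 w)))) = φ w
  rw [RingHomCompTriple.comp_apply, RingHom.id_apply, A.equivH1.symm_apply_apply]

/-- The adjoint of `B ∈ L(G, H₂')` as a bounded operator on `H ≅ H₂`. -/
def dualAdjointL (B : G →L[𝕜] A.H2Dual) : H →L[𝕜] G :=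
  LinearMap.mkContinuous
    { toFun := fun z => A.dualAdjoint B (A.equivH2.symm z)
      map_add' := fun x y => ext_inner_right 𝕜 fun g => by
        simp [inner_add_left, inner_dualAdjoint]
      map_smul' := fun c x => ext_inner_right 𝕜 fun g => by
        simp [inner_smul_left, inner_dualAdjoint] } ‖B‖ fun z => by
    change ‖A.dualAdjoint B (A.equivH2.symm z)‖ ≤ _
    rw [dualAdjoint, LinearIsometryEquiv.norm_map]
    have := B.flip.le_opNorm (A.equivH2.symm z)
    rwa [A.equivH2.symm.norm_map, ContinuousLinearMap.opNorm_flip] at this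

theorem dualAdjointL_apply (B : G →L[𝕜] A.H2Dual) (z : H) :
    A.dualAdjointL B z = A.dualAdjoint B (A.equivH2.symm z) := rfl

/-- Formally `B = A 𝔅`, where the bounded operator `𝔅 = A⁻¹ B` is the adjoint of `B* A⁻¹`. The
source `B v` thus takes the form `A b` with `b = 𝔅 v`. -/
theorem apply_eq_inner_adjoint (B : G →L[𝕜] A.H2Dual) (g : G) (w : A.H2) :
    B g w = inner 𝕜 (A.opMap w) (ContinuousLinearMap.adjoint (A.dualAdjointL B) g) := by
  rw [ContinuousLinearMap.adjoint_inner_right, dualAdjointL_apply, ← A.equivH2_apply,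
    LinearIsometryEquiv.symm_apply_apply, inner_dualAdjoint]

theorem pivot_injective {u v : H} (h : A.pivot u = A.pivot v) : u = v :=
  A.halfInv_injective <| A.halfInv_injective <| ext_inner_left 𝕜 fun z => by
    have := congrFun h (A.equivH2.symm z)
    simp only [pivot, ofH2_eq, opMap_symm] at this
    rw [← halfInv_symm, ← halfInv_symm, this, halfInv_symm, halfInv_symm]

theorem pivotNeg1_injective {φ ψ : A.HNeg1} (h : A.pivotNeg1 φ = A.pivotNeg1 ψ) : φ = ψ := by
  obtain ⟨p, rfl⟩ := A.exists_toHNeg1_eq φ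
  obtain ⟨q, rfl⟩ := A.exists_toHNeg1_eq ψ
  have : p = q := A.halfInv_injective <| ext_inner_left 𝕜 fun z => by
    have := congrFun h (A.equivH2.symm z)
    simp only [pivotNeg1, toHNeg1_apply, halfMap_inclH2H1, opMap_symm] at this
    rwa [halfInv_symm, halfInv_symm] at this
  rw [this]

theorem memLp_Ioo_of_Ioc {v : ℝ → G} {T : ℝ} (hv : MemLp v 2 (volume.restrict (Ioc 0 T))) :
    MemLp v 2 (volume.restrict (Ioo 0 T)) :=
  hv.mono_measure (Measure.restrict_mono Ioo_subset_Ioc_self le_rfl)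

variable [InnerProductSpace ℝ H] [InnerProductSpace ℝ G]

/-- Here the states of the abstract system are `(A^{1/2} y₁, y₁')` and `(y₂, A^{-1/2} y₂')`. -/
theorem exists_unbounded_control {C P : H →L[𝕜] H} (hC : A.PartiallyCoercive C P)
    {T₁ T₂ : ℝ} (hT₁ : 0 < T₁) (hT₂ : 0 < T₂) (hP : A.Observable (fun _ w' => P w') T₂)
    (B : G →L[𝕜] A.H2Dual) (hadm : A.Admissible (A.unboundedObs B))
    (hob : A.Observable (A.unboundedObs B) T₁) :
    ∃ Tstar : ℝ, max T₁ T₂ ≤ Tstar ∧ ∀ T : ℝ, Tstar < T →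
      ∀ (a₁ : A.H1) (a₂ : H) (b₁ : H) (b₂ : A.HNeg1),
      ∃ v : ℝ → G, MemLp v 2 (volume.restrict (Ioo 0 T)) ∧
        ∃ y₁ y₂ z₁ z₂, A.IsUnboundedCascadeSolution C B T v a₁ a₂ b₁ b₂ y₁ y₂ z₁ z₂ ∧
          y₁ T = 0 ∧ y₂ T = 0 ∧ z₁ T = 0 ∧ z₂ T = 0 := by
  set 𝔅 : G →L[𝕜] H := ContinuousLinearMap.adjoint (A.dualAdjointL B) with h𝔅
  -- The signs follow from `w = -A⁻¹ p` for an adjoint state `(p, q)`: then `B* w` is `-B* A⁻¹ p`,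
  -- and the adjoint of this observation is `g ↦ (-𝔅 g, 0)`.
  let D : G →L[ℝ] State H := State.pair (-𝔅.restrictScalars ℝ) 0
  let O : State H →L[ℝ] G := -((A.dualAdjointL B).restrictScalars ℝ).comp (State.fstL H)
  obtain ⟨Tstar, hTs, h⟩ := A.exists_state_control (O := O) (D := D) (fun ψ => by
      change ‖A.dualAdjointL B (-State.fstL H ψ)‖ = ‖-(A.dualAdjointL B (State.fstL H ψ))‖
      rw [map_neg]) (fun x g => by
      have : ⟪A.dualAdjointL B (State.fstL H x), g⟫ = ⟪State.fstL H x, 𝔅 g⟫ :=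
        real_inner_eq_of_inner_eq (ContinuousLinearMap.adjoint_inner_right _ _ _).symm
      rw [State.inner_def]
      simp only [D, State.fstL_pair, State.sndL_pair]
      change ⟪-(A.dualAdjointL B (State.fstL H x)), g⟫ = ⟪_, -𝔅 g⟫ + ⟪_, (0 : H)⟫
      rw [inner_neg_left, this, inner_neg_right, inner_zero_right, add_zero])
    hC hT₁ hT₂ hP hadm hob
  refine ⟨Tstar, hTs, fun T hT a₁ a₂ b₁ b₂ => ?_⟩
  have hT0 : 0 ≤ T := hT₁.le.trans ((le_max_left _ _).trans (hTs.trans hT.le))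
  obtain ⟨β, hβ⟩ := A.exists_toHNeg1_eq b₂
  obtain ⟨v, hv, Y₁, Y₂, hY₁c, hY₂c, hY₁0, hY₂0, hY₁, hY₂, hY₁T, hY₂T⟩ :=
    h T hT (State.mk (A.halfMap a₁) b₁) (State.mk a₂ β)
  have hp₂ : ContinuousOn (fun t => State.fstL H (Y₂ t)) (Icc 0 T) :=
    (State.fstL H).continuous.comp_continuousOn hY₂c
  refine ⟨v, memLp_Ioo_of_Ioc hv, fun t => A.equivH1.symm (State.fstL H (Y₁ t)),
    fun t => State.fstL H (Y₂ t), fun t => State.sndL H (Y₁ t),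
    fun t => A.toHNeg1 (State.sndL H (Y₂ t)), ⟨?_, hp₂, ?_, ?_, ?_, ?_⟩, ?_, ?_, ?_, ?_⟩
  · exact A.equivH1.symm.continuous.comp_continuousOn
      ((State.fstL H).continuous.comp_continuousOn hY₁c)
  · exact (State.sndL H).continuous.comp_continuousOn hY₁c
  · exact A.toHNeg1.continuous.comp_continuousOn ((State.sndL H).continuous.comp_continuousOn hY₂c)
  · have := A.isTranspositionSolution_of_mild hT0 hY₁c
      (x := fun s => ContinuousLinearMap.adjoint C (State.fstL H (Y₂ s)))
      ((ContinuousLinearMap.adjoint C).continuous.comp_continuousOn hp₂)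
      (fun s _ => by rw [hY₁0]; exact hY₁ s)
    simpa only [hY₁0, State.fstL_mk, State.sndL_mk, ← A.ofH1_eq, ofH1_symm] using this
  · have hbi : IntervalIntegrable (fun s => 𝔅 (v s)) volume 0 T :=
      intervalIntegrable_clm_comp (𝔅.restrictScalars ℝ) (by
        rw [intervalIntegrable_iff_integrableOn_Ioc_of_le hT0]
        exact hv.integrable one_le_two)
    have := A.isTranspositionSolution_of_state hY₂c hbi
      (fun s hs => by rw [hY₂0]; exact hY₂ s hs)
    simp only [hY₂0, State.fstL_mk, State.sndL_mk] at this
    have e1 : ∀ q, A.pivotNeg1 (A.toHNeg1 q) = fun w => inner 𝕜 (A.halfInv (A.opMap w)) q :=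
      fun q => funext fun w => by rw [pivotNeg1, toHNeg1_apply, halfMap_inclH2H1]
    simpa only [A.apply_eq_inner_adjoint, ← hβ, e1] using this
  all_goals simp only [hY₁T, hY₂T, map_zero]

/-- The abstract result is applied to the system differentiated in time, with states `(A^{1/2} y₁',
y₁'')` and `(y₂', -A^{1/2} y₂)`. The displacement `y₁` is recovered from `A y₁ = -y₁'' - C* y₂`. -/
theorem exists_bounded_control {C P : H →L[𝕜] H} (hC : A.PartiallyCoercive C P)
    {T₁ T₂ : ℝ} (hT₁ : 0 < T₁) (hT₂ : 0 < T₂) (hP : A.Observable (fun _ w' => P w') T₂)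
    (B : G →L[𝕜] H) (hadm : A.Admissible (A.boundedObs B))
    (hob : A.Observable (A.boundedObs B) T₁) :
    ∃ Tstar : ℝ, max T₁ T₂ ≤ Tstar ∧ ∀ T : ℝ, Tstar < T →
      ∀ (a₁ : A.H2) (a₂ : A.H1) (b₁ : A.H1) (b₂ : H),
      ∃ v : ℝ → G, MemLp v 2 (volume.restrict (Ioo 0 T)) ∧
        ∃ y₁ y₂ z₁ z₂, A.IsBoundedCascadeSolution C B T v a₁ a₂ b₁ b₂ y₁ y₂ z₁ z₂ ∧
          y₁ T = 0 ∧ y₂ T = 0 ∧ z₁ T = 0 ∧ z₂ T = 0 := by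
  set Q := A.realHalfInv with hQ
  set C' : H →L[𝕜] H := ContinuousLinearMap.adjoint C with hC'
  -- For an adjoint state `(p, q)` the velocity is `w' = -Q q`, so up to sign `O` observes `B* w'`.
  -- Since `J⁻¹ (0, Q B g) = (B g, 0)`, the control acts on `y₂''`.
  let D : G →L[ℝ] State H := State.pair 0 (Q.comp (B.restrictScalars ℝ))
  let O : State H →L[ℝ] G := ((ContinuousLinearMap.adjoint B).restrictScalars ℝ).comp
    (Q.comp (State.sndL H))
  obtain ⟨Tstar, hTs, h⟩ := A.exists_state_control (O := O) (D := D) (fun ψ => by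
      change ‖ContinuousLinearMap.adjoint B (-Q (State.sndL H ψ))‖ =
        ‖ContinuousLinearMap.adjoint B (Q (State.sndL H ψ))‖
      rw [map_neg, norm_neg]) (fun x g => by
      have : ⟪ContinuousLinearMap.adjoint B (Q (State.sndL H x)), g⟫ = ⟪Q (State.sndL H x), B g⟫ :=
        real_inner_eq_of_inner_eq (ContinuousLinearMap.adjoint_inner_left _ _ _)
      rw [State.inner_def]
      change ⟪ContinuousLinearMap.adjoint B (Q (State.sndL H x)), g⟫ =
        ⟪_, (0 : H)⟫ + ⟪State.sndL H x, Q (B g)⟫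
      rw [this, inner_zero_right, zero_add, A.realHalfInv_symm])
    hC hT₁ hT₂ hP hadm hob
  refine ⟨Tstar, hTs, fun T hT a₁ a₂ b₁ b₂ => ?_⟩
  have hT0 : 0 ≤ T := hT₁.le.trans ((le_max_left _ _).trans (hTs.trans hT.le))
  -- The second component is `y₁''` at time `0`, read off from the first equation.
  set Z₁ : State H := State.mk (A.halfMap b₁) (-A.opMap a₁ - C' (A.ofH1 a₂)) with hZ₁
  set Z₂ : State H := State.mk b₂ (-A.halfMap a₂) with hZ₂
  obtain ⟨v, hv, Y₁, Y₂, hY₁c, hY₂c, hY₁0, hY₂0, hY₁, hY₂, hY₁T, hY₂T⟩ := h T hT Z₁ Z₂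
  set J := State.waveInv Q with hJ
  have hp₂ : ContinuousOn (fun t => State.fstL H (Y₂ t)) (Icc 0 T) :=
    (State.fstL H).continuous.comp_continuousOn hY₂c
  have hq₂ : ContinuousOn (fun t => State.sndL H (Y₂ t)) (Icc 0 T) :=
    (State.sndL H).continuous.comp_continuousOn hY₂c
  have hvi : IntervalIntegrable v volume 0 T := by
    rw [intervalIntegrable_iff_integrableOn_Ioc_of_le hT0]
    exact hv.integrable one_le_two
  have hDi : IntervalIntegrable (fun s => D (v s)) volume 0 T := intervalIntegrable_clm_comp D hvi
  -- the displacement `y₂` and its derivative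
  set x₂ : ℝ → H := fun t => -Q (State.sndL H (Y₂ t)) with hx₂
  have hx₂d : ∀ t ∈ Icc 0 T, HasDerivWithinAt x₂ (State.fstL H (Y₂ t)) (Icc 0 T) t := by
    have hx₂i : ∀ t ∈ Icc 0 T, x₂ t = x₂ 0 + ∫ s in (0 : ℝ)..t, State.fstL H (Y₂ s) := by
      intro t ht
      have hsub : Icc 0 t ⊆ Icc 0 T := Icc_subset_Icc le_rfl ht.2
      have hpi : IntervalIntegrable (fun s => State.fstL H (Y₂ s)) volume 0 t :=
        (hp₂.mono hsub).intervalIntegrable_of_Icc ht.1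
      refine ext_inner_left ℝ fun h => ?_
      -- Testing with the constant `(h, 0)` extracts the first component of the equation for `J Y₂`.
      -- The control is absent there, because `D` has zero first component, so `x₂` is
      -- differentiable although `v` is only in `L²`.
      have key := A.waveGroup.inner_sub_inner_eq_integral (State.waveInv_skew A.realHalfInv_symm)
        ht.1 (hY₂c.mono hsub)
        (hDi.mono_set (by rwa [uIcc_of_le ht.1, uIcc_of_le hT0]))
        (fun s hs => by rw [hY₂0]; exact hY₂ s (hsub hs))
        (Θ := fun _ => State.mk h 0) (F := fun _ => -State.mk h 0) continuousOn_const
        intervalIntegrable_const (fun s hs => by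
          have := A.waveGroup.map_eq_of_hasDerivWithinAt hs.1 (x := fun _ => State.mk h 0)
            (x' := fun _ => 0) (fun r _ => hasDerivWithinAt_const _ _ _) continuousOn_const
          simpa using this)
      simp only [State.inner_def, State.fstL_mk, State.sndL_mk, State.fstL_waveInv,
        State.sndL_waveInv, map_zero, neg_zero, inner_zero_right, zero_add, add_zero,
        inner_neg_right, ← hQ] at key
      have e0 : ∀ s, State.fstL H (D (v s)) = 0 := fun s => rfl
      simp only [e0, inner_zero_left, sub_zero, intervalIntegral.integral_neg] at key
      have e1 : ⟪h, ∫ s in (0 : ℝ)..t, State.fstL H (Y₂ s)⟫ =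
          ∫ s in (0 : ℝ)..t, ⟪State.fstL H (Y₂ s), h⟫ := by
        refine ((innerSL ℝ h).intervalIntegral_comp_comm hpi).symm.trans ?_
        exact intervalIntegral.integral_congr fun s _ => real_inner_comm _ _
      have e2 : ∀ s, ⟪h, x₂ s⟫ = -⟪State.sndL H (Y₂ s), Q h⟫ := fun s => by
        rw [hx₂, inner_neg_right, real_inner_comm, A.realHalfInv_symm]
      rw [inner_add_right, e1, e2, e2]
      linarith
    intro t ht
    have : Fact (t ∈ Icc 0 T) := ⟨ht⟩
    have hd : HasDerivWithinAt (fun t => ∫ s in (0 : ℝ)..t, State.fstL H (Y₂ s))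
        (State.fstL H (Y₂ t)) (Icc 0 T) t :=
      intervalIntegral.integral_hasDerivWithinAt_right
        ((hp₂.mono (Icc_subset_Icc le_rfl ht.2)).intervalIntegrable_of_Icc ht.1)
        (hp₂.stronglyMeasurableAtFilter_nhdsWithin measurableSet_Icc t) (hp₂ t ht)
    exact (hd.const_add (x₂ 0)).congr hx₂i (hx₂i t ht)
  have hx₂c : ContinuousOn x₂ (Icc 0 T) := fun t ht => (hx₂d t ht).continuousWithinAt
  have hx₂0 : x₂ 0 = A.ofH1 a₂ := by
    simp only [hx₂, hY₂0, hZ₂, State.sndL_mk, map_neg, neg_neg]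
    exact (A.ofH1_eq a₂).symm
  have hC'x : ContinuousOn (fun t => C' (x₂ t)) (Icc 0 T) := C'.continuous.comp_continuousOn hx₂c
  -- the state `(A^{1/2} y₁, y₁')`
  set g : ℝ → State H := fun t => State.mk 0 (-C' (x₂ t)) with hg
  set g' : ℝ → State H := fun t => State.dualCoupling (C'.restrictScalars ℝ) (Y₂ t) with hg'
  have hgd : ∀ t ∈ Icc 0 T, HasDerivWithinAt g (g' t) (Icc 0 T) t := fun t ht =>
    State.hasDerivWithinAt_mk (hasDerivWithinAt_const _ _ _)
      ((-(C'.restrictScalars ℝ)).hasFDerivAt.comp_hasDerivWithinAt t (hx₂d t ht))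
  have hgc : ContinuousOn g (Icc 0 T) := fun t ht => (hgd t ht).continuousWithinAt
  have hg'c : ContinuousOn g' (Icc 0 T) :=
    (State.dualCoupling (C'.restrictScalars ℝ)).continuous.comp_continuousOn hY₂c
  -- Subtracting `g = (0, -C* y₂)` from `Y₁` leaves `(A^{1/2} y₁', -A y₁)`, which `J` maps to
  -- `(A^{1/2} y₁, y₁')`. Integration by parts in time turns the differentiated source `g'` back
  -- into `g`.
  set V : ℝ → State H := fun t => J (Y₁ t - g t) with hV
  have hVc : ContinuousOn V (Icc 0 T) := J.continuous.comp_continuousOn (hY₁c.sub hgc)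
  have hVmild : ∀ t ∈ Icc 0 T, V t = A.waveGroup.toFun t (V 0 + A.waveGroup.source g t) := by
    intro t ht
    have hsub : Icc 0 t ⊆ Icc 0 T := Icc_subset_Icc le_rfl ht.2
    rw [A.waveGroup.source_eq_of_hasDerivWithinAt ht.1
      (fun s hs => (hgd s (hsub hs)).mono hsub) (hg'c.mono hsub)]
    simp only [hV]
    rw [hY₁ t, hY₁0]
    simp only [map_sub, map_add, A.waveGroup.map_map_neg, ← hQ, ← hJ]
    rw [← A.waveGroup.comm_self t Z₁, ← A.waveGroup.comm_self t (A.waveGroup.source g' t)]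
    abel
  have hV0 : V 0 = State.mk (A.halfMap (A.inclH2H1 a₁)) (A.ofH1 b₁) := by
    simp only [hV, hY₁0]
    refine State.ext ?_ ?_
    · simp [hJ, hg, hZ₁, hx₂0, halfMap_inclH2H1, hQ, realHalfInv_apply]
    · simp [hJ, hg, hZ₁, ofH1_eq, hQ, realHalfInv_apply]
  refine ⟨v, memLp_Ioo_of_Ioc hv,
    fun t => A.equivH2.symm (-State.sndL H (Y₁ t) - C' (x₂ t)),
    fun t => A.equivH1.symm (-State.sndL H (Y₂ t)),
    fun t => A.equivH1.symm (State.fstL H (Y₁ t)),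
    fun t => State.fstL H (Y₂ t), ⟨?_, ?_, ?_, hp₂, ?_, ?_⟩, ?_, ?_, ?_, ?_⟩
  · exact A.equivH2.symm.continuous.comp_continuousOn
      (((State.sndL H).continuous.comp_continuousOn hY₁c).neg.sub hC'x)
  · exact A.equivH1.symm.continuous.comp_continuousOn hq₂.neg
  · exact A.equivH1.symm.continuous.comp_continuousOn
      ((State.fstL H).continuous.comp_continuousOn hY₁c)
  · have := A.isTranspositionSolution_of_mild hT0 hVc hC'x hVmild
    have e1 : ∀ t, A.halfInv (State.fstL H (V t)) =
        A.ofH2 (A.equivH2.symm (-State.sndL H (Y₁ t) - C' (x₂ t))) := fun t => by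
      rw [ofH2_eq, opMap_symm]
      simp [hV, hJ, hg, hQ, realHalfInv_apply]
    have e2 : ∀ t, State.sndL H (V t) = A.ofH1 (A.equivH1.symm (State.fstL H (Y₁ t))) := fun t => by
      rw [ofH1_symm]
      simp [hV, hJ, hg, hQ, realHalfInv_apply]
    have e3 : ∀ t, A.ofH1 (A.equivH1.symm (-State.sndL H (Y₂ t))) = x₂ t := fun t => by
      rw [ofH1_symm, map_neg]; rfl
    simp only [hV0, State.fstL_mk, State.sndL_mk, halfMap_inclH2H1, ← ofH2_eq] at this
    simp only [e1, e2] at this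
    simp only [e3]
    exact this
  · have hbi : IntervalIntegrable (fun s => Q (Q (B (v s)))) volume 0 T :=
      intervalIntegrable_clm_comp (Q.comp (Q.comp (B.restrictScalars ℝ))) hvi
    have := A.isTranspositionSolution_of_state (Y := fun t => J (Y₂ t))
      (J.continuous.comp_continuousOn hY₂c) hbi (fun s hs => by
        have e1 : (fun r => State.mk (-Q (Q (B (v r)))) (0 : H)) = fun r => J (D (v r)) :=
          funext fun r => by
            refine State.ext ?_ ?_
            · rfl
            · simp [hJ, D]
        rw [e1, ← A.waveGroup.map_source (hDi.mono_set (by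
          rw [uIcc_of_le hs.1, uIcc_of_le hT0]; exact Icc_subset_Icc le_rfl hs.2)) (fun _ => rfl)]
        change J (J (Y₂ s)) = A.waveGroup.toFun s
          (J (J (Y₂ 0)) + J (A.waveGroup.source (fun r => D (v r)) s))
        rw [← map_add, A.waveGroup.comm_self, hY₂0]
        exact congrArg J (hY₂ s hs))
    have e1 : ∀ g w, inner 𝕜 (A.opMap w) (Q (Q (B g))) = A.pivot (B g) w := fun g w => by
      rw [pivot, ofH2_eq, halfInv_symm, halfInv_symm]; rfl
    have e2 : ∀ t w, inner 𝕜 (A.halfInv (A.opMap w)) (State.sndL H (J (Y₂ t))) =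
        A.pivot (State.fstL H (Y₂ t)) w := fun t w => by
      rw [pivot, ofH2_eq, halfInv_symm _ (A.halfInv _)]; rfl
    have e3 : ∀ t, A.ofH1 (A.equivH1.symm (-State.sndL H (Y₂ t))) = x₂ t := fun t => by
      rw [ofH1_symm, map_neg]; rfl
    have e4 : ∀ t, State.fstL H (J (Y₂ t)) = x₂ t := fun t => rfl
    simp only [e1, e2, e4, hx₂0] at this
    simp only [hY₂0, hZ₂, State.fstL_mk] at this
    simp only [e3]
    exact this
  all_goals simp only [hx₂, hY₁T, hY₂T, map_zero, neg_zero, sub_zero]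

end CoerciveOperator

end Cascade

end

/-! ### Uniqueness for the cascade, and the theorem. -/

noncomputable section

set_option linter.unusedSectionVars false

namespace Cascade

open Filter Topology Set

namespace CoerciveOperator

variable {𝕜 H G : Type*} [RCLike 𝕜]
  [NormedAddCommGroup H] [InnerProductSpace 𝕜 H] [CompleteSpace H]
  [NormedAddCommGroup G] [InnerProductSpace 𝕜 G] [CompleteSpace G]
  {A : CoerciveOperator 𝕜 H} [InnerProductSpace ℝ H]

/-- The second equation does not involve `y₁`, so it determines `y₂` and `z₂`; the sources of the
first equation then agree on `[0, T]`. -/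
theorem IsBoundedCascadeSolution.eqOn {C : H →L[𝕜] H} {B : G →L[𝕜] H} {T : ℝ} {v : ℝ → G}
    {a₁ : A.H2} {a₂ b₁ : A.H1} {b₂ : H} {y₁ y₁' : ℝ → A.H2} {y₂ y₂' z₁ z₁' : ℝ → A.H1}
    {z₂ z₂' : ℝ → H} (h : A.IsBoundedCascadeSolution C B T v a₁ a₂ b₁ b₂ y₁ y₂ z₁ z₂)
    (h' : A.IsBoundedCascadeSolution C B T v a₁ a₂ b₁ b₂ y₁' y₂' z₁' z₂') :
    EqOn y₁ y₁' (Icc 0 T) ∧ EqOn y₂ y₂' (Icc 0 T) ∧ EqOn z₁ z₁' (Icc 0 T) ∧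
      EqOn z₂ z₂' (Icc 0 T) := by
  have hy₂ : EqOn y₂ y₂' (Icc 0 T) := fun t ht =>
    A.ofH1_injective (h.eq₂.eq_of_eq A h'.eq₂ (fun _ _ => rfl) ht).1
  have h₁ {t} (ht : t ∈ Icc 0 T) := h.eq₁.eq_of_eq A h'.eq₁ (fun s hs => by rw [hy₂ hs]) ht
  exact ⟨fun t ht => A.ofH2_injective (h₁ ht).1, hy₂,
    fun t ht => A.ofH1_injective (A.pivot_injective (h₁ ht).2),
    fun t ht => A.pivot_injective (h.eq₂.eq_of_eq A h'.eq₂ (fun _ _ => rfl) ht).2⟩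

theorem IsUnboundedCascadeSolution.eqOn {C : H →L[𝕜] H} {B : G →L[𝕜] A.H2Dual} {T : ℝ}
    {v : ℝ → G} {a₁ : A.H1} {a₂ b₁ : H} {b₂ : A.HNeg1} {y₁ y₁' : ℝ → A.H1}
    {y₂ y₂' z₁ z₁' : ℝ → H} {z₂ z₂' : ℝ → A.HNeg1}
    (h : A.IsUnboundedCascadeSolution C B T v a₁ a₂ b₁ b₂ y₁ y₂ z₁ z₂)
    (h' : A.IsUnboundedCascadeSolution C B T v a₁ a₂ b₁ b₂ y₁' y₂' z₁' z₂') :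
    EqOn y₁ y₁' (Icc 0 T) ∧ EqOn y₂ y₂' (Icc 0 T) ∧ EqOn z₁ z₁' (Icc 0 T) ∧
      EqOn z₂ z₂' (Icc 0 T) := by
  have hy₂ : EqOn y₂ y₂' (Icc 0 T) := fun t ht =>
    (h.eq₂.eq_of_eq A h'.eq₂ (fun _ _ => rfl) ht).1
  have h₁ {t} (ht : t ∈ Icc 0 T) := h.eq₁.eq_of_eq A h'.eq₁ (fun s hs => by rw [hy₂ hs]) ht
  exact ⟨fun t ht => A.ofH1_injective (h₁ ht).1, hy₂,
    fun t ht => A.pivot_injective (h₁ ht).2,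
    fun t ht => A.pivotNeg1_injective (h.eq₂.eq_of_eq A h'.eq₂ (fun _ _ => rfl) ht).2⟩

end CoerciveOperator

end Cascade

end

theorem theorem2p1 {𝕜 H G : Type*} [RCLike 𝕜]
    [NormedAddCommGroup H] [InnerProductSpace 𝕜 H] [CompleteSpace H]
    [NormedAddCommGroup G] [InnerProductSpace 𝕜 G] [CompleteSpace G]
    (A : Cascade.CoerciveOperator 𝕜 H) (C P : H →L[𝕜] H) (hC : A.PartiallyCoercive C P)
    (T₁ T₂ : ℝ) (hT₁ : 0 < T₁) (hT₂ : 0 < T₂)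
    (hP : A.Observable (fun _ w' => P w') T₂) :
    (∀ B : G →L[𝕜] H, A.Admissible (A.boundedObs B) → A.Observable (A.boundedObs B) T₁ →
      ∃ Tstar : ℝ, max T₁ T₂ ≤ Tstar ∧ ∀ T : ℝ, Tstar < T →
        ∀ (a₁ : A.H2) (a₂ : A.H1) (b₁ : A.H1) (b₂ : H),
        ∃ v : ℝ → G, MeasureTheory.MemLp v 2 (MeasureTheory.volume.restrict (Set.Ioo 0 T)) ∧
          ∃ y₁ y₂ z₁ z₂, A.IsBoundedCascadeSolution C B T v a₁ a₂ b₁ b₂ y₁ y₂ z₁ z₂ ∧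
            (∀ y₁' y₂' z₁' z₂',
              A.IsBoundedCascadeSolution C B T v a₁ a₂ b₁ b₂ y₁' y₂' z₁' z₂' →
                Set.EqOn y₁' y₁ (Set.Icc 0 T) ∧ Set.EqOn y₂' y₂ (Set.Icc 0 T) ∧
                Set.EqOn z₁' z₁ (Set.Icc 0 T) ∧ Set.EqOn z₂' z₂ (Set.Icc 0 T)) ∧
            y₁ T = 0 ∧ y₂ T = 0 ∧ z₁ T = 0 ∧ z₂ T = 0) ∧
    (∀ B : G →L[𝕜] A.H2Dual, A.Admissible (A.unboundedObs B) →
      A.Observable (A.unboundedObs B) T₁ →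
      ∃ Tstar : ℝ, max T₁ T₂ ≤ Tstar ∧ ∀ T : ℝ, Tstar < T →
        ∀ (a₁ : A.H1) (a₂ : H) (b₁ : H) (b₂ : A.HNeg1),
        ∃ v : ℝ → G, MeasureTheory.MemLp v 2 (MeasureTheory.volume.restrict (Set.Ioo 0 T)) ∧
          ∃ y₁ y₂ z₁ z₂, A.IsUnboundedCascadeSolution C B T v a₁ a₂ b₁ b₂ y₁ y₂ z₁ z₂ ∧
            (∀ y₁' y₂' z₁' z₂',
              A.IsUnboundedCascadeSolution C B T v a₁ a₂ b₁ b₂ y₁' y₂' z₁' z₂' →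
                Set.EqOn y₁' y₁ (Set.Icc 0 T) ∧ Set.EqOn y₂' y₂ (Set.Icc 0 T) ∧
                Set.EqOn z₁' z₁ (Set.Icc 0 T) ∧ Set.EqOn z₂' z₂ (Set.Icc 0 T)) ∧
            y₁ T = 0 ∧ y₂ T = 0 ∧ z₁ T = 0 ∧ z₂ T = 0) := by
  -- The group and duality arguments are real; the auxiliary real inner products are the real parts
  -- of the given ones.
  let : InnerProductSpace ℝ H := InnerProductSpace.rclikeToReal 𝕜 H
  let : InnerProductSpace ℝ G := InnerProductSpace.rclikeToReal 𝕜 G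
  refine ⟨fun B hadm hob => ?_, fun B hadm hob => ?_⟩
  · obtain ⟨Tstar, hTs, h⟩ := A.exists_bounded_control hC hT₁ hT₂ hP B hadm hob
    refine ⟨Tstar, hTs, fun T hT a₁ a₂ b₁ b₂ => ?_⟩
    obtain ⟨v, hv, y₁, y₂, z₁, z₂, hy, hyT⟩ := h T hT a₁ a₂ b₁ b₂
    exact ⟨v, hv, y₁, y₂, z₁, z₂, hy, fun _ _ _ _ hy' => hy'.eqOn hy, hyT⟩
  · obtain ⟨Tstar, hTs, h⟩ := A.exists_unbounded_control hC hT₁ hT₂ hP B hadm hob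
    refine ⟨Tstar, hTs, fun T hT a₁ a₂ b₁ b₂ => ?_⟩
    obtain ⟨v, hv, y₁, y₂, z₁, z₂, hy, hyT⟩ := h T hT a₁ a₂ b₁ b₂
    exact ⟨v, hv, y₁, y₂, z₁, z₂, hy, fun _ _ _ _ hy' => hy'.eqOn hy, hyT⟩
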